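/- A mould is a family $P=\bigl(P(u_1,\dots,u_r)\bigr)_{r\ge 0}$ with $P(u_1,\dots,u_r)\in\mathbb{Q}(u_1,\dots,u_r)$ ("depth $r$"). Let $ARI$ (resp. $GARI$) be the set of moulds with $P(\emptyset)=0$ (resp. $P(\emptyset)=1$), and let $1$ denote the mould equal to $1$ in depth $0$ and $0$ in depths $r\ge 1$. For words write $\mathbf u=(u_1,\dots,u_r)$ and $|\mathbf b|$ for the sum of the letters of $\mathbf b$; $\lceil\mathbf c$ (resp. $\mathbf a\rceil$) is $\mathbf c$ (resp. $\mathbf a$) with $|\mathbf b|$ added to its first (resp. last) letter, in a factorization $\mathbf a\mathbf b\mathbf c$. Put $$(PQ)(\mathbf u)=\sum_{\mathbf u=\mathbf a\mathbf b}P(\mathbf a)Q(\mathbf b),\qquad [P,Q]=PQ-QP,\qquad ad(P)\cdot Q=[P,Q],$$ and let $P^{-1}$ be the inverse of $P\in GARI$ for this product. Define $$dar(P)(\mathbf u)=u_1\cdots u_r\,P(\mathbf u),\quad dur(P)(\mathbf u)=(u_1+\cdots+u_r)P(\mathbf u),\quad \Delta(P)(\mathbf u)=u_1\cdots u_r(u_1+\cdots+u_r)P(\mathbf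 u)$$ for $r\ge 1$, with $dar(P)(\emptyset)=\Delta(P)(\emptyset)=P(\emptyset)$ and $dur(P)(\emptyset)=0$, and, for $P\in GARI$, the $mu$-dilator $du\,P=P^{-1}\,dur(P)$. For $F\in ARI$ put $arit(F)\cdot M(\mathbf u)=\sum_{\mathbf u=\mathbf a\mathbf b\mathbf c,\ \mathbf c\neq\emptyset}M(\mathbf a\lceil\mathbf c)F(\mathbf b)-\sum_{\mathbf u=\mathbf a\mathbf b\mathbf c,\ \mathbf a\ne\emptyset}M(\mathbf a\rceil\mathbf c)F(\mathbf b)$, $preari(P,Q)=PQ+arit(Q)\cdot P$, and $exp_{ari}(P)=\sum_{n\ge0}\frac1{n!}preari(P,\dots,P)$ ($n$ arguments, composed from left to right, with value $1$ for $n=0$). For $P\in GARI$ put $$(garit(P)\cdot Q)(\mathbf u)=\sum_{s\ge 0}\ \sum_{\mathbf u=\mathbf a_1\mathbf b_1\mathbf c_1\cdots\mathbf a_s\mathbf b_s\mathbf c_s}Q(\lceil\mathbf b_1\rceil\cdots\lceil\mathbf b_s\rceil)\,P(\mathbf a_1)\cdots P(\mathbf a_s)\,P^{-1}(\mathbf c_1)\cdots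 P^{-1}(\mathbf c_s),$$ the sum being over cuttings with all $\mathbf b_i\ne\emptyset$ and all $\mathbf c_i\mathbf a_{i+1}\neq\emptyset$ ($1\le i<s$), where $\lceil\mathbf b_i\rceil$ is $\mathbf b_i$ with $|\mathbf a_i|$ added to its first and $|\mathbf c_i|$ to its last letter. Put $gari(P,Q)=(garit(Q)\cdot P)\,Q$. For $P\in ARI$ put $Darit(P)=-dar\circ\bigl(arit(\Delta^{-1}P)-ad(\Delta^{-1}P)\bigr)\circ dar^{-1}$, a linear operator on $ARI$, extended to $ARI\oplus\mathbb{Q}a$ ($a$ a formal generator) by $Darit(P)\cdot a=P$, and $exp_{Dari}(P)=1+\sum_{n\ge1}\frac1{n!}Darit(P)^{n-1}(P)$. **Proposition.** $(GARI,gari)$ is a group with neutral element $1$, and $exp_{ari}$, $exp_{Dari}$ are bijections $ARI\to GARI$; let $inv_{gari}$ be the inversion of this group and $log_{ari}$, $log_{Dari}$ the inverse bijections. For $P\in GARI$ put $Dgarit(P)=exp\bigl(Darit(log_{Dari}P)\bigr)$ on $ARI\oplus\mathbb{Q}a$ and define $Dgari$ on $GARI$ by $a-1+Dgari(P,Q)=Dgarit(P)\circ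 Dgarit(Q)\cdot a$. Then $(GARI,Dgari)$ is a group with neutral element $1$, and the map $\Delta^*=exp_{Dari}\circ\Delta\circ log_{ari}$ is a group isomorphism from $(GARI,gari)$ to $(GARI,Dgari)$, given for all $Q\in GARI$ by $$\Delta^*(Q)=1-dar\bigl(du\,inv_{gari}(Q)\bigr).$$ **Corollary.** Let $dupal\in ARI$ be the mould $dupal(u_1,\dots,u_r)=\frac{B_r}{r!}\frac1{u_1\cdots u_r}\sum_{j=0}^{r-1}(-1)^j\binom{r-1}{j}u_{j+1}$ (Bernoulli numbers with $B_1=-\frac12$), let $pal$ be the mould with $pal(\emptyset)=1$ and $dur(pal)=pal\;dupal$, and let $invpal=inv_{gari}(pal)$. Let $C_i=ad(a)^{i-1}(b)$ $(i\ge1)$ in the algebra of formal power series over $\mathbb{Q}$ in the non-commuting variables $a,b$, let $\mathbb{Q}\langle C\rangle$ be the space of power series in the $C_i$ that are polynomials in each depth (number of factors $C_i$), and let $ma$ be the linear map from $\mathbb{Q}\langle C\rangle$ to moulds, applied depth by depth, with $ma(C_{k_1}\cdots C_{k_r})=(-1)^{k_1+\cdots+k_r-r}u_1^{k_1-1}\cdots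 u_r^{k_r-1}$. With $Ber_x=\frac{ad(x)}{\exp(ad(x))-1}=\sum_{n\ge 0}\frac{B_n}{n!}ad(x)^n$, the series $1-a+Ber_{-b}(a)$ lies in $\mathbb{Q}\langle C\rangle$, and $$\Delta^*(invpal)=ma\bigl(1-a+Ber_{-b}(a)\bigr).$$ -/

import Mathlib

open scoped Nat

noncomputable section

namespace MouldTheory

/-! ### Words and cuttings of words -/

/-- All ways `w = p ++ q` of cutting a word into two (possibly empty) chunks. -/
def splits {α : Type*} : List α → List (List α × List α)
  | [] => [([], [])]
  | x :: w => ([], x :: w) :: (splits w).map fun p => (x :: p.1, p.2)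

/-- All ways `w = a ++ b ++ c` of cutting a word into three (possibly empty) chunks. -/
def splits₃ {α : Type*} (w : List α) : List (List α × List α × List α) :=
  (splits w).flatMap fun p => (splits p.2).map fun q => (p.1, q.1, q.2)

/-- All ways `w = a₁ b₁ c₁ ⋯ aₛ bₛ cₛ` of cutting a word into `3s` (possibly empty) chunks,
each recorded as the list of the triples `(aᵢ, bᵢ, cᵢ)`. -/
def cuttings {α : Type*} : ℕ → List α → List (List (List α × List α × List α))
  | 0, [] => [[]]
  | 0, _ :: _ => []
  | s + 1, w => (splits w).flatMap fun p => (splits p.2).flatMap fun q =>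
      (splits q.2).flatMap fun t => (cuttings s t.2).map fun l => (p.1, q.1, t.1) :: l

/-- The condition on a cutting `a₁ b₁ c₁ ⋯ aₛ bₛ cₛ` that no `bᵢ` is empty and no interior
double chunk `cᵢ aᵢ₊₁` is empty. -/
def admissible {α : Type*} : List (List α × List α × List α) → Bool
  | [] => true
  | [t] => !t.2.1.isEmpty
  | t :: t' :: l => !t.2.1.isEmpty && !(t.2.2 ++ t'.1).isEmpty && admissible (t' :: l)

/-- Add `x` to the first letter of a word (lower flexion `⌈`). -/
def addFirst {L : Type*} [Add L] (x : L) : List L → List L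
  | [] => []
  | y :: w => (x + y) :: w

/-- Add `x` to the last letter of a word (lower flexion `⌉`). -/
def addLast {L : Type*} [Add L] (x : L) : List L → List L
  | [] => []
  | [y] => [y + x]
  | y :: z :: w => y :: addLast x (z :: w)

/-! ### Moulds -/

/-- The field `ℚ(u₁, …, u_r)`; the variable `u_{i+1}` has index `i`. -/
abbrev RatFun (r : ℕ) : Type := FractionRing (MvPolynomial (Fin r) ℚ)

/-- The variable `u_{i+1}` of `ℚ(u₁, …, u_r)`. -/
def u {r : ℕ} (i : Fin r) : RatFun r :=
  algebraMap (MvPolynomial (Fin r) ℚ) (RatFun r) (MvPolynomial.X i)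

/-- The word `(u₁, …, u_r)`. -/
def genericWord (r : ℕ) : List (RatFun r) := List.ofFn u

open Classical in
/-- Substitution of algebraically independent elements `v₁, …, v_s` of an extension field of `ℚ`
in a rational function in `s` variables (and `0` if they are not algebraically independent,
which never happens below: the substituted elements are always sums of disjoint nonempty sets
of variables). -/
def subst {s : ℕ} {L : Type*} [Field L] [Algebra ℚ L] (f : RatFun s) (v : Fin s → L) : L :=
  if h : Function.Injective (MvPolynomial.aeval v : MvPolynomial (Fin s) ℚ →ₐ[ℚ] L) then
    IsFractionRing.lift (g := (MvPolynomial.aeval v : MvPolynomial (Fin s) ℚ →ₐ[ℚ] L).toRingHom)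
      h f
  else 0

/-- A (rational-function valued) mould: a family `P(u₁, …, u_r) ∈ ℚ(u₁, …, u_r)`, `r ≥ 0`. -/
def Mould : Type := ∀ r : ℕ, RatFun r

instance : AddCommGroup Mould := inferInstanceAs (AddCommGroup (∀ r : ℕ, RatFun r))

instance : Module ℚ Mould := inferInstanceAs (Module ℚ (∀ r : ℕ, RatFun r))

/-- The mould that is `1` in depth `0` and `0` in positive depth. -/
instance : One Mould := ⟨fun r => if r = 0 then 1 else 0⟩

/-- The value `P(w)` of a mould on a word. -/
def Mould.eval (P : Mould) {L : Type*} [Field L] [Algebra ℚ L] (w : List L) : L :=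
  subst (P w.length) w.get

/-- Moulds with constant term `0`. -/
def ARI : Set Mould := {P | P 0 = 0}

/-- Moulds with constant term `1`. -/
def GARI : Set Mould := {P | P 0 = 1}

/-! ### Operators on moulds -/

/-- `dar(P)(u₁,…,u_r) = u₁⋯u_r P(u₁,…,u_r)`. -/
def dar (P : Mould) : Mould := fun r => (∏ i : Fin r, u i) * P r

/-- The inverse of `dar`. -/
def darInv (P : Mould) : Mould := fun r => (∏ i : Fin r, u i)⁻¹ * P r

/-- `dur(P)(u₁,…,u_r) = (u₁+⋯+u_r) P(u₁,…,u_r)`; in particular `dur(P)(∅) = 0`. -/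
def dur (P : Mould) : Mould := fun r => (∑ i : Fin r, u i) * P r

/-- The factor `u₁⋯u_r(u₁+⋯+u_r)` in depth `r ≥ 1`, and `1` in depth `0`. -/
def deltaFactor (r : ℕ) : RatFun r :=
  if r = 0 then 1 else (∏ i : Fin r, u i) * ∑ i : Fin r, u i

/-- `Δ(P)(u₁,…,u_r) = u₁⋯u_r(u₁+⋯+u_r) P(u₁,…,u_r)` for `r ≥ 1`, and `Δ(P)(∅) = P(∅)`. -/
def delta (P : Mould) : Mould := fun r => deltaFactor r * P r

/-- The inverse of `Δ`. -/
def deltaInv (P : Mould) : Mould := fun r => (deltaFactor r)⁻¹ * P r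

/-- Mould multiplication `mu(P,Q)(w) = ∑_{w = pq} P(p) Q(q)`. -/
def mu (P Q : Mould) : Mould := fun r =>
  ((splits (genericWord r)).map fun p => P.eval p.1 * Q.eval p.2).sum

/-- The `lu`-bracket `[P,Q] = PQ - QP`. -/
def lu (P Q : Mould) : Mould := mu P Q - mu Q P

/-- The `mu`-inverse of a mould in `GARI`: the sum of `(-1)^s P(w₁)⋯P(w_s)` over all ways of
cutting the word into nonempty chunks `w₁, …, w_s`. -/
def invmu (P : Mould) : Mould := fun r =>
  ∑ c : Composition r,
    (-1) ^ c.length * (((genericWord r).splitWrtComposition c).map fun w => P.eval w).prod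

/-- `arit(F)·M(w) = ∑_{w=abc, c≠∅} M(a⌈c) F(b) - ∑_{w=abc, a≠∅} M(a⌉c) F(b)`. -/
def arit (F M : Mould) : Mould := fun r =>
  ((splits₃ (genericWord r)).map fun t =>
    (if t.2.2.isEmpty then 0 else M.eval (t.1 ++ addFirst t.2.1.sum t.2.2) * F.eval t.2.1)
    - (if t.1.isEmpty then 0 else M.eval (addLast t.2.1.sum t.1 ++ t.2.2) * F.eval t.2.1)).sum

/-- `preari(P,Q) = PQ + arit(Q)·P`. -/
def preari (P Q : Mould) : Mould := mu P Q + arit Q P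

/-- `preari(P,…,P)` with `n` arguments, composed from left to right. -/
def preariPow (P : Mould) : ℕ → Mould
  | 0 => 1
  | n + 1 => preari (preariPow P n) P

/-- `exp_ari(P) = ∑_{n ≥ 0} preari(P,…,P)/n!`. For `P` in `ARI` the `n`-th term vanishes in
depths `< n`, so in depth `r` the sum runs over `n ≤ r`. -/
def expAri (P : Mould) : Mould := fun r =>
  ∑ n ∈ Finset.range (r + 1), ((n ! : ℚ)⁻¹) • preariPow P n r

/-- The inverse `GARI → ARI` of `exp_ari : ARI → GARI`. -/
def logAri : Mould → Mould := Function.invFunOn expAri ARI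

/-- `⌈b₁⌉⋯⌈b_s⌉`: in each `bᵢ` the sum of `aᵢ` is added to the first letter and the sum of
`cᵢ` to the last letter. -/
def flexed {L : Type*} [AddMonoid L] (l : List (List L × List L × List L)) : List L :=
  l.flatMap fun t => addLast t.2.2.sum (addFirst t.1.sum t.2.1)

/-- `garit(P)·Q(w) = ∑ Q(⌈b₁⌉⋯⌈b_s⌉) P(a₁)⋯P(a_s) P⁻¹(c₁)⋯P⁻¹(c_s)`, the sum being over all
admissible cuttings `w = a₁b₁c₁⋯a_sb_sc_s` (which have `s ≤ r` as no `bᵢ` is empty). -/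
def garit (P Q : Mould) : Mould := fun r =>
  ∑ s ∈ Finset.range (r + 1),
    (((cuttings s (genericWord r)).filter fun l => admissible l).map fun l =>
      Q.eval (flexed l) * (l.map fun t => P.eval t.1).prod
        * (l.map fun t => (invmu P).eval t.2.2).prod).sum

/-- The multiplication `gari(P,Q) = (garit(Q)·P) Q`. -/
def gari (P Q : Mould) : Mould := mu (garit Q P) Q

/-- The inverse of a mould of `GARI` for the multiplication `gari`. -/
def invGari (Q : Mould) : Mould :=
  Classical.epsilon fun R : Mould => R ∈ GARI ∧ gari Q R = 1 ∧ gari R Q = 1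

/-- `Darit(P) = -dar ∘ (arit(Δ⁻¹P) - ad(Δ⁻¹P)) ∘ dar⁻¹`. -/
def darit (P M : Mould) : Mould :=
  -dar (arit (deltaInv P) (darInv M) - lu (deltaInv P) (darInv M))

/-- `exp_Dari(P) = 1 + ∑_{n ≥ 1} Darit(P)^{n-1}(P)/n!`. For `P` in `ARI` the `n`-th term
vanishes in depths `< n`, so in depth `r` the sum runs over `1 ≤ n ≤ r`. -/
def expDari (P : Mould) : Mould := fun r =>
  (1 : Mould) r + ∑ n ∈ Finset.Icc 1 r, ((n ! : ℚ)⁻¹) • ((darit P)^[n - 1] P) r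

/-- The inverse `GARI → ARI` of `exp_Dari : ARI → GARI`. -/
def logDari : Mould → Mould := Function.invFunOn expDari ARI

/-- The derivation `Darit(P)` extended to `ARI ⊕ ℚa` by `Darit(P)·a = P`; the pair `(M, c)`
stands for `M + c a`. -/
def daritA (P : Mould) (x : Mould × ℚ) : Mould × ℚ := (darit P x.1 + x.2 • P, 0)

/-- The automorphism `Dgarit(P) = exp(Darit(log_Dari(P)))` of `ARI ⊕ ℚa`. The `n`-th power of
`Darit` raises the depth by at least `n` (with `a` in depth `0`), so in depth `r` the exponential
series runs over `n ≤ r`; the coefficient of `a` is preserved. -/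
def dgaritA (P : Mould) (x : Mould × ℚ) : Mould × ℚ :=
  (fun r => ∑ n ∈ Finset.range (r + 1), ((n ! : ℚ)⁻¹) • ((daritA (logDari P))^[n] x).1 r, x.2)

/-- The multiplication `Dgari` on `GARI`, given by
`a - 1 + Dgari(P,Q) = Dgarit(P)(Dgarit(Q)(a))`. -/
def dgari (P Q : Mould) : Mould := 1 + (dgaritA P (dgaritA Q (0, 1))).1

/-- `Δ* = exp_Dari ∘ Δ ∘ log_ari`. -/
def deltaStar (Q : Mould) : Mould := expDari (delta (logAri Q))

/-- The `mu`-dilator `du P = P⁻¹ dur(P)`. -/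
def du (P : Mould) : Mould := mu (invmu P) (dur P)

/-- The binary operation `op` makes the set `S` into a group with neutral element `e`. -/
structure IsGroupLawOn {α : Type*} (S : Set α) (op : α → α → α) (e : α) : Prop where
  mem : ∀ x ∈ S, ∀ y ∈ S, op x y ∈ S
  assoc : ∀ x ∈ S, ∀ y ∈ S, ∀ z ∈ S, op (op x y) z = op x (op y z)
  one_mem : e ∈ S
  one_op : ∀ x ∈ S, op e x = x
  op_one : ∀ x ∈ S, op x e = x
  inv : ∀ x ∈ S, ∃ y ∈ S, op x y = e ∧ op y x = e

/-! ### The mould `pal` -/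

/-- `dupal(u₁,…,u_r) = (B_r / r!) (u₁⋯u_r)⁻¹ ∑_{j=0}^{r-1} (-1)^j binom(r-1,j) u_{j+1}`, where
`B₁ = -1/2`; in depth `0` the sum is empty and the value is `0`. -/
def dupal : Mould := fun r =>
  (bernoulli r / (r ! : ℚ)) • ((∏ i : Fin r, u i)⁻¹ *
    ∑ j : Fin r, (-1) ^ (j : ℕ) * ((r - 1).choose j : RatFun r) * u j)

/-- The mould `pal`: `pal(∅) = 1` and `dur(pal) = pal dupal`, solved depth by depth. -/
def pal : Mould
  | 0 => 1
  | r + 1 => (∑ i : Fin (r + 1), u i)⁻¹ *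
      ∑ i : Fin (r + 1),
        subst (pal i) (fun k : Fin (i : ℕ) => u (r := r + 1) (k.castLE i.2.le))
          * dupal.eval ((genericWord (r + 1)).drop i)
termination_by r => r
decreasing_by exact i.2

/-- `invpal = inv_gari(pal)`. -/
def invpal : Mould := invGari pal

/-! ### Power series in `a` and `b`, and the map `ma` -/

/-- Power series in two non-commuting variables `a` (letter `0`) and `b` (letter `1`) over `ℚ`,
as families of coefficients. -/
def NCSeries : Type := List (Fin 2) → ℚ

instance : AddCommGroup NCSeries := inferInstanceAs (AddCommGroup (List (Fin 2) → ℚ))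

/-- The series with the single monomial `w`. -/
def ncWord (w : List (Fin 2)) : NCSeries := fun w' => if w' = w then 1 else 0

instance : One NCSeries := ⟨ncWord []⟩

/-- The variable `a`. -/
def sa : NCSeries := ncWord [0]

/-- The variable `b`. -/
def sb : NCSeries := ncWord [1]

/-- Multiplication of series. -/
def ncMul (f g : NCSeries) : NCSeries := fun w =>
  ((splits w).map fun p => f p.1 * g p.2).sum

/-- `ad(x)(y) = xy - yx`. -/
def ncAd (x y : NCSeries) : NCSeries := ncMul x y - ncMul y x

/-- `Ber_x = ad(x)/(exp(ad(x)) - 1) = ∑_n (B_n/n!) ad(x)^n`, for `x` without constant term: then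
the `n`-th term only involves monomials of length `≥ n`. -/
def ber (x y : NCSeries) : NCSeries := fun w =>
  ∑ n ∈ Finset.range (w.length + 1), bernoulli n / (n ! : ℚ) * ((ncAd x)^[n] y) w

/-- `C_{k+1} = ad(a)^k(b)`. -/
def genC (k : ℕ) : NCSeries := (ncAd sa)^[k] sb

/-- The monomial `C_{k₁+1}⋯C_{k_r+1}`, as a series in `a` and `b`. -/
def monC {r : ℕ} (k : Fin r → ℕ) : NCSeries := (List.ofFn fun i => genC (k i)).foldr ncMul 1

/-- The space `ℚ⟨C⟩` of power series in `C₁, C₂, …` that are polynomials in each depth: in depth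
`r`, the coefficient of `C_{k₁+1}⋯C_{k_r+1}` is the value at `(k₁, …, k_r)`. -/
def SeriesC : Type := ∀ r : ℕ, (Fin r → ℕ) →₀ ℚ

/-- The inclusion of `ℚ⟨C⟩` in the power series in `a` and `b`. (Monomials in the `Cᵢ` of depth `r`
only involve words with exactly `r` letters `b`.) -/
def SeriesC.toNC (g : SeriesC) : NCSeries := fun w =>
  (g (w.count 1)).sum fun k c => c * monC k w

/-- The map `ma : ℚ⟨C⟩ → ` moulds, with
`ma(C_{k₁+1}⋯C_{k_r+1}) = (-1)^{k₁+⋯+k_r} u₁^{k₁}⋯u_r^{k_r}`. -/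
def SeriesC.ma (g : SeriesC) : Mould := fun r =>
  (g r).sum fun k c => c • ((-1) ^ (∑ i, k i) * ∏ i, u i ^ k i)

end MouldTheory

end

open MouldTheory

noncomputable section

namespace MouldTheory

/-! ### Functions on words -/

section Words

variable {α R : Type*}

/-! Moulds behave like noncommutative series in one generator: `mu` is concatenation, and the mould
b = `letterMould` can be replaced by any mould K in `ARI` through the substitution `comp · K`. The
flexion formulas then become short. `arit F` is the derivation with b ↦ [F, b] (`aritW_eq_derW`,
`arit_letter`), and `garit P` is the substitution b ↦ P b P⁻¹ (`sum_cutSum`, `garit_eq_comp`). Thus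
gari(P, Q) is P with Q b Q⁻¹ substituted, times Q, and associativity follows because the conjugates
of b compose (`conjLetter_gari`).

Let T = preari(·, G) and E = exp_ari(G) = exp(T)(1). T obeys a Leibniz rule over `arit G`, and T(Xb)
= T(X)b. Computing exp(T)(b) in two ways shows that exp(arit G) sends b to E b E⁻¹, so exp(T) is
right translation by E for gari (`exp_preariL`). As preari(·, -G) = -T, the gari-inverse of
exp_ari(G) is exp_ari(-G). Both exponentials are bijective because they are P ↦ 1 + P + terms of
higher order in depth (`bijOn_egf`).

Conjugation by `dar` turns Darit(ΔF) into S = arit(G) - ad(G) with G = -F (`darit_delta`). Here S is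
T minus left multiplication by G, whence exp(S)(N) = E⁻¹ exp(T)(N). Since `dur` is a derivation
commuting with arit, its commutator with T is right multiplication by dur(G), which yields E⁻¹
dur(E) = ∑ Sⁿ⁻¹(dur G)/n! (`egf_durSeq`). This is the formula for Δ*. The homomorphism property then
reduces to the cocycle rule `du_gari`, and the group law Dgari is transported along Δ*.

For the corollary, the formula at invpal involves only du(pal) = dupal. Expanding ad(-b)ⁿ⁺¹(a)
binomially in the words C₁ⁱ C₂ C₁ⁿ⁻ⁱ gives the binomial coefficients of dupal, and `toNC_injective`
makes the element of ℚ⟨C⟩ unique.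

The identities are proved for arbitrary functions on words, by induction on the word, and carried to
moulds by naturality under field homomorphisms on algebraically independent words. -/

theorem mem_splits {w : List α} {p : List α × List α} : p ∈ splits w ↔ p.1 ++ p.2 = w := by
  induction w generalizing p with
  | nil => simp [splits, Prod.ext_iff]
  | cons x w ih =>
    obtain ⟨p, q⟩ := p
    simp only [splits, List.mem_cons, List.mem_map, Prod.mk.injEq, Prod.exists]
    constructor
    · rintro (⟨rfl, rfl⟩ | ⟨a, b, h, rfl, rfl⟩)
      · rfl
      · simpa using ih.1 h
    · intro h
      cases p with
      | nil => exact Or.inl ⟨rfl, h⟩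
      | cons y p =>
        simp only [List.cons_append, List.cons.injEq] at h
        obtain ⟨rfl, h⟩ := h
        exact Or.inr ⟨p, q, ih.2 h, rfl, rfl⟩

theorem splits_map {β : Type*} (f : α → β) (w : List α) :
    splits (w.map f) = (splits w).map fun p => (p.1.map f, p.2.map f) := by
  induction w with
  | nil => rfl
  | cons x w ih => simp [splits, ih, Function.comp_def]

/-- The function `w ↦ F (xw)`. -/
def shift (x : α) (F : List α → R) : List α → R := fun w => F (x :: w)

@[simp] theorem shift_apply (x : α) (F : List α → R) (w : List α) : shift x F w = F (x :: w) := rfl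

/-- The unit for the product of functions on words. -/
def wone [CommRing R] : List α → R
  | [] => 1
  | _ :: _ => 0

/-- The function that is `1` on words of length one, and `0` on all others. -/
def letter [CommRing R] : List α → R
  | [_] => 1
  | _ => 0

theorem shift_letter [CommRing R] (x : α) : shift x (letter : List α → R) = wone := by
  ext w
  cases w <;> rfl

@[simp] theorem letter_nil [CommRing R] : (letter : List α → R) [] = 0 := rfl

@[simp] theorem letter_singleton [CommRing R] (x : α) : (letter : List α → R) [x] = 1 := rfl

theorem length_le_of_append {p q w : List α} (h : p ++ q = w) :
    p.length ≤ w.length ∧ q.length ≤ w.length := by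
  subst h; simp

theorem word_induction {C : List α → Prop} (nil : C [])
    (cons : ∀ x w, (∀ v : List α, v.length ≤ w.length → C v) → C (x :: w)) (w : List α) : C w := by
  suffices h : ∀ (n : ℕ) (w : List α), w.length ≤ n → C w from h _ w le_rfl
  intro n
  induction n with
  | zero =>
    intro w hw
    obtain rfl : w = [] := List.length_eq_zero_iff.1 (Nat.le_zero.1 hw)
    exact nil
  | succ n ih =>
    intro w hw
    cases w with
    | nil => exact nil
    | cons x w => exact cons x w fun v hv => ih v (by simp at hw; omega)

variable [AddMonoid α] [CommRing R]

/-- The twisted product `∑_{w = pq} F(p) G_{|p|}(q)`. -/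
def tmul (F : List α → R) (G : α → List α → R) : List α → R := fun w =>
  ((splits w).map fun p => F p.1 * G p.1.sum p.2).sum

theorem tmul_congr {F F' : List α → R} {G G' : α → List α → R} {w : List α}
    (h : ∀ p q, p ++ q = w → F p * G p.sum q = F' p * G' p.sum q) :
    tmul F G w = tmul F' G' w :=
  congrArg List.sum (List.map_congr_left fun p hp => h p.1 p.2 (mem_splits.1 hp))

theorem tmul_congr_right {F : List α → R} {G G' : α → List α → R} {w : List α}
    (h : ∀ p q, p ++ q = w → G p.sum q = G' p.sum q) :
    tmul F G w = tmul F G' w :=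
  tmul_congr fun p q hpq => by rw [h p q hpq]

@[simp] theorem tmul_nil (F : List α → R) (G : α → List α → R) :
    tmul F G [] = F [] * G 0 [] := by
  simp [tmul, splits]

theorem tmul_cons (F : List α → R) (G : α → List α → R) (x : α) (w : List α) :
    tmul F G (x :: w) = F [] * G 0 (x :: w) + tmul (shift x F) (fun s => G (x + s)) w := by
  simp [tmul, splits, Function.comp_def]

theorem tmul_add_left (F F' : List α → R) (G : α → List α → R) :
    tmul (F + F') G = tmul F G + tmul F' G := by
  ext w
  simp [tmul, add_mul, List.sum_map_add]

theorem tmul_add_right (F : List α → R) (G G' : α → List α → R) :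
    tmul F (fun s => G s + G' s) = tmul F G + tmul F G' := by
  ext w
  simp [tmul, mul_add, List.sum_map_add]

theorem tmul_smul_left (c : R) (F : List α → R) (G : α → List α → R) :
    tmul (c • F) G = c • tmul F G := by
  ext w
  simp [tmul, mul_assoc, List.sum_map_mul_left]

theorem tmul_smul_right (c : R) (F : List α → R) (G : α → List α → R) :
    tmul F (fun s => c • G s) = c • tmul F G := by
  ext w
  simp [tmul, mul_left_comm _ c, List.sum_map_mul_left]

theorem shift_tmul (F : List α → R) (G : α → List α → R) (x : α) :
    shift x (tmul F G) = F [] • shift x (G 0) + tmul (shift x F) (fun s => G (x + s)) := by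
  ext w
  simp [tmul_cons]

/-- In a cutting into three chunks the last factor sees the sum of the first two, however the
product is bracketed. The twist is what lets compositions and derivations, whose arguments are
partial sums, be handled as products. -/
theorem tmul_assoc (F : List α → R) (A B : α → List α → R) (w : List α) :
    tmul F (fun s => tmul (A s) fun t => B (s + t)) w = tmul (tmul F A) B w := by
  induction w generalizing F A B with
  | nil => simp [mul_assoc]
  | cons x w ih =>
    rw [tmul_cons, tmul_cons, tmul_cons, shift_tmul, tmul_add_left, tmul_smul_left]
    simp only [add_assoc, Pi.add_apply, Pi.smul_apply, smul_eq_mul, zero_add, tmul_nil]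
    rw [← ih]
    ring

/-- The product of functions on words. -/
def wmul (F G : List α → R) : List α → R := tmul F fun _ => G

theorem wmul_assoc (F G H : List α → R) : wmul (wmul F G) H = wmul F (wmul G H) :=
  funext fun w => (tmul_assoc F (fun _ => G) (fun _ => H) w).symm

theorem tmul_zero_left (G : α → List α → R) : tmul 0 G = 0 := by
  ext w; simp [tmul]

theorem tmul_wone (G : α → List α → R) : tmul wone G = G 0 := by
  ext w
  cases w with
  | nil => simp [wone]
  | cons x w =>
    have : shift x (wone : List α → R) = 0 := rfl
    simp [tmul_cons, this, tmul_zero_left, wone]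

theorem one_wmul (F : List α → R) : wmul wone F = F := tmul_wone _

theorem wmul_one (F : List α → R) : wmul F wone = F := by
  ext w
  induction w generalizing F with
  | nil => simp [wone, wmul]
  | cons x w ih =>
    rw [wmul, tmul_cons]
    exact (congrArg₂ (· + ·) (mul_zero _) (ih _)).trans (zero_add _)

theorem tmul_letter_cons (G : α → List α → R) (x : α) (w : List α) :
    tmul letter G (x :: w) = G x w := by
  simp [tmul_cons, shift_letter, tmul_wone]

/-! ### Composition -/

/-- Composition of functions on words, with a bound on the number of blocks. -/
def compAux : ℕ → (List α → R) → (List α → R) → List α → R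
  | _, M, _, [] => M []
  | 0, _, _, _ :: _ => 0
  | n + 1, M, K, x :: w =>
    ((splits w).map fun p => K (x :: p.1) * compAux n (shift (x + p.1.sum) M) K p.2).sum

/-- The composition `∑_{w = w₁⋯wₘ} M(|w₁|,…,|wₘ|) K(w₁)⋯K(wₘ)`, over the ways of cutting `w` into
nonempty words. -/
def compW (M K : List α → R) : List α → R := fun w => compAux w.length M K w

/-- The bound is only fuel for the recursion: each step consumes a letter, so any bound at least the
length gives the same value. -/
theorem compAux_eq (n m : ℕ) (M K : List α → R) (w : List α) (hn : w.length ≤ n)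
    (hm : w.length ≤ m) : compAux n M K w = compAux m M K w := by
  induction n generalizing m M w with
  | zero =>
    obtain rfl : w = [] := List.length_eq_zero_iff.1 (by omega)
    cases m <;> rfl
  | succ n ih =>
    cases w with
    | nil => cases m <;> rfl
    | cons x w =>
      simp only [List.length_cons] at hn hm
      obtain ⟨m, rfl⟩ : ∃ k, m = k + 1 := ⟨m - 1, by omega⟩
      refine congrArg List.sum (List.map_congr_left fun p hp => ?_)
      have := (length_le_of_append (mem_splits.1 hp)).2
      rw [ih m _ _ (by omega) (by omega)]

@[simp] theorem compW_nil (M K : List α → R) : compW M K [] = M [] := rfl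

theorem compW_cons (M K : List α → R) (x : α) (w : List α) :
    compW M K (x :: w) = tmul (shift x K) (fun s => compW (shift (x + s) M) K) w := by
  refine congrArg List.sum (List.map_congr_left fun p hp => ?_)
  have := (length_le_of_append (mem_splits.1 hp)).2
  rw [shift_apply, compAux_eq _ p.2.length _ _ _ this le_rfl]
  rfl

theorem shift_compW (M K : List α → R) (x : α) :
    shift x (compW M K) = tmul (shift x K) (fun s => compW (shift (x + s) M) K) :=
  funext fun w => compW_cons M K x w

theorem compW_add (M M' K : List α → R) : compW (M + M') K = compW M K + compW M' K := by
  ext w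
  induction w using word_induction generalizing M M' with
  | nil => rfl
  | cons x w ih =>
    rw [Pi.add_apply, compW_cons, compW_cons, compW_cons, ← Pi.add_apply (tmul _ _),
      ← tmul_add_right]
    exact tmul_congr_right fun p q h => ih q (length_le_of_append h).2 _ _

theorem compW_smul (c : R) (M K : List α → R) : compW (c • M) K = c • compW M K := by
  ext w
  induction w using word_induction generalizing M with
  | nil => rfl
  | cons x w ih =>
    rw [Pi.smul_apply, compW_cons, compW_cons, ← Pi.smul_apply, ← tmul_smul_right]
    exact tmul_congr_right fun p q h => ih q (length_le_of_append h).2 _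

theorem compW_zero (K : List α → R) : compW 0 K = 0 := by
  have := compW_smul 0 0 K
  simpa using this

/-- Replacing blocks by their sums preserves the sum of a prefix, so the twist of `G` is the same
before and after substitution. Substitution is thus multiplicative. -/
theorem compW_tmul (F : List α → R) (G : α → List α → R) (N : List α → R) :
    compW (tmul F G) N = tmul (compW F N) fun s => compW (G s) N := by
  ext w
  induction w using word_induction generalizing F G with
  | nil => simp
  | cons x w ih =>
    rw [compW_cons, tmul_cons, shift_compW]
    have h1 : ∀ p q : List α, p ++ q = w → compW (shift (x + p.sum) (tmul F G)) N q =
        F [] * compW (shift (x + p.sum) (G 0)) N q +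
          tmul (compW (shift (x + p.sum) F) N) (fun s => compW (G (x + (p.sum + s))) N) q := by
      intro p q h
      rw [shift_tmul, compW_add, compW_smul, Pi.add_apply, ih q (length_le_of_append h).2]
      simp [add_assoc]
    rw [tmul_congr_right (G' := fun t => F [] • compW (shift (x + t) (G 0)) N +
      tmul (compW (shift (x + t) F) N) (fun s => compW (G (x + (t + s))) N)) h1,
      tmul_add_right, tmul_smul_right, Pi.add_apply, Pi.smul_apply, ← shift_compW,
      tmul_assoc (shift x N) (fun t => compW (shift (x + t) F) N) (fun s => compW (G (x + s)) N)]
    simp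

theorem compW_wmul (F G N : List α → R) : compW (wmul F G) N = wmul (compW F N) (compW G N) :=
  compW_tmul _ _ _

theorem compW_assoc (M K N : List α → R) : compW (compW M K) N = compW M (compW K N) := by
  ext w
  induction w using word_induction generalizing M with
  | nil => simp
  | cons x w ih =>
    rw [compW_cons, compW_cons, shift_compW]
    simp_rw [shift_compW, compW_tmul]
    have := tmul_assoc (shift x N) (fun s => compW (shift (x + s) K) N)
      (fun s => compW (compW (shift (x + s) M) K) N) w
    simp only [← add_assoc] at this
    rw [this]
    exact tmul_congr_right fun p q h => ih q (length_le_of_append h).2 _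

theorem compW_wone (K : List α → R) : compW wone K = wone := by
  ext w
  cases w with
  | nil => rfl
  | cons x w =>
    rw [compW_cons]
    have : ∀ s, shift s (wone : List α → R) = 0 := fun s => rfl
    simp [this, compW_zero, tmul, wone]

theorem compW_letter (K : List α → R) (hK : K [] = 0) : compW letter K = K := by
  ext w
  cases w with
  | nil => simp [hK]
  | cons x w =>
    rw [compW_cons]
    simp_rw [shift_letter, compW_wone]
    exact congrFun (wmul_one _) w

theorem letter_compW (M : List α → R) : compW M letter = M := by
  ext w
  induction w using word_induction generalizing M with
  | nil => rfl
  | cons x w ih =>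
    rw [compW_cons, shift_letter, tmul_wone, add_zero, ih w le_rfl]
    rfl

/-! ### Derivations -/

/-- The derivation `∑_{w = abc} M(a|b|c) K(b)`, over cuttings with `b` nonempty. -/
def derW (K : List α → R) : (List α → R) → List α → R
  | _, [] => 0
  | M, x :: w => tmul (shift x K) (fun s => shift (x + s) M) w + derW K (shift x M) w

@[simp] theorem derW_nil (K M : List α → R) : derW K M [] = 0 := rfl

theorem derW_cons (K M : List α → R) (x : α) (w : List α) : derW K M (x :: w) =
    tmul (shift x K) (fun s => shift (x + s) M) w + derW K (shift x M) w := rfl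

theorem shift_derW (K M : List α → R) (x : α) : shift x (derW K M) =
    tmul (shift x K) (fun s => shift (x + s) M) + derW K (shift x M) := rfl

theorem derW_add (K M M' : List α → R) : derW K (M + M') = derW K M + derW K M' := by
  ext w
  induction w generalizing M M' with
  | nil => simp
  | cons x w ih =>
    have h : ∀ y, shift y (M + M') = shift y M + shift y M' := fun y => rfl
    simp only [Pi.add_apply, derW_cons, h, tmul_add_right, ih]
    ring

theorem derW_smul (K : List α → R) (c : R) (M : List α → R) :
    derW K (c • M) = c • derW K M := by
  ext w
  induction w generalizing M with
  | nil => simp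
  | cons x w ih =>
    have h : ∀ y, shift y (c • M) = c • shift y M := fun y => rfl
    simp only [Pi.smul_apply, derW_cons, h, tmul_smul_right, ih, smul_add]

theorem derW_add_left (K K' M : List α → R) : derW (K + K') M = derW K M + derW K' M := by
  ext w
  induction w generalizing M with
  | nil => simp
  | cons x w ih =>
    have h : ∀ y, shift y (K + K') = shift y K + shift y K' := fun y => rfl
    simp only [Pi.add_apply, derW_cons, h, tmul_add_left, ih]
    ring

theorem derW_smul_left (K : List α → R) (c : R) (M : List α → R) :
    derW (c • K) M = c • derW K M := by
  ext w
  induction w generalizing M with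
  | nil => simp
  | cons x w ih =>
    have h : ∀ y, shift y (c • K) = c • shift y K := fun y => rfl
    simp only [Pi.smul_apply, derW_cons, h, tmul_smul_left, ih, smul_add]

/-- The merged block ends up in the left or in the right factor. Merging inside the left factor does
not change its sum, so the twist adds no further term. -/
theorem derW_tmul (K F : List α → R) (G : α → List α → R) :
    derW K (tmul F G) = tmul (derW K F) G + tmul F fun s => derW K (G s) := by
  ext w
  induction w generalizing F G with
  | nil => simp
  | cons x w ih =>
    have h := tmul_assoc (shift x K) (fun s => shift (x + s) F) (fun s => G (x + s)) w
    simp only [← add_assoc] at h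
    simp only [derW_cons, Pi.add_apply, tmul_cons, shift_tmul, tmul_add_right, tmul_smul_right,
      derW_add, derW_smul, ih, shift_derW, tmul_add_left, derW_nil, Pi.smul_apply, smul_eq_mul, h]
    ring

theorem derW_wmul (K F G : List α → R) :
    derW K (wmul F G) = wmul (derW K F) G + wmul F (derW K G) :=
  derW_tmul _ _ _

theorem derW_wone (K : List α → R) : derW K wone = 0 := by
  ext w
  cases w with
  | nil => rfl
  | cons x w =>
    have h : ∀ y, shift y (wone : List α → R) = 0 := fun y => rfl
    have h0 : derW K 0 = 0 := by simpa using derW_smul K 0 0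
    simp only [derW_cons, h, h0]
    simp [tmul]

theorem derW_letter (K : List α → R) (hK : K [] = 0) : derW K letter = K := by
  ext w
  cases w with
  | nil => simp [hK]
  | cons x w =>
    simp only [derW_cons, shift_letter, derW_wone, Pi.zero_apply, add_zero]
    exact congrFun (wmul_one _) w

end Words

/-! ### Exponential series -/

/-- Only a two-index recursion is required, so the two factors of a product may be acted on by
different operators. This is used below with the pairs (arit, preari) and (preari, arit - ad). -/
theorem iterate_leibniz {V : Type*} [AddCommGroup V] (T : V →+ V) (f : ℕ → ℕ → V)
    (h : ∀ i j, T (f i j) = f (i + 1) j + f i (j + 1)) (n : ℕ) :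
    T^[n] (f 0 0) = ∑ ij ∈ Finset.HasAntidiagonal.antidiagonal n, n.choose ij.1 • f ij.1 ij.2 := by
  induction n with
  | zero => simp
  | succ n ih =>
    rw [Function.iterate_succ_apply', ih, Finset.sum_antidiagonal_choose_succ_nsmul, map_sum,
      ← Finset.sum_add_distrib]
    refine Finset.sum_congr rfl fun ij hij => ?_
    rw [map_nsmul, h, smul_add, add_comm,
      Nat.choose_symm_of_eq_add (Finset.HasAntidiagonal.mem_antidiagonal.1 hij).symm]

/-- The square of indices may be cut down to the triangle `i + j ≤ r`, and there the reciprocal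
factorials combine into binomial coefficients. -/
theorem sum_range_sum_range_eq {V : Type*} [AddCommGroup V] [Module ℚ V] (f : ℕ → ℕ → V) (r : ℕ)
    (h : ∀ i j, r < i + j → f i j = 0) :
    ∑ i ∈ Finset.range (r + 1), ∑ j ∈ Finset.range (r + 1),
      (((i ! : ℚ)⁻¹ * (j ! : ℚ)⁻¹) • f i j) =
    ∑ n ∈ Finset.range (r + 1), (n ! : ℚ)⁻¹ •
      ∑ ij ∈ Finset.HasAntidiagonal.antidiagonal n, n.choose ij.1 • f ij.1 ij.2 := by
  have hR : ∀ n ∈ Finset.range (r + 1), (n ! : ℚ)⁻¹ •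
      ∑ ij ∈ Finset.HasAntidiagonal.antidiagonal n, n.choose ij.1 • f ij.1 ij.2 =
      ∑ ij ∈ Finset.HasAntidiagonal.antidiagonal n, ((ij.1 ! : ℚ)⁻¹ * (ij.2 ! : ℚ)⁻¹) • f ij.1 ij.2 := by
    intro n _
    rw [Finset.smul_sum]
    refine Finset.sum_congr rfl fun ij hij => ?_
    obtain rfl := Finset.HasAntidiagonal.mem_antidiagonal.1 hij
    rw [← Nat.cast_smul_eq_nsmul ℚ, smul_smul, Nat.choose_symm_add, Nat.add_choose, Nat.cast_div
      (Nat.factorial_mul_factorial_dvd_factorial_add _ _) (by positivity)]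
    congr 1
    push_cast
    have := Nat.factorial_ne_zero (ij.1 + ij.2)
    field_simp
  rw [Finset.sum_congr rfl hR, ← Finset.sum_product', Finset.sum_sigma',
    ← Finset.sum_filter_of_ne (p := fun x : ℕ × ℕ => x.1 + x.2 < r + 1)]
  · refine Finset.sum_nbij' (fun x => ⟨x.1 + x.2, x⟩) (fun x => x.2) ?_ ?_ ?_ ?_ ?_
    · intro x hx
      simp only [Finset.mem_filter] at hx
      simp [hx.2]
    · rintro ⟨n, i, j⟩ hx
      simp at hx ⊢
      omega
    · intro x hx
      rfl
    · rintro ⟨n, i, j⟩ hx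
      simp at hx
      obtain ⟨_, rfl⟩ := hx
      rfl
    · intro x hx
      rfl
  · intro x _ hx
    by_contra hlt
    exact hx (by rw [h _ _ (by omega), smul_zero])

/-! ### Exponentials of derivations on functions on words -/

section Words

set_option linter.unusedSectionVars false

variable {α R : Type*} [AddMonoid α] [CommRing R]

/-- The function vanishes on the words of length less than `k`. -/
def WVan (k : ℕ) (F : List α → R) : Prop := ∀ w, w.length < k → F w = 0

theorem tmul_wvan {i j : ℕ} {F : List α → R} {G : α → List α → R} (hF : WVan i F)
    (hG : ∀ s, WVan j (G s)) : WVan (i + j) (tmul F G) := by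
  intro w hw
  have h : tmul F G w = tmul 0 G w := tmul_congr fun p q hpq => by
    subst hpq
    rw [List.length_append] at hw
    by_cases hp : p.length < i
    · simp [hF p hp]
    · simp [hG _ q (by omega)]
  rw [h, tmul_zero_left]
  rfl

theorem shift_wvan {k : ℕ} {F : List α → R} (hF : WVan k F) (x : α) :
    WVan (k - 1) (shift x F) := fun w hw => hF _ (by simp; omega)

/-- The block fed to `K` survives as one letter in the argument of `M`, which costs one unit of
order. -/
theorem derW_wvan {i j : ℕ} {K M : List α → R} (hK : WVan (i + 1) K) (hM : WVan j M) :
    WVan (i + j) (derW K M) := by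
  intro w
  induction w generalizing j M with
  | nil => intro; rfl
  | cons x w ih =>
    intro hw
    simp only [List.length_cons] at hw
    rw [derW_cons, tmul_wvan (shift_wvan hK x) (fun s => shift_wvan hM (x + s)) w (by omega),
      zero_add]
    cases j with
    | zero =>
      have h0 : WVan 0 (shift x M) := fun v hv => absurd hv (Nat.not_lt_zero _)
      exact ih h0 (by omega)
    | succ j => exact ih (shift_wvan hM x) (by omega)

/-- `derW` as a linear map. -/
def derL (K : List α → R) : (List α → R) →ₗ[R] (List α → R) where
  toFun := derW K
  map_add' := derW_add K
  map_smul' := derW_smul K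

@[simp] theorem derL_apply (K M : List α → R) : derL K M = derW K M := rfl

theorem derW_iterate_wvan {K : List α → R} (hK : WVan 2 K) (M : List α → R) (n : ℕ) :
    WVan n ((derL K)^[n] M) := by
  induction n with
  | zero => exact fun v hv => absurd hv (Nat.not_lt_zero _)
  | succ n ih =>
    rw [Function.iterate_succ_apply', add_comm]
    exact derW_wvan hK ih

theorem eq_add_tmul_letter (M : List α → R) :
    M = M [] • wone + tmul letter fun s => shift s M := by
  ext w
  cases w with
  | nil => simp [wone]
  | cons x w => simp [wone, tmul_letter_cons]

variable [Algebra ℚ R]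

/-- The exponential generating function of a sequence of functions on words. -/
def egfW (p : ℕ → List α → R) : List α → R := fun w =>
  ∑ n ∈ Finset.range (w.length + 1), (n ! : ℚ)⁻¹ • p n w

theorem egfW_eq {p : ℕ → List α → R} (hp : ∀ n, WVan n (p n)) {w : List α} {N : ℕ}
    (hN : w.length ≤ N) : egfW p w = ∑ n ∈ Finset.range (N + 1), (n ! : ℚ)⁻¹ • p n w := by
  refine Finset.sum_subset (Finset.range_mono (by omega)) fun n _ hn => ?_
  rw [hp n w (by simpa using hn), smul_zero]

theorem egfW_tmul {A : ℕ → List α → R} {G : ℕ → α → List α → R} (hA : ∀ n, WVan n (A n))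
    (hG : ∀ n s, WVan n (G n s)) :
    egfW (fun n => ∑ ij ∈ Finset.HasAntidiagonal.antidiagonal n, n.choose ij.1 • tmul (A ij.1) (G ij.2)) =
      tmul (egfW A) fun s => egfW fun n => G n s := by
  ext w
  have h := sum_range_sum_range_eq (fun i j => tmul (A i) (G j) w) w.length
    fun i j hij => tmul_wvan (hA i) (hG j) w hij
  have hL : egfW (fun n => ∑ ij ∈ Finset.HasAntidiagonal.antidiagonal n, n.choose ij.1 • tmul (A ij.1) (G ij.2)) w
      = ∑ n ∈ Finset.range (w.length + 1), (n ! : ℚ)⁻¹ •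
        ∑ ij ∈ Finset.HasAntidiagonal.antidiagonal n, n.choose ij.1 • tmul (A ij.1) (G ij.2) w := by
    simp [egfW, Finset.sum_apply]
  rw [hL, ← h, tmul]
  have hs : ((splits w).map fun p => egfW A p.1 * egfW (fun n => G n p.1.sum) p.2) =
      (splits w).map fun p => ∑ i ∈ Finset.range (w.length + 1),
        ∑ j ∈ Finset.range (w.length + 1),
          ((i ! : ℚ)⁻¹ * (j ! : ℚ)⁻¹) • (A i p.1 * G j p.1.sum p.2) := by
    refine List.map_congr_left fun p hp => ?_
    have hl := length_le_of_append (mem_splits.1 hp)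
    rw [egfW_eq hA hl.1, egfW_eq (fun n => hG n _) hl.2, Finset.sum_mul_sum]
    simp only [smul_mul_smul_comm]
  rw [hs]
  simp only [tmul]
  have hmap : ∀ (l : List (List α × List α)) (g : ℕ → List α × List α → R) (S : Finset ℕ),
      (l.map fun p => ∑ i ∈ S, g i p).sum = ∑ i ∈ S, (l.map (g i)).sum := by
    intro l g S
    induction l with
    | nil => simp
    | cons a l ih => simp [ih, Finset.sum_add_distrib]
  rw [hmap]
  refine Finset.sum_congr rfl fun i _ => ?_
  rw [hmap]
  refine Finset.sum_congr rfl fun j _ => ?_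
  rw [List.smul_sum, List.map_map]
  rfl

/-- The exponential of the derivation `derW K`. -/
def expW (K M : List α → R) : List α → R := egfW fun n => (derL K)^[n] M

theorem expW_add (K M M' : List α → R) : expW K (M + M') = expW K M + expW K M' := by
  ext w
  simp [expW, egfW, iterate_map_add, Finset.sum_add_distrib]

theorem expW_smul (K : List α → R) (c : R) (M : List α → R) :
    expW K (c • M) = c • expW K M := by
  ext w
  have : ∀ n, (derL K)^[n] (c • M) = c • (derL K)^[n] M := fun n => by
    rw [← Module.End.pow_apply, map_smul, Module.End.pow_apply]
  simp [expW, egfW, this, Finset.mul_sum]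

theorem expW_wone (K : List α → R) : expW K wone = wone := by
  have h : ∀ n, (derL K)^[n + 1] (wone : List α → R) = 0 := fun n => by
    rw [Function.iterate_succ_apply, derL_apply, derW_wone, iterate_map_zero]
  ext w
  rw [expW, egfW, Finset.sum_range_succ']
  simp [h]

/-- The exponential of a derivation is multiplicative. Vanishing below length two makes each
application of the derivation raise the order by one, so the truncated series lose nothing. -/
theorem expW_tmul {K : List α → R} (hK : WVan 2 K) (F : List α → R) (G : α → List α → R) :
    expW K (tmul F G) = tmul (expW K F) fun s => expW K (G s) := by
  refine Eq.trans ?_ (egfW_tmul (derW_iterate_wvan hK F) fun n s => derW_iterate_wvan hK (G s) n)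
  unfold expW
  congr 1
  ext1 n
  refine iterate_leibniz (derL K).toAddMonoidHom
    (fun i j => tmul ((derL K)^[i] F) fun s => (derL K)^[j] (G s)) (fun i j => ?_) n
  simp only [LinearMap.toAddMonoidHom_coe, Function.iterate_succ_apply']
  exact derW_tmul _ _ _

theorem expW_nil {K : List α → R} (M : List α → R) : expW K M [] = M [] := by
  simp [expW, egfW]

/-- A multiplicative map is determined by its value at the generator: split `M` into its constant
term and `letter` times its shifts, and induct on the length of the word. -/
theorem expW_eq_compW {K : List α → R} (hK : WVan 2 K) (M : List α → R) :
    expW K M = compW M (expW K letter) := by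
  ext w
  induction w using word_induction generalizing M with
  | nil => exact expW_nil M
  | cons x w ih =>
    rw [compW_cons]
    conv_lhs => rw [eq_add_tmul_letter M]
    rw [expW_add, expW_smul, expW_wone, expW_tmul hK, Pi.add_apply, tmul_cons, expW_nil]
    simp only [Pi.smul_apply, wone, smul_zero, zero_add, letter_nil, zero_mul]
    exact tmul_congr_right fun p q h => ih q (length_le_of_append h).2 _

end Words

/-! ### Inverses, `arit` and `garit` as explicit sums over cuttings -/

section Words

set_option linter.unusedSectionVars false

variable {α R : Type*}

theorem sum_map_flatMap {β γ : Type*} [AddCommMonoid R] (l : List β) (f : β → List γ) (g : γ → R) :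
    ((l.flatMap f).map g).sum = (l.map fun a => ((f a).map g).sum).sum := by
  induction l with
  | nil => rfl
  | cons a l ih => simp [ih]

theorem sum_map_filter' {β : Type*} [AddCommMonoid R] (l : List β) (p : β → Bool) (g : β → R) :
    ((l.filter p).map g).sum = (l.map fun a => if p a then g a else 0).sum := by
  induction l with
  | nil => rfl
  | cons a l ih => by_cases h : p a <;> simp [h, ih]

theorem sum_splits_ite [AddCommMonoid R] (h : List α → R) (w : List α) :
    ((splits w).map fun p => if p.1.isEmpty then h p.2 else 0).sum = h w := by
  cases w with
  | nil => simp [splits]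
  | cons x w => simp [splits, Function.comp_def]

/-! ### The `mu`-inverse -/

theorem splits_eq_map_range (w : List α) :
    splits w = (List.range (w.length + 1)).map fun i => (w.take i, w.drop i) := by
  induction w with
  | nil => rfl
  | cons x w ih =>
    rw [splits, ih, List.length_cons, List.range_succ_eq_map (n := w.length + 1)]
    simp [Function.comp_def]

/-- Adding a first block to a composition. -/
def consComposition (x : α) (w : List α)
    (s : Σ i : Fin (w.length + 1), Composition (w.drop i).length) :
    Composition (x :: w).length where
  blocks := ((s.1 : ℕ) + 1) :: s.2.blocks
  blocks_pos := by
    intro i hi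
    rcases List.mem_cons.1 hi with rfl | hi
    · omega
    · exact s.2.blocks_pos hi
  blocks_sum := by
    have := s.1.2
    simp only [List.sum_cons, s.2.blocks_sum, List.length_drop, List.length_cons]
    omega

theorem consComposition_bijective (x : α) (w : List α) :
    Function.Bijective (consComposition x w) := by
  constructor
  · rintro ⟨i, c⟩ ⟨j, d⟩ h
    have h := congrArg Composition.blocks h
    simp only [consComposition, List.cons.injEq, add_left_inj] at h
    obtain ⟨h1, h2⟩ := h
    obtain rfl : i = j := Fin.ext h1
    rw [Composition.ext h2]
  · intro c
    obtain ⟨blocks, hpos, hsum⟩ := c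
    cases blocks with
    | nil => simp at hsum
    | cons k bs =>
      have hk : 0 < k := hpos (by simp)
      simp only [List.sum_cons, List.length_cons] at hsum
      refine ⟨⟨⟨k - 1, by omega⟩, ⟨bs, fun hi => hpos (List.mem_cons_of_mem _ hi), ?_⟩⟩, ?_⟩
      · simp only [List.length_drop]
        omega
      · refine Composition.ext ?_
        simp only [consComposition, List.cons.injEq, and_true]
        omega

/-- Choosing the first block amounts to choosing which prefix of `w` joins `x`; this turns sums over
compositions into a recursion on words. -/
theorem sum_composition_cons [AddCommMonoid R] (f : List (List α) → R) (x : α) (w : List α) :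
    ∑ c : Composition (x :: w).length, f ((x :: w).splitWrtComposition c) =
      ((splits w).map fun p =>
        ∑ c : Composition p.2.length, f ((x :: p.1) :: p.2.splitWrtComposition c)).sum := by
  rw [splits_eq_map_range, List.map_map, ← Function.Bijective.sum_comp
    (consComposition_bijective x w), Fintype.sum_sigma, ← List.sum_ofFn, List.ofFn_eq_map,
    ← List.map_coe_finRange_eq_range, List.map_map]
  refine congrArg List.sum (List.map_congr_left fun i _ => Finset.sum_congr rfl fun c _ => ?_)
  rw [List.splitWrtComposition, consComposition, List.splitWrtCompositionAux_cons]
  rfl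

variable [AddMonoid α] [CommRing R]

theorem list_mul_sum {β : Type*} (c : R) (l : List β) (f : β → R) :
    c * (l.map f).sum = (l.map fun a => c * f a).sum := (List.sum_map_mul_left ..).symm

/-- The alternating sum over the ways of cutting a word into nonempty words. -/
def invW (F : List α → R) : List α → R := fun w =>
  ∑ c : Composition w.length, (-1) ^ c.length * ((w.splitWrtComposition c).map F).prod

theorem invW_nil (F : List α → R) : invW F [] = 1 := by
  have h : ∀ c : Composition 0, c.blocks = [] := fun c => by
    rw [← List.length_eq_zero_iff]
    exact Nat.le_zero.1 (Composition.length_le _)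
  have hu : (Finset.univ : Finset (Composition 0)).card = 1 := by
    rw [Finset.card_univ, composition_card]
    rfl
  rw [invW, Finset.sum_congr rfl (g := fun _ => 1), Finset.sum_const]
  · exact (congrArg (· • (1 : R)) hu).trans (one_smul _ _)
  · intro c _
    simp [List.splitWrtComposition, h c, Composition.length, List.splitWrtCompositionAux]

theorem invW_cons (F : List α → R) (x : α) (w : List α) :
    invW F (x :: w) = -wmul (shift x F) (invW F) w := by
  have h : ∀ v : List α, invW F v = ∑ c : Composition v.length,
      (fun l : List (List α) => (-1) ^ l.length * (l.map F).prod) (v.splitWrtComposition c) := by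
    intro v
    simp only [List.length_splitWrtComposition]
    rfl
  rw [h, sum_composition_cons (fun l : List (List α) => (-1) ^ l.length * (l.map F).prod), wmul,
    tmul, ← neg_one_mul (List.sum _), list_mul_sum]
  refine congrArg List.sum (List.map_congr_left fun p _ => ?_)
  rw [h, Finset.mul_sum, Finset.mul_sum]
  refine Finset.sum_congr rfl fun c _ => ?_
  simp only [List.length_cons, List.map_cons, List.prod_cons, shift_apply]
  ring

theorem wmul_invW {F : List α → R} (hF : F [] = 1) : wmul F (invW F) = wone := by
  ext w
  cases w with
  | nil => simp [wmul, hF, invW_nil, wone]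
  | cons x w =>
    rw [wmul, tmul_cons, invW_cons, hF]
    simp [wone, wmul]

/-- A right inverse that itself has a right inverse is two-sided, and `invW F` has constant term one
whatever `F` is. -/
theorem invW_wmul {F : List α → R} (hF : F [] = 1) : wmul (invW F) F = wone := by
  have h1 := wmul_invW hF
  have h2 := wmul_invW (invW_nil F)
  have : F = invW (invW F) := by
    rw [← one_wmul (invW (invW F)), ← h1, wmul_assoc, h2, wmul_one]
  conv_lhs => arg 2; rw [this]
  exact h2

/-! ### The derivation `arit` -/

/-- The operator `arit` on functions on words. -/
def aritW (F M : List α → R) : List α → R := fun w =>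
  ((splits₃ w).map fun t =>
    (if t.2.2.isEmpty then 0 else M (t.1 ++ addFirst t.2.1.sum t.2.2) * F t.2.1)
    - (if t.1.isEmpty then 0 else M (addLast t.2.1.sum t.1 ++ t.2.2) * F t.2.1)).sum

theorem splits₃_cons (x : α) (w : List α) : splits₃ (x :: w) =
    ((splits (x :: w)).map fun q => ([], q)) ++
      (splits₃ w).map fun t => (x :: t.1, t.2.1, t.2.2) := by
  simp [splits₃, splits, List.flatMap_map, List.map_flatMap, Function.comp_def]

theorem sum_splits₃_ite (h : List α → List α → R) (w : List α) :
    ((splits₃ w).map fun t => if t.1.isEmpty then h t.2.1 t.2.2 else 0).sum =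
      ((splits w).map fun p => h p.1 p.2).sum := by
  rw [splits₃, sum_map_flatMap]
  simp only [List.map_map, Function.comp_def]
  have h2 := sum_splits_ite (fun w => ((splits w).map fun p => h p.1 p.2).sum) w
  rw [← h2]
  refine congrArg List.sum (List.map_congr_left fun p _ => ?_)
  by_cases hp : p.1.isEmpty <;> simp [hp]

theorem list_sum_map_sub {β : Type*} (l : List β) (f g : β → R) :
    (l.map fun a => f a - g a).sum = (l.map f).sum - (l.map g).sum := by
  induction l with
  | nil => simp
  | cons a l ih => simp [ih]; ring

/-- The first term collects the cuttings with `a` empty. When `a` is nonempty, `x` is absorbed into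
`M`, but the case `a = [x]` becomes an empty prefix for which the second flexion is no longer
counted; the subtracted term restores it. -/
theorem aritW_cons (F M : List α → R) (x : α) (w : List α) :
    aritW F M (x :: w) = tmul F (fun s => tmul letter fun t => shift (s + t) M) (x :: w)
      - tmul F (fun s => shift (x + s) M) w + aritW F (shift x M) w := by
  have h1 : tmul F (fun s => tmul letter fun t => shift (s + t) M) (x :: w) =
      ((splits (x :: w)).map fun q =>
        (if q.2.isEmpty then 0 else M ([] ++ addFirst q.1.sum q.2) * F q.1) -
          if ([] : List α).isEmpty then 0 else M (addLast q.1.sum [] ++ q.2) * F q.1).sum := by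
    refine congrArg List.sum (List.map_congr_left fun q _ => ?_)
    obtain ⟨q1, q2⟩ := q
    cases q2 with
    | nil => simp
    | cons y q2 => simp [tmul_letter_cons, addFirst, mul_comm]
  have h2 : tmul F (fun s => shift (x + s) M) w = ((splits₃ w).map fun t =>
      if t.1.isEmpty then M ((x + t.2.1.sum) :: t.2.2) * F t.2.1 else 0).sum := by
    rw [sum_splits₃_ite fun b c => M ((x + b.sum) :: c) * F b]
    simp [tmul, mul_comm]
  rw [h1, h2, aritW, splits₃_cons, List.map_append, List.sum_append, List.map_map, List.map_map,
    sub_add_eq_add_sub, add_sub_assoc]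
  congr 1
  rw [aritW, ← list_sum_map_sub]
  refine congrArg List.sum (List.map_congr_left fun t _ => ?_)
  obtain ⟨a, b, c⟩ := t
  cases a with
  | nil => simp [addLast]
  | cons y a => simp [addLast]

theorem wmul_letter_cons (F : List α → R) (x : α) (w : List α) :
    wmul letter F (x :: w) = F w := tmul_letter_cons _ _ _

/-- The function `F b - b F`, where `b` is the function `letter`. -/
def bracketLetter (F : List α → R) : List α → R := wmul F letter - wmul letter F

/-- Adding the sum of `b` to the next letter `y` is merging the block `by`, whose weight is the
product of `F` with `letter`. Adding it to the preceding letter gives the product in the other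
order, with a minus sign. -/
theorem aritW_eq_derW (F M : List α → R) : aritW F M = derW (bracketLetter F) M := by
  ext w
  induction w generalizing M with
  | nil => simp [aritW, splits₃, splits]
  | cons x w ih =>
    rw [aritW_cons, ih, derW_cons, tmul_assoc F (fun _ => letter) (fun s => shift s M) (x :: w),
      tmul_cons]
    have h : shift x (bracketLetter F) = shift x (wmul F letter) + (-1 : R) • F := by
      ext v
      simp [bracketLetter, wmul_letter_cons, sub_eq_add_neg]
    rw [h, tmul_add_left, tmul_smul_left]
    simp [wmul]
    ring

theorem bracketLetter_wvan {F : List α → R} (hF : F [] = 0) : WVan 2 (bracketLetter F) := by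
  intro w hw
  match w, hw with
  | [], _ => simp [bracketLetter, wmul]
  | [x], _ => simp [bracketLetter, wmul, tmul_cons, hF]
  | x :: y :: w, hw => simp at hw

/-! ### The automorphism `garit` -/

/-- The contribution of a cutting to `garit`. -/
def cutWeight (P N Q : List α → R) (l : List (List α × List α × List α)) : R :=
  Q (flexed l) * (l.map fun t => P t.1).prod * (l.map fun t => N t.2.2).prod

/-- The operator `garit` on functions on words, with `N` in the role of `P⁻¹`. -/
def garitW (P N Q : List α → R) : List α → R := fun w =>
  ∑ s ∈ Finset.range (w.length + 1),
    (((cuttings s w).filter fun l => admissible l).map (cutWeight P N Q)).sum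

/-- The part of `garit` coming from cuttings in `s` blocks. -/
def cutSum (P N Q : List α → R) (s : ℕ) (w : List α) : R :=
  ((cuttings s w).map fun l => if admissible l then cutWeight P N Q l else 0).sum

/-- The part of `garit` coming from cuttings in `s + 1` blocks with `a₁ = ∅`, the factor
`P(a₁)` being left out. -/
def cutSumTail (P N M : List α → R) (s : ℕ) (w : List α) : R :=
  ((splits w).map fun p => ((splits p.2).map fun q => ((cuttings s q.2).map fun l =>
    if admissible (([], p.1, q.1) :: l) then
      N q.1 * cutWeight P N (fun v => M (addLast q.1.sum p.1 ++ v)) l else 0).sum).sum).sum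

theorem admissible_cons (a b c : List α) (l : List (List α × List α × List α)) :
    admissible ((a, b, c) :: l) = (!b.isEmpty && admissible l &&
      (match l with | [] => true | t :: _ => !(c ++ t.1).isEmpty)) := by
  cases l with
  | nil => simp [admissible]
  | cons t l => exact Bool.and_right_comm _ _ _

theorem cutSum_zero (P N Q : List α → R) (w : List α) : cutSum P N Q 0 w = Q [] * wone w := by
  cases w <;> simp [cutSum, cuttings, admissible, cutWeight, flexed, wone]

theorem addLast_addFirst (s t : α) (b : List α) :
    addLast t (addFirst s b) = addFirst s (addLast t b) := by
  match b with
  | [] => rfl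
  | [y] => simp [addFirst, addLast, add_assoc]
  | y :: z :: b => rfl

theorem addFirst_append (s : α) (b v : List α) (hb : b ≠ []) :
    addFirst s b ++ v = addFirst s (b ++ v) := by
  cases b with
  | nil => exact absurd rfl hb
  | cons y b => rfl

theorem addLast_ne_nil (t : α) (b : List α) (hb : b ≠ []) : addLast t b ≠ [] := by
  match b, hb with
  | [y], _ => simp [addLast]
  | y :: z :: b, _ => simp [addLast]

/-- Only the sum of `a₁` is remembered by the rest of the cutting, so its factor can be split off as
a twisted product. -/
theorem cutSum_succ (P N Q : List α → R) (s : ℕ) (w : List α) : cutSum P N Q (s + 1) w =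
    tmul P (fun t => cutSumTail P N (fun v => Q (addFirst t v)) s) w := by
  simp only [cutSum, cuttings, sum_map_flatMap, tmul, cutSumTail, List.map_map, Function.comp_def,
    list_mul_sum]
  refine congrArg List.sum (List.map_congr_left fun p _ => ?_)
  refine congrArg List.sum (List.map_congr_left fun q _ => ?_)
  refine congrArg List.sum (List.map_congr_left fun t _ => ?_)
  refine congrArg List.sum (List.map_congr_left fun l _ => ?_)
  rw [admissible_cons, admissible_cons]
  split_ifs with h
  · have hq : q.1 ≠ [] := by
      rintro hq
      simp [hq] at h
    have : flexed ((p.1, q.1, t.1) :: l) = addFirst p.1.sum (addLast t.1.sum q.1 ++ flexed l) := by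
      rw [← addFirst_append _ _ _ (addLast_ne_nil _ _ hq), ← addLast_addFirst]
      rfl
    simp only [cutWeight, this, List.map_cons, List.prod_cons]
    ring
  · simp

theorem cutSumTail_nil (P N M : List α → R) (s : ℕ) : cutSumTail P N M s [] = 0 := by
  simp [cutSumTail, splits, admissible_cons]

theorem cutSumTail_cons_aux (P N M : List α → R) (s : ℕ) (x : α) (w : List α) :
    cutSumTail P N M s (x :: w) = cutSumTail P N (shift x M) s w +
      ((splits w).map fun q => ((cuttings s q.2).map fun l =>
        if admissible (([], [x], q.1) :: l) then
          N q.1 * cutWeight P N (shift (x + q.1.sum) M) l else 0).sum).sum := by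
  rw [← sum_splits_ite (fun r => ((splits r).map fun q => ((cuttings s q.2).map fun l =>
        if admissible (([], [x], q.1) :: l) then
          N q.1 * cutWeight P N (shift (x + q.1.sum) M) l else 0).sum).sum) w, cutSumTail,
    cutSumTail, splits, List.map_cons, List.sum_cons, ← List.sum_map_add, List.map_map]
  simp only [admissible_cons, List.isEmpty_nil, Bool.not_true, Bool.false_and, Bool.false_eq_true,
    if_false, List.map_const', List.sum_replicate, smul_zero, zero_add]
  refine congrArg List.sum (List.map_congr_left fun p _ => ?_)
  obtain ⟨p, r⟩ := p
  cases p with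
  | nil =>
    simp [addLast]
    rfl
  | cons y p =>
    simp [addLast]

variable {P N : List α → R} (hP : P [] = 1) (hN : N [] = 1)

theorem cutSumTail_zero_cons (M : List α → R) (x : α) (w : List α) :
    cutSumTail P N M 0 (x :: w) = cutSumTail P N (shift x M) 0 w +
      tmul N (fun t => cutSum P N (shift (x + t) M) 0) w := by
  rw [cutSumTail_cons_aux]
  congr 1
  refine congrArg List.sum (List.map_congr_left fun q _ => ?_)
  obtain ⟨q1, q2⟩ := q
  cases q2 <;> simp [cutSum, cuttings, admissible]

include hP hN in
-- If `b₁` has further letters, `x` is absorbed into `M`. If `b₁ = [x]`, an arbitrary `c₁` and an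
-- admissible remainder follow, except that `c₁` and `a₂` cannot both be empty. The excluded
-- cuttings are those with one block fewer, since `b₂` would then continue `b₁`.
theorem cutSumTail_succ_cons (M : List α → R) (s : ℕ) (x : α) (w : List α) :
    cutSumTail P N M (s + 1) (x :: w) = cutSumTail P N (shift x M) (s + 1) w -
      cutSumTail P N (shift x M) s w + tmul N (fun t => cutSum P N (shift (x + t) M) (s + 1)) w := by
  -- The excluded cuttings, rewritten as a sum over all `c₁` with the conditions that `c₁` and `a₂`
  -- are empty. Here `P [] = 1` removes the factor of `a₂`.
  have h : cutSumTail P N (shift x M) s w = ((splits w).map fun q =>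
      if q.1.isEmpty then ((cuttings (s + 1) q.2).map fun l =>
        if admissible l && (match l with | [] => false | t :: _ => t.1.isEmpty) then
          cutWeight P N (shift x M) l else 0).sum else 0).sum := by
    rw [sum_splits_ite (fun r => ((cuttings (s + 1) r).map fun l =>
        if admissible l && (match l with | [] => false | t :: _ => t.1.isEmpty) then
          cutWeight P N (shift x M) l else 0).sum) w]
    rw [← sum_splits_ite (cutSumTail P N (shift x M) s) w]
    simp only [cuttings, sum_map_flatMap, cutSumTail, List.map_map, Function.comp_def]
    refine congrArg List.sum (List.map_congr_left fun p _ => ?_)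
    obtain ⟨p, r⟩ := p
    cases p with
    | cons y p => simp
    | nil =>
      simp only [List.isEmpty_nil, if_true]
      refine congrArg List.sum (List.map_congr_left fun q _ => ?_)
      refine congrArg List.sum (List.map_congr_left fun t _ => ?_)
      refine congrArg List.sum (List.map_congr_left fun l _ => ?_)
      rw [Bool.and_true]
      split_ifs with h
      · have hq : q.1 ≠ [] := by
          rintro hq
          simp [hq, admissible_cons] at h
        obtain ⟨y, b, hb⟩ := List.exists_cons_of_ne_nil hq
        have : flexed (([], q.1, t.1) :: l) = addLast t.1.sum q.1 ++ flexed l := by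
          simp [flexed, hb, addFirst]
        simp only [cutWeight, this, List.map_cons, List.prod_cons, hP]
        ring
      · rfl
  rw [cutSumTail_cons_aux, sub_add_eq_add_sub, add_sub_assoc]
  congr 1
  rw [h, tmul, ← list_sum_map_sub]
  refine congrArg List.sum (List.map_congr_left fun q _ => ?_)
  obtain ⟨c, q⟩ := q
  cases c with
  | cons y c =>
    simp only [cutSum, list_mul_sum, List.isEmpty_cons, Bool.false_eq_true, if_false, sub_zero]
    refine congrArg List.sum (List.map_congr_left fun l _ => ?_)
    cases l <;> simp [admissible_cons]
  | nil =>
    simp only [cutSum, list_mul_sum, List.isEmpty_nil, if_true, ← list_sum_map_sub]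
    refine congrArg List.sum (List.map_congr_left fun l _ => ?_)
    rw [admissible_cons]
    cases l with
    | nil => simp [admissible, hN]
    | cons t l =>
      cases h1 : admissible (t :: l) <;> cases h2 : t.1.isEmpty <;> simp_all

include hP hN in
-- The corrections telescope over the number of blocks, leaving one boundary term, which vanishes
-- for large `n` by `cutSumTail_eq_zero`.
theorem sum_cutSumTail_cons (M : List α → R) (n : ℕ) (x : α) (w : List α) :
    ∑ s ∈ Finset.range (n + 1), cutSumTail P N M s (x :: w) = cutSumTail P N (shift x M) n w +
      tmul N (fun t v => ∑ s ∈ Finset.range (n + 1), cutSum P N (shift (x + t) M) s v) w := by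
  induction n with
  | zero => simpa using cutSumTail_zero_cons M x w
  | succ n ih =>
    have : (fun t v => ∑ s ∈ Finset.range (n + 1 + 1), cutSum P N (shift (x + t) M) s v) =
      fun t => (fun v => ∑ s ∈ Finset.range (n + 1), cutSum P N (shift (x + t) M) s v) +
        cutSum P N (shift (x + t) M) (n + 1) := by
      ext t v
      rw [Finset.sum_range_succ]
      rfl
    rw [Finset.sum_range_succ, ih, cutSumTail_succ_cons hP hN, this, tmul_add_right, Pi.add_apply]
    ring

include hP hN in
-- There are `n + 1` chunks `bᵢ`, all nonempty, so at least `n + 1` letters would be needed.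
theorem cutSumTail_eq_zero (n : ℕ) (M : List α → R) (w : List α) (hw : w.length ≤ n) :
    cutSumTail P N M n w = 0 := by
  induction w using word_induction generalizing n M with
  | nil => exact cutSumTail_nil _ _ _ _
  | cons x w ih =>
    simp only [List.length_cons] at hw
    obtain ⟨n, rfl⟩ : ∃ k, n = k + 1 := ⟨n - 1, by omega⟩
    rw [cutSumTail_succ_cons hP hN, ih w le_rfl _ _ (by omega), ih w le_rfl _ _ (by omega)]
    rw [tmul_congr_right (G' := fun _ => 0)]
    · simp [tmul]
    · intro p q hpq
      have hq := (length_le_of_append hpq).2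
      rw [cutSum_succ, tmul_congr_right (G' := fun _ => 0)]
      · simp [tmul]
      · intro a v hv
        have := (length_le_of_append hv).2
        exact ih v (by omega) _ _ (by omega)

include hP hN in
-- On the right, `w` is cut into blocks `a y c` with a single middle letter `y`. Joining maximal
-- runs of middle letters with nothing between them gives the admissible cuttings: such a run is a
-- chunk `bᵢ`, and only its end letters receive sums.
theorem sum_cutSum (n : ℕ) (Q : List α → R) (w : List α) (hw : w.length ≤ n) :
    ∑ s ∈ Finset.range (n + 1), cutSum P N Q s w = compW Q (wmul P (wmul letter N)) w := by
  induction w using word_induction generalizing n Q with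
  | nil =>
    rw [Finset.sum_range_succ']
    simp [cutSum_zero, cutSum_succ, cutSumTail_nil, wone]
  | cons x w ih =>
    simp only [List.length_cons] at hw
    obtain ⟨n, rfl⟩ : ∃ k, n = k + 1 := ⟨n - 1, by omega⟩
    set K := wmul P (wmul letter N) with hK
    have hK0 : K [] = 0 := by simp [hK, wmul]
    have h1 : ∑ s ∈ Finset.range (n + 1 + 1), cutSum P N Q s (x :: w) =
        tmul P (fun t v => ∑ s ∈ Finset.range (n + 1),
          cutSumTail P N (fun v => Q (addFirst t v)) s v) (x :: w) := by
      have hadd : ∀ (n : ℕ) (G : ℕ → α → List α → R),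
          tmul P (fun t v => ∑ s ∈ Finset.range n, G s t v) (x :: w) =
            ∑ s ∈ Finset.range n, tmul P (G s) (x :: w) := by
        intro n G
        induction n with
        | zero => simp [tmul]
        | succ n ih =>
          rw [Finset.sum_range_succ, ← ih, ← Pi.add_apply (tmul _ _), ← tmul_add_right]
          simp only [Finset.sum_range_succ]
          rfl
      rw [Finset.sum_range_succ', cutSum_zero, hadd]
      simp only [cutSum_succ, wone, mul_zero, add_zero]
    have h2 : tmul P (fun t v => ∑ s ∈ Finset.range (n + 1),
          cutSumTail P N (fun v => Q (addFirst t v)) s v) (x :: w) =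
        tmul P (fun s => tmul letter fun t => tmul N fun u => compW (shift (s + t + u) Q) K)
          (x :: w) := by
      refine tmul_congr_right fun p q hpq => ?_
      cases q with
      | nil => simp [cutSumTail_nil]
      | cons y q =>
        have hl : q.length ≤ w.length := by
          have := (length_le_of_append hpq).2
          simp at this
          omega
        rw [sum_cutSumTail_cons hP hN, cutSumTail_eq_zero hP hN _ _ _ (by omega), zero_add,
          tmul_letter_cons]
        refine tmul_congr_right fun c v hv => ?_
        have := (length_le_of_append hv).2
        have hs : shift (y + c.sum) (fun v => Q (addFirst p.sum v)) =
            shift (p.sum + y + c.sum) Q := by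
          ext v
          simp [addFirst, add_assoc]
        rw [← ih v (by omega) n _ (by omega), hs]
    have h3 := tmul_assoc P (fun s => tmul letter fun _ => N) (fun s => compW (shift s Q) K) (x :: w)
    have h4 : ∀ s : α, tmul (tmul letter fun _ => N) (fun t => compW (shift (s + t) Q) K) =
        tmul letter fun t => tmul N fun u => compW (shift (s + t + u) Q) K := by
      intro s
      ext v
      rw [← tmul_assoc]
      simp only [add_assoc]
    simp only [h4] at h3
    have h5 : tmul P (fun _ => tmul letter fun _ => N) = K := rfl
    rw [h1, h2, h3, compW_cons, h5, tmul_cons, hK0, zero_mul, zero_add]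

include hP hN in
theorem garitW_eq_compW (Q : List α → R) (w : List α) :
    garitW P N Q w = compW Q (wmul P (wmul letter N)) w := by
  rw [← sum_cutSum hP hN w.length Q w le_rfl]
  exact Finset.sum_congr rfl fun s _ => sum_map_filter' _ _ _

end Words

/-! ### Algebraically independent words -/

/-- The letters of the word are algebraically independent over `ℚ`. -/
def Good {L : Type*} [CommRing L] [Algebra ℚ L] (w : List L) : Prop :=
  AlgebraicIndependent ℚ w.get

section Good

variable {L L' : Type*} [CommRing L] [Algebra ℚ L] [CommRing L'] [Algebra ℚ L']

theorem good_ofFn {n : ℕ} (v : Fin n → L) : Good (List.ofFn v) ↔ AlgebraicIndependent ℚ v := by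
  refine (algebraicIndependent_equiv' (finCongr (List.length_ofFn (f := v))) ?_)
  ext i
  simp
  rfl

theorem Good.map {w : List L} (hw : Good w) {f : L →ₐ[ℚ] L'} (hf : Function.Injective f) :
    Good (w.map f) := by
  have h : w.map f = List.ofFn (f ∘ w.get) := by
    rw [← List.map_ofFn, List.ofFn_get]
  rw [h, good_ofFn]
  exact AlgebraicIndependent.map' hw hf

theorem good_of_map {w : List L} (f : L →ₐ[ℚ] L') (hw : Good (w.map f)) : Good w := by
  have h : w.map f = List.ofFn (f ∘ w.get) := by
    rw [← List.map_ofFn, List.ofFn_get]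
  rw [h, good_ofFn] at hw
  exact AlgebraicIndependent.of_comp f hw

theorem Good.sublist {w w' : List L} (hw : Good w) (h : w'.Sublist w) : Good w' := by
  obtain ⟨f, hf⟩ := List.sublist_iff_exists_fin_orderEmbedding_get_eq.1 h
  have : w'.get = w.get ∘ f := funext hf
  rw [Good, this]
  exact AlgebraicIndependent.comp hw f f.injective

/-- It suffices to treat polynomial variables, as evaluation at an independent word is injective.
Setting the second of the two variables to zero sends the contracted word to a list of distinct
variables, and independence of an image implies independence. -/
theorem Good.contract {a c : List L} {x y : L} (h : Good (a ++ x :: y :: c)) :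
    Good (a ++ (x + y) :: c) := by
  generalize hw : a ++ x :: y :: c = w at h
  have hfin : (List.finRange w.length).map w.get = a ++ x :: y :: c := by
    rw [hw, ← List.ofFn_eq_map, List.ofFn_get]
  obtain ⟨A, l, hA, rfl, hl⟩ := List.map_eq_append_iff.1 hfin
  obtain ⟨i, l, rfl, rfl, hl'⟩ := List.map_eq_cons_iff.1 hl
  obtain ⟨j, C, rfl, rfl, rfl⟩ := List.map_eq_cons_iff.1 hl'
  have hnd := hA ▸ List.nodup_finRange w.length
  rw [List.nodup_append] at hnd
  obtain ⟨-, hnd, hdisj⟩ := hnd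
  rw [List.nodup_cons, List.nodup_cons] at hnd
  have hij : i ≠ j := fun h => hnd.1 (h ▸ List.mem_cons_self)
  have hCj : ∀ k ∈ C, k ≠ j := fun k hk h => hnd.2.1 (h ▸ hk)
  have hAj : ∀ k ∈ A, k ≠ j := fun k hk => hdisj k hk j (by simp)
  let X : Fin w.length → MvPolynomial (Fin w.length) ℚ := MvPolynomial.X
  have e : A.map w.get ++ (w.get i + w.get j) :: C.map w.get =
      (A.map X ++ (X i + X j) :: C.map X).map (MvPolynomial.aeval w.get) := by
    simp [X, Function.comp_def]
    rfl
  rw [e]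
  refine Good.map ?_ h
  let σ : MvPolynomial (Fin w.length) ℚ →ₐ[ℚ] MvPolynomial (Fin w.length) ℚ :=
    MvPolynomial.aeval fun k => if k = j then 0 else X k
  refine good_of_map σ ?_
  have hσ : ∀ k, k ≠ j → σ (X k) = X k := fun k hk => by simp [σ, X, hk]
  have hσj : σ (X j) = 0 := by simp [σ, X]
  have e2 : (A.map X ++ (X i + X j) :: C.map X).map σ = (A ++ i :: C).map X := by
    simp only [List.map_append, List.map_cons, List.map_map, map_add, hσ i hij, hσj, add_zero]
    congr 1
    · exact List.map_congr_left fun k hk => hσ k (hAj k hk)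
    · congr 1
      exact List.map_congr_left fun k hk => hσ k (hCj k hk)
  rw [e2]
  have hX : Good (List.ofFn X) := (good_ofFn X).2 (MvPolynomial.algebraicIndependent_X _ _)
  rw [List.ofFn_eq_map, hA] at hX
  exact hX.sublist (List.Sublist.map _ (by simp))

theorem Good.merge {a b c : List L} (h : Good (a ++ b ++ c)) (hb : b ≠ []) :
    Good (a ++ b.sum :: c) := by
  obtain ⟨x, b, rfl⟩ := List.exists_cons_of_ne_nil hb
  clear hb
  induction b generalizing x with
  | nil => simpa using h
  | cons y b ih =>
    have h' := ih (x + y) (by simpa using Good.contract (a := a) (c := b ++ c) (by simpa using h))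
    simpa [add_assoc] using h'

theorem Good.left {a b : List L} (h : Good (a ++ b)) : Good a :=
  h.sublist (List.sublist_append_left _ _)

theorem Good.right {a b : List L} (h : Good (a ++ b)) : Good b :=
  h.sublist (List.sublist_append_right _ _)

end Good

/-! ### Naturality -/

section Naturality

variable {L L' : Type*} [Field L] [Algebra ℚ L] [Field L'] [Algebra ℚ L'] (θ : L →ₐ[ℚ] L')

/-- The two functions on words correspond to each other under a field homomorphism, on
algebraically independent words. -/
def Compat (F : List L → L) (F' : List L' → L') : Prop :=
  ∀ w, Good w → θ (F w) = F' (w.map θ)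

variable {θ}

theorem map_tmul {F : List L → L} {F' : List L' → L'} {G : L → List L → L}
    {G' : L' → List L' → L'} {w : List L}
    (h : ∀ p q, p ++ q = w →
      θ (F p) * θ (G p.sum q) = F' (p.map θ) * G' (θ p.sum) (q.map θ)) :
    θ (tmul F G w) = tmul F' G' (w.map θ) := by
  rw [tmul, map_list_sum, List.map_map, tmul, splits_map, List.map_map]
  refine congrArg List.sum (List.map_congr_left fun p hp => ?_)
  have := h p.1 p.2 (mem_splits.1 hp)
  rw [map_list_sum] at this
  simpa using this

theorem Compat.wmul {F G : List L → L} {F' G' : List L' → L'} (hF : Compat θ F F')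
    (hG : Compat θ G G') : Compat θ (wmul F G) (wmul F' G') := by
  intro w hw
  refine map_tmul fun p q h => ?_
  subst h
  rw [hF p hw.left, hG q hw.right]

theorem Compat.letter : Compat θ letter letter := by
  intro w _
  match w with
  | [] => simp
  | [x] => simp
  | x :: y :: w => exact map_zero θ

theorem Compat.compW {M K : List L → L} {M' K' : List L' → L'} (hM : Compat θ M M')
    (hK : Compat θ K K') : Compat θ (compW M K) (compW M' K') := by
  -- A shift of `M` by a fixed letter is not natural by itself. The merged letters are therefore
  -- kept in a prefix `v`, so that independence is always that of the whole argument of `M`.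
  suffices h : ∀ w v : List L, Good (v ++ w) → θ (MouldTheory.compW (fun z => M (v ++ z)) K w) =
      MouldTheory.compW (fun z => M' (v.map θ ++ z)) K' (w.map θ) from fun w hw => h w [] hw
  intro w
  induction w using word_induction with
  | nil =>
    intro v hv
    simp only [List.append_nil] at hv
    simp [hM v hv]
  | cons x w ih =>
    intro v hv
    rw [compW_cons, List.map_cons, compW_cons]
    refine map_tmul fun p q h => ?_
    have hq := (length_le_of_append h).2
    subst h
    have h1 : Good (x :: p) := hv.right.sublist (by simp)
    have h2 : Good (v ++ (x :: p).sum :: q) := Good.merge (by simpa using hv) (by simp)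
    have h3 := ih q hq (v ++ [x + p.sum]) (by simpa using h2)
    simp only [shift_apply, hK _ h1, List.map_cons]
    congr 1
    have e1 : shift (x + p.sum) (fun z => M (v ++ z)) = fun z => M (v ++ [x + p.sum] ++ z) := by
      ext z; simp
    have e2 : shift (θ x + θ p.sum) (fun z => M' (v.map θ ++ z)) =
        fun z => M' ((v ++ [x + p.sum]).map θ ++ z) := by
      ext z; simp
    rw [e1, e2, h3]

theorem Compat.derW {M K : List L → L} {M' K' : List L' → L'} (hM : Compat θ M M')
    (hK : Compat θ K K') : Compat θ (derW K M) (derW K' M') := by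
  suffices h : ∀ w v : List L, Good (v ++ w) → θ (MouldTheory.derW K (fun z => M (v ++ z)) w) =
      MouldTheory.derW K' (fun z => M' (v.map θ ++ z)) (w.map θ) from fun w hw => h w [] hw
  intro w
  induction w with
  | nil => intro v _; simp
  | cons x w ih =>
    intro v hv
    rw [derW_cons, List.map_cons, derW_cons, map_add]
    congr 1
    · refine map_tmul fun p q h => ?_
      subst h
      have h1 : Good (x :: p) := hv.right.sublist (by simp)
      have h2 : Good (v ++ (x :: p).sum :: q) := Good.merge (by simpa using hv) (by simp)
      have h3 := hM _ h2
      simp only [shift_apply, hK _ h1, List.map_cons]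
      simpa using Or.inl h3
    · have h3 := ih (v ++ [x]) (by simpa using hv)
      have e1 : shift x (fun z => M (v ++ z)) = fun z => M (v ++ [x] ++ z) := by
        ext z; simp
      have e2 : shift (θ x) (fun z => M' (v.map θ ++ z)) =
          fun z => M' ((v ++ [x]).map θ ++ z) := by
        ext z; simp
      rw [e1, e2, h3]

theorem Compat.sub {F G : List L → L} {F' G' : List L' → L'} (hF : Compat θ F F')
    (hG : Compat θ G G') : Compat θ (F - G) (F' - G') := by
  intro w hw
  simp [hF w hw, hG w hw]

theorem Compat.bracketLetter {F : List L → L} {F' : List L' → L'} (hF : Compat θ F F') :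
    Compat θ (bracketLetter F) (bracketLetter F') :=
  (hF.wmul Compat.letter).sub (Compat.letter.wmul hF)

theorem Compat.invW {F : List L → L} {F' : List L' → L'} (hF : Compat θ F F') :
    Compat θ (invW F) (invW F') := by
  intro w hw
  induction w using word_induction with
  | nil => simp [invW_nil]
  | cons x w ih =>
    rw [invW_cons, List.map_cons, invW_cons, map_neg, neg_inj]
    refine map_tmul fun p q h => ?_
    have hq := (length_le_of_append h).2
    subst h
    rw [shift_apply, hF (x :: p) (hw.sublist (by simp)), ih q hq (hw.sublist (by simp))]
    rfl

end Naturality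

/-! ### Values of moulds on words -/

section Eval

variable {L L' : Type*} [Field L] [Algebra ℚ L] [Field L'] [Algebra ℚ L']

theorem Good.injective {w : List L} (hw : Good w) : Function.Injective
    (MvPolynomial.aeval w.get : MvPolynomial (Fin w.length) ℚ →ₐ[ℚ] L) := hw

/-- The field homomorphism substituting an algebraically independent word. -/
def Good.hom {w : List L} (hw : Good w) : RatFun w.length →ₐ[ℚ] L :=
  IsFractionRing.liftAlgHom (K := RatFun w.length) (g := MvPolynomial.aeval w.get) hw.injective

theorem Good.hom_u {w : List L} (hw : Good w) (i : Fin w.length) : hw.hom (u i) = w.get i := by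
  rw [u, Good.hom, IsFractionRing.liftAlgHom_apply, IsFractionRing.lift_algebraMap]
  simp

theorem Good.eval_eq {w : List L} (hw : Good w) (P : Mould) : P.eval w = hw.hom (P w.length) := by
  rw [Mould.eval, subst, dif_pos hw.injective]
  rfl

theorem Good.map_genericWord {w : List L} (hw : Good w) :
    (genericWord w.length).map hw.hom = w := by
  rw [genericWord, List.map_ofFn]
  conv_rhs => rw [← List.ofFn_get w]
  congr 1
  ext i
  exact hw.hom_u i

/-- The default value of `subst` being zero, evaluation is linear in the mould on every word;
multiplicative statements still need independence. -/
theorem eval_of_not_good {w : List L} (hw : ¬ Good w) (P : Mould) : P.eval w = 0 := by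
  rw [Mould.eval, subst]
  exact dif_neg hw

theorem good_genericWord (r : ℕ) : Good (genericWord r) := by
  rw [genericWord, good_ofFn]
  exact AlgebraicIndependent.map' (MvPolynomial.algebraicIndependent_X (Fin r) ℚ)
    (f := IsScalarTower.toAlgHom ℚ _ (RatFun r)) (IsFractionRing.injective _ _)

theorem length_genericWord (r : ℕ) : (genericWord r).length = r := List.length_ofFn

theorem ratFun_hom_ext {r : ℕ} {f g : RatFun r →ₐ[ℚ] L} (h : ∀ i, f (u i) = g (u i)) : f = g := by
  refine IsLocalization.algHom_ext (nonZeroDivisors (MvPolynomial (Fin r) ℚ)) ?_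
  ext i
  exact h i

theorem eval_ofFn {n : ℕ} (v : Fin n → L) (P : Mould) : P.eval (List.ofFn v) = subst (P n) v := by
  -- The length of `List.ofFn v` equals `n` only propositionally, so the depth is generalized before
  -- substituting.
  have h : ∀ (m : ℕ) (e : m = n) (v' : Fin m → L), (∀ i, v' i = v (i.cast e)) →
      subst (P m) v' = subst (P n) v := by
    rintro m rfl v' h
    congr 1
    exact funext h
  exact h _ List.length_ofFn _ fun i => by simp; rfl

@[simp] theorem eval_genericWord (P : Mould) (r : ℕ) : P.eval (genericWord r) = P r := by
  rw [genericWord, eval_ofFn, subst]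
  have h := (good_ofFn _).1 (good_genericWord r)
  have h' : Function.Injective (MvPolynomial.aeval u : MvPolynomial (Fin r) ℚ →ₐ[ℚ] RatFun r) := h
  rw [dif_pos h']
  have : IsFractionRing.liftAlgHom (K := RatFun r) (g := MvPolynomial.aeval u) h' =
      AlgHom.id ℚ (RatFun r) := by
    refine ratFun_hom_ext fun i => ?_
    rw [u, IsFractionRing.liftAlgHom_apply, IsFractionRing.lift_algebraMap]
    simp [u]
  exact DFunLike.congr_fun this (P r)

theorem Mould.ext_eval {P Q : Mould} (h : ∀ r, P.eval (genericWord r) = Q.eval (genericWord r)) :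
    P = Q := by
  funext r
  simpa using h r

/-- Both sides come from homomorphisms out of the field of rational functions, and these agree on
the variables. -/
theorem compat_eval (θ : L →ₐ[ℚ] L') (P : Mould) : Compat θ P.eval P.eval := by
  intro w hw
  have h : w.map θ = List.ofFn (θ ∘ w.get) := by
    rw [← List.map_ofFn, List.ofFn_get]
  have hg : Good (List.ofFn (θ ∘ w.get)) := h ▸ hw.map θ.injective
  have hg' : Function.Injective
      (MvPolynomial.aeval (θ ∘ w.get) : MvPolynomial (Fin w.length) ℚ →ₐ[ℚ] L') :=
    (good_ofFn _).1 hg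
  rw [h, eval_ofFn, hw.eval_eq, subst, dif_pos hg']
  have : θ.comp hw.hom = IsFractionRing.liftAlgHom (K := RatFun w.length)
      (g := MvPolynomial.aeval (θ ∘ w.get)) hg' := by
    refine ratFun_hom_ext fun i => ?_
    rw [AlgHom.comp_apply, hw.hom_u, u, IsFractionRing.liftAlgHom_apply,
      IsFractionRing.lift_algebraMap]
    simp
  exact DFunLike.congr_fun this (P w.length)

/-- An operation given by a natural formula on generic words is given by it on all
algebraically independent words. -/
theorem eval_eq_of_compat {P : Mould} {w : List L} (hw : Good w)
    {F : List (RatFun w.length) → RatFun w.length} {F' : List L → L}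
    (hP : P w.length = F (genericWord w.length)) (hF : Compat hw.hom F F') : P.eval w = F' w := by
  rw [hw.eval_eq, hP, hF _ (good_genericWord _), hw.map_genericWord]

theorem eval_add (P Q : Mould) : (P + Q).eval (L := L) = P.eval + Q.eval := by
  ext w
  by_cases hw : Good w
  · have h : (P + Q) w.length = P w.length + Q w.length := rfl
    rw [Pi.add_apply, hw.eval_eq, hw.eval_eq, hw.eval_eq, h, map_add]
  · simp [eval_of_not_good hw]

/-- The scalar action in use comes from the localization instance rather than from the algebra
structure; the two agree because ℚ-module structures are unique. -/
theorem ratFun_smul_def {r : ℕ} (c : ℚ) (x : RatFun r) : c • x = algebraMap ℚ (RatFun r) c * x := by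
  have h : (OreLocalization.instModuleOfIsScalarTower : Module ℚ (RatFun r)) = Algebra.toModule :=
    Subsingleton.elim _ _
  exact (congrArg (fun m : Module ℚ (RatFun r) => m.smul c x) h).trans (Algebra.smul_def c x)

theorem eval_smul (c : ℚ) (P : Mould) (w : List L) :
    (c • P).eval w = algebraMap ℚ L c * P.eval w := by
  by_cases hw : Good w
  · have h : (c • P) w.length = c • P w.length := rfl
    rw [hw.eval_eq, hw.eval_eq, h, ratFun_smul_def, map_mul, AlgHom.commutes]
  · simp [eval_of_not_good hw]

theorem eval_neg (P : Mould) : (-P).eval (L := L) = -P.eval := by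
  ext w
  have h : -P = (-1 : ℚ) • P := by simp
  rw [h, eval_smul]
  simp

theorem eval_sub (P Q : Mould) : (P - Q).eval (L := L) = P.eval - Q.eval := by
  rw [sub_eq_add_neg, eval_add, eval_neg, sub_eq_add_neg]

theorem one_apply (r : ℕ) : (1 : Mould) r = if r = 0 then 1 else 0 := rfl

theorem eval_one {w : List L} (hw : Good w) : (1 : Mould).eval w = wone w := by
  rw [hw.eval_eq, one_apply]
  cases w <;> simp [wone]

theorem eval_mu (P Q : Mould) {w : List L} (hw : Good w) :
    (mu P Q).eval w = wmul P.eval Q.eval w :=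
  eval_eq_of_compat hw rfl ((compat_eval _ P).wmul (compat_eval _ Q))

theorem eval_nil (P : Mould) (c : ℚ) (h : P 0 = algebraMap ℚ _ c) :
    P.eval ([] : List L) = algebraMap ℚ L c := by
  have hg : Good ([] : List L) :=
    (good_ofFn Fin.elim0).2 algebraicIndependent_empty_type
  rw [hg.eval_eq]
  exact (congrArg hg.hom h).trans (AlgHom.commutes _ _)

end Eval

/-! ### Equality on algebraically independent words -/

section GEq

variable {L : Type*} [Field L] [Algebra ℚ L]

/-- The two functions agree on algebraically independent words. -/
def GEq (F F' : List L → L) : Prop := ∀ w, Good w → F w = F' w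

theorem GEq.rfl {F : List L → L} : GEq F F := fun _ _ => Eq.refl _

theorem GEq.of_eq {F F' : List L → L} (h : F = F') : GEq F F' := h ▸ GEq.rfl

theorem GEq.symm {F F' : List L → L} (h : GEq F F') : GEq F' F := fun w hw => (h w hw).symm

theorem GEq.trans {F F' F'' : List L → L} (h : GEq F F') (h' : GEq F' F'') : GEq F F'' :=
  fun w hw => (h w hw).trans (h' w hw)

/-- Makes congruence for equality on independent words the special case of naturality at the
identity. -/
theorem compat_id {F F' : List L → L} : Compat (AlgHom.id ℚ L) F F' ↔ GEq F F' := by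
  simp [Compat, GEq]

variable {F F' G G' : List L → L}

theorem GEq.wmul (h : GEq F F') (h' : GEq G G') : GEq (wmul F G) (wmul F' G') :=
  compat_id.1 ((compat_id.2 h).wmul (compat_id.2 h'))

theorem GEq.compW (h : GEq F F') (h' : GEq G G') : GEq (compW F G) (compW F' G') :=
  compat_id.1 ((compat_id.2 h).compW (compat_id.2 h'))

theorem GEq.derW (h : GEq F F') (h' : GEq G G') : GEq (derW G F) (derW G' F') :=
  compat_id.1 ((compat_id.2 h).derW (compat_id.2 h'))

theorem GEq.bracketLetter (h : GEq F F') : GEq (bracketLetter F) (bracketLetter F') :=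
  compat_id.1 (compat_id.2 h).bracketLetter

theorem GEq.add (h : GEq F F') (h' : GEq G G') : GEq (F + G) (F' + G') :=
  fun w hw => congrArg₂ (· + ·) (h w hw) (h' w hw)

theorem Mould.ext_geq {P Q : Mould} (h : ∀ r, GEq (L := RatFun r) P.eval Q.eval) : P = Q :=
  Mould.ext_eval fun r => h r _ (good_genericWord r)

theorem eval_smul' (c : ℚ) (P : Mould) : (c • P).eval (L := L) = algebraMap ℚ L c • P.eval :=
  funext fun w => eval_smul c P w

theorem eval_zero : (0 : Mould).eval (L := L) = 0 := by
  have := eval_smul' (L := L) 0 0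
  simpa using this

end GEq

/-! ### The ring of moulds -/

section Ring

set_option linter.unusedSectionVars false

variable {L : Type*} [Field L] [Algebra ℚ L]

theorem geq_mu (P Q : Mould) : GEq (L := L) (mu P Q).eval (wmul P.eval Q.eval) :=
  fun _ hw => eval_mu P Q hw

theorem geq_one : GEq (L := L) (1 : Mould).eval wone := fun _ hw => eval_one hw

theorem mu_assoc (P Q R : Mould) : mu (mu P Q) R = mu P (mu Q R) :=
  Mould.ext_geq fun _ => (geq_mu _ _).trans <| ((geq_mu P Q).wmul GEq.rfl).trans <|
    (GEq.of_eq (wmul_assoc _ _ _)).trans <| (GEq.rfl.wmul (geq_mu Q R).symm).trans (geq_mu _ _).symm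

theorem one_mu (P : Mould) : mu 1 P = P :=
  Mould.ext_geq fun _ => (geq_mu _ _).trans <| (geq_one.wmul GEq.rfl).trans
    (GEq.of_eq (one_wmul _))

theorem mu_one (P : Mould) : mu P 1 = P :=
  Mould.ext_geq fun _ => (geq_mu _ _).trans <| (GEq.rfl.wmul geq_one).trans
    (GEq.of_eq (wmul_one _))

theorem wmul_add_left (F G H : List L → L) : wmul (F + G) H = wmul F H + wmul G H :=
  tmul_add_left _ _ _

theorem wmul_add_right (F G H : List L → L) : wmul F (G + H) = wmul F G + wmul F H :=
  tmul_add_right _ _ _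

theorem add_mu (P Q R : Mould) : mu (P + Q) R = mu P R + mu Q R := by
  funext r
  change wmul (P + Q).eval R.eval (genericWord r) =
      wmul P.eval R.eval (genericWord r) + wmul Q.eval R.eval (genericWord r)
  rw [eval_add, wmul_add_left]
  rfl

theorem mu_add (P Q R : Mould) : mu P (Q + R) = mu P Q + mu P R := by
  funext r
  change wmul P.eval (Q + R).eval (genericWord r) =
      wmul P.eval Q.eval (genericWord r) + wmul P.eval R.eval (genericWord r)
  rw [eval_add, wmul_add_right]
  rfl

theorem smul_mu (c : ℚ) (P Q : Mould) : mu (c • P) Q = c • mu P Q := by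
  funext r
  change wmul (c • P).eval Q.eval (genericWord r) = c • wmul P.eval Q.eval (genericWord r)
  rw [eval_smul', ratFun_smul_def, wmul, tmul_smul_left]
  rfl

theorem mu_smul (c : ℚ) (P Q : Mould) : mu P (c • Q) = c • mu P Q := by
  funext r
  change wmul P.eval (c • Q).eval (genericWord r) = c • wmul P.eval Q.eval (genericWord r)
  rw [eval_smul', ratFun_smul_def, wmul, tmul_smul_right]
  rfl

local instance instMulMould : Mul Mould := ⟨mu⟩

local instance instRingMould : Ring Mould :=
  { (inferInstance : AddCommGroup Mould) with
    mul := mu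
    one := 1
    mul_assoc := mu_assoc
    one_mul := one_mu
    mul_one := mu_one
    left_distrib := mu_add
    right_distrib := add_mu
    zero_mul := fun P => by
      have h := smul_mu 0 0 P
      rw [zero_smul, zero_smul] at h
      exact h
    mul_zero := fun P => by
      have h := mu_smul 0 P 0
      rw [zero_smul, zero_smul] at h
      exact h }

instance : IsScalarTower ℚ Mould Mould := ⟨fun c P Q => smul_mu c P Q⟩

instance : SMulCommClass ℚ Mould Mould := ⟨fun c P Q => (mu_smul c P Q).symm⟩

theorem geq_mul (P Q : Mould) : GEq (L := L) (P * Q).eval (wmul P.eval Q.eval) := geq_mu P Q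

theorem mul_apply (P Q : Mould) (r : ℕ) : (P * Q) r = wmul P.eval Q.eval (genericWord r) := rfl

@[simp] theorem add_apply (P Q : Mould) (r : ℕ) : (P + Q) r = P r + Q r := rfl
@[simp] theorem sub_apply (P Q : Mould) (r : ℕ) : (P - Q) r = P r - Q r := rfl
@[simp] theorem zero_apply (r : ℕ) : (0 : Mould) r = 0 := rfl
@[simp] theorem smul_apply (c : ℚ) (P : Mould) (r : ℕ) : (c • P) r = c • P r := rfl

theorem sum_apply {ι : Type*} (s : Finset ι) (P : ι → Mould) (r : ℕ) :
    (∑ i ∈ s, P i) r = ∑ i ∈ s, P i r := by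
  induction s using Finset.cons_induction with
  | empty => rfl
  | cons a s ha ih => rw [Finset.sum_cons, Finset.sum_cons, add_apply, ih]

theorem genericWord_zero : genericWord 0 = [] := rfl

theorem mul_apply_zero (P Q : Mould) : (P * Q) 0 = P 0 * Q 0 := by
  rw [mul_apply, genericWord_zero, wmul, tmul_nil, ← genericWord_zero, eval_genericWord,
    eval_genericWord]

theorem eval_nil_of_mem_GARI {P : Mould} (hP : P ∈ GARI) : P.eval ([] : List L) = 1 := by
  have hP : P 0 = 1 := hP
  simpa using eval_nil (L := L) P 1 (by simpa using hP)

theorem eval_nil_of_mem_ARI {P : Mould} (hP : P ∈ ARI) : P.eval ([] : List L) = 0 := by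
  have hP : P 0 = 0 := hP
  simpa using eval_nil (L := L) P 0 (by simpa using hP)

theorem one_mem_GARI : (1 : Mould) ∈ GARI := rfl

theorem mul_mem_GARI {P Q : Mould} (hP : P ∈ GARI) (hQ : Q ∈ GARI) : P * Q ∈ GARI := by
  have hP : P 0 = 1 := hP
  have hQ : Q 0 = 1 := hQ
  change (P * Q) 0 = 1
  rw [mul_apply_zero, hP, hQ, one_mul]

/-! ### Inversion -/

theorem invmu_apply (P : Mould) (r : ℕ) : invmu P r = invW P.eval (genericWord r) := by
  have h : ∀ (n : ℕ) (w : List (RatFun r)) (h : w.length = n),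
      ∑ c : Composition n, (-1 : RatFun r) ^ c.length *
        ((w.splitWrtComposition c).map fun w => P.eval w).prod = invW P.eval w := by
    rintro n w rfl
    rfl
  exact h r _ (length_genericWord r)

theorem geq_invmu (P : Mould) : GEq (L := L) (invmu P).eval (invW P.eval) :=
  fun _ hw => eval_eq_of_compat hw (invmu_apply P _) (compat_eval _ P).invW

theorem mul_invmu {P : Mould} (hP : P ∈ GARI) : P * invmu P = 1 :=
  Mould.ext_geq fun _ => (geq_mul _ _).trans <| (GEq.rfl.wmul (geq_invmu P)).trans <|
    (GEq.of_eq (wmul_invW (eval_nil_of_mem_GARI hP))).trans geq_one.symm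

theorem invmu_mul {P : Mould} (hP : P ∈ GARI) : invmu P * P = 1 :=
  Mould.ext_geq fun _ => (geq_mul _ _).trans <| ((geq_invmu P).wmul GEq.rfl).trans <|
    (GEq.of_eq (invW_wmul (eval_nil_of_mem_GARI hP))).trans geq_one.symm

theorem invmu_mem_GARI (P : Mould) : invmu P ∈ GARI := by
  change invmu P 0 = 1
  rw [invmu_apply, genericWord_zero, invW_nil]

/-! ### Composition of moulds -/

/-- The mould that is `1` in depth one and `0` in all other depths. -/
def letterMould : Mould := fun r => letter (genericWord r)

theorem geq_letterMould : GEq (L := L) letterMould.eval letter :=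
  fun _ hw => eval_eq_of_compat hw rfl Compat.letter

/-- The composition of moulds. -/
def comp (M K : Mould) : Mould := fun r => compW M.eval K.eval (genericWord r)

theorem geq_comp (M K : Mould) : GEq (L := L) (comp M K).eval (compW M.eval K.eval) :=
  fun _ hw => eval_eq_of_compat hw rfl ((compat_eval _ M).compW (compat_eval _ K))

theorem comp_mul (M N K : Mould) : comp (M * N) K = comp M K * comp N K :=
  Mould.ext_geq fun _ => (geq_comp _ _).trans <| ((geq_mul M N).compW GEq.rfl).trans <|
    (GEq.of_eq (compW_wmul _ _ _)).trans <|
      ((geq_comp M K).symm.wmul (geq_comp N K).symm).trans (geq_mul _ _).symm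

theorem comp_one (K : Mould) : comp 1 K = 1 :=
  Mould.ext_geq fun _ => (geq_comp _ _).trans <| (geq_one.compW GEq.rfl).trans <|
    (GEq.of_eq (compW_wone _)).trans geq_one.symm

theorem comp_assoc (M K N : Mould) : comp (comp M K) N = comp M (comp K N) :=
  Mould.ext_geq fun _ => (geq_comp _ _).trans <| ((geq_comp M K).compW GEq.rfl).trans <|
    (GEq.of_eq (compW_assoc _ _ _)).trans <|
      (GEq.rfl.compW (geq_comp K N).symm).trans (geq_comp _ _).symm

theorem letter_comp {K : Mould} (hK : K ∈ ARI) : comp letterMould K = K :=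
  Mould.ext_geq fun _ => (geq_comp _ _).trans <| (geq_letterMould.compW GEq.rfl).trans <|
    GEq.of_eq (compW_letter _ (eval_nil_of_mem_ARI hK))

theorem comp_letter (M : Mould) : comp M letterMould = M :=
  Mould.ext_geq fun _ => (geq_comp _ _).trans <| (GEq.rfl.compW geq_letterMould).trans <|
    GEq.of_eq (letter_compW _)

theorem comp_apply_zero (M K : Mould) : comp M K 0 = M 0 := by
  rw [comp, genericWord_zero, compW_nil, ← genericWord_zero, eval_genericWord]

theorem comp_mem_GARI {M : Mould} (hM : M ∈ GARI) (K : Mould) : comp M K ∈ GARI :=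
  (comp_apply_zero M K).trans hM

theorem comp_smul (c : ℚ) (M K : Mould) : comp (c • M) K = c • comp M K := by
  funext r
  change compW (c • M).eval K.eval (genericWord r) = c • compW M.eval K.eval (genericWord r)
  rw [eval_smul', ratFun_smul_def, compW_smul]
  rfl

/-- The conjugate of `letterMould` by `P`. -/
def conjLetter (P : Mould) : Mould := P * (letterMould * invmu P)

theorem letterMould_apply_zero : letterMould 0 = 0 := rfl

theorem conjLetter_mem_ARI (P : Mould) : conjLetter P ∈ ARI := by
  change conjLetter P 0 = 0
  rw [conjLetter, mul_apply_zero, mul_apply_zero, letterMould_apply_zero, zero_mul, mul_zero]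

/-- Turns the flexion automorphism into the substitution of a conjugate of the generator; from here
on cuttings no longer appear. -/
theorem garit_eq_comp {P : Mould} (hP : P ∈ GARI) (Q : Mould) :
    garit P Q = comp Q (conjLetter P) := by
  funext r
  have h : garit P Q r = garitW P.eval (invmu P).eval Q.eval (genericWord r) := by
    rw [garitW, length_genericWord]
    rfl
  rw [h, garitW_eq_compW (eval_nil_of_mem_GARI hP) (eval_nil_of_mem_GARI (invmu_mem_GARI P)), comp]
  refine GEq.compW GEq.rfl ?_ _ (good_genericWord r)
  exact GEq.symm <| (geq_mul _ _).trans <| GEq.rfl.wmul <| (geq_mul _ _).trans <|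
    geq_letterMould.wmul GEq.rfl

/-! ### The derivation `arit` -/

theorem arit_apply (F M : Mould) (r : ℕ) :
    arit F M r = derW (bracketLetter F.eval) M.eval (genericWord r) := by
  rw [← aritW_eq_derW]
  rfl

theorem geq_arit (F M : Mould) :
    GEq (L := L) (arit F M).eval (derW (bracketLetter F.eval) M.eval) :=
  fun _ hw => eval_eq_of_compat hw (arit_apply F M _)
    ((compat_eval _ M).derW (compat_eval _ F).bracketLetter)

theorem arit_add (F M N : Mould) : arit F (M + N) = arit F M + arit F N := by
  funext r
  rw [add_apply, arit_apply, arit_apply, arit_apply, eval_add, derW_add]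
  rfl

theorem arit_smul (F : Mould) (c : ℚ) (M : Mould) : arit F (c • M) = c • arit F M := by
  funext r
  rw [smul_apply, arit_apply, arit_apply, eval_smul', ratFun_smul_def, derW_smul]
  rfl

theorem bracketLetter_add (F G : List L → L) :
    bracketLetter (F + G) = bracketLetter F + bracketLetter G := by
  rw [bracketLetter, wmul_add_left, wmul_add_right, bracketLetter, bracketLetter]
  abel

theorem bracketLetter_smul (c : L) (F : List L → L) :
    bracketLetter (c • F) = c • bracketLetter F := by
  rw [bracketLetter, wmul, tmul_smul_left, wmul, Pi.smul_def c F]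
  exact (congrArg (_ - ·) (tmul_smul_right c letter fun _ => F)).trans (smul_sub _ _ _).symm

theorem add_arit (F G M : Mould) : arit (F + G) M = arit F M + arit G M := by
  funext r
  rw [add_apply, arit_apply, arit_apply, arit_apply, eval_add, bracketLetter_add, derW_add_left]
  rfl

theorem smul_arit (c : ℚ) (F M : Mould) : arit (c • F) M = c • arit F M := by
  funext r
  rw [smul_apply, arit_apply, arit_apply, eval_smul', ratFun_smul_def, bracketLetter_smul,
    derW_smul_left]
  rfl

theorem arit_mul (F M N : Mould) : arit F (M * N) = arit F M * N + M * arit F N := by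
  refine Mould.ext_geq fun r => ?_
  rw [eval_add]
  exact (geq_arit _ _).trans <| ((geq_mul M N).derW GEq.rfl).trans <|
    (GEq.of_eq (derW_wmul _ _ _)).trans <|
      (((geq_arit F M).symm.wmul GEq.rfl).trans (geq_mul _ _).symm).add
        ((GEq.rfl.wmul (geq_arit F N).symm).trans (geq_mul _ _).symm)

theorem arit_one (F : Mould) : arit F 1 = 0 := by
  refine Mould.ext_geq fun r => ?_
  rw [eval_zero]
  exact (geq_arit _ _).trans <| (geq_one.derW GEq.rfl).trans <| GEq.of_eq (derW_wone _)

theorem geq_bracketLetter (F : Mould) : GEq (L := L) (F * letterMould - letterMould * F).eval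
    (bracketLetter F.eval) := by
  rw [eval_sub]
  intro w hw
  exact congrArg₂ (· - ·) (((geq_mul _ _).trans (GEq.rfl.wmul geq_letterMould)) w hw)
    (((geq_mul _ _).trans (geq_letterMould.wmul GEq.rfl)) w hw)

theorem arit_letter {F : Mould} (hF : F ∈ ARI) :
    arit F letterMould = F * letterMould - letterMould * F :=
  Mould.ext_geq fun r => (geq_arit _ _).trans <| (geq_letterMould.derW GEq.rfl).trans <|
    (GEq.of_eq (derW_letter _
      (bracketLetter_wvan (eval_nil_of_mem_ARI hF) [] (by simp)))).trans (geq_bracketLetter F).symm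

/-! ### The operators `dur` and `dar` -/

theorem sum_genericWord (r : ℕ) : (genericWord r).sum = ∑ i : Fin r, u i := List.sum_ofFn

theorem prod_genericWord (r : ℕ) : (genericWord r).prod = ∏ i : Fin r, u i := List.prod_ofFn

theorem geq_dur (P : Mould) : GEq (L := L) (dur P).eval fun w => w.sum * P.eval w := by
  intro w hw
  refine eval_eq_of_compat hw (F := fun w => w.sum * P.eval w)
    (F' := fun w => w.sum * P.eval w) ?_ ?_
  · rw [eval_genericWord, sum_genericWord]
    rfl
  · intro v hv
    rw [map_mul, map_list_sum, compat_eval _ P v hv]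

theorem dur_apply (P : Mould) (r : ℕ) : dur P r = (genericWord r).sum * P r := by
  rw [sum_genericWord]
  rfl

theorem dar_apply (P : Mould) (r : ℕ) : dar P r = (genericWord r).prod * P r := by
  rw [prod_genericWord]
  rfl

theorem wmul_sum_mul (F G : List L → L) (w : List L) :
    wmul (fun v => v.sum * F v) G w + wmul F (fun v => v.sum * G v) w = w.sum * wmul F G w := by
  rw [wmul, wmul, wmul, tmul, tmul, tmul, ← List.sum_map_add, list_mul_sum]
  refine congrArg List.sum (List.map_congr_left fun p hp => ?_)
  rw [← mem_splits.1 hp, List.sum_append]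
  ring

theorem dur_mul (P Q : Mould) : dur (P * Q) = dur P * Q + P * dur Q := by
  funext r
  rw [add_apply, dur_apply, mul_apply, ← wmul_sum_mul]
  exact (congrArg₂ (· + ·) (((geq_dur P).wmul GEq.rfl) _ (good_genericWord r))
    ((GEq.rfl.wmul (geq_dur Q)) _ (good_genericWord r))).symm

/-- Merging letters preserves the total sum. The offset `s` holds the sum of the blocks already
merged, as the induction requires. -/
theorem compW_sum_mul (s : L) (M K : List L → L) (w : List L) :
    compW (fun v => (s + v.sum) * M v) K w = (s + w.sum) * compW M K w := by
  induction w using word_induction generalizing s M with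
  | nil => simp
  | cons x w ih =>
    rw [compW_cons, compW_cons, ← smul_eq_mul, ← Pi.smul_apply, ← tmul_smul_right]
    refine tmul_congr_right fun p q h => ?_
    have hq := (length_le_of_append h).2
    have e : shift (x + p.sum) (fun v => (s + v.sum) * M v) =
        fun v => (s + (x + p.sum) + v.sum) * shift (x + p.sum) M v := by
      ext v
      simp [add_assoc]
    rw [e, ih q hq]
    subst h
    simp [add_assoc]

theorem derW_sum_mul (s : L) (M K : List L → L) (w : List L) :
    derW K (fun v => (s + v.sum) * M v) w = (s + w.sum) * derW K M w := by
  induction w generalizing s M with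
  | nil => simp
  | cons x w ih =>
    have e : ∀ y, shift y (fun v => (s + v.sum) * M v) =
        fun v => (s + y + v.sum) * shift y M v := by
      intro y
      ext v
      simp [add_assoc]
    rw [derW_cons, derW_cons, e, ih, mul_add, ← smul_eq_mul (_ + _) (tmul _ _ _), ← Pi.smul_apply,
      ← tmul_smul_right]
    congr 1
    · refine tmul_congr_right fun p q h => ?_
      subst h
      rw [e]
      simp [add_assoc]
    · simp [add_assoc]

theorem dur_comp (M K : Mould) : dur (comp M K) = comp (dur M) K := by
  funext r
  rw [dur_apply, comp, comp, ((geq_dur M).compW GEq.rfl) _ (good_genericWord r)]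
  simpa using (compW_sum_mul 0 M.eval K.eval (genericWord r)).symm

theorem arit_dur (F M : Mould) : arit F (dur M) = dur (arit F M) := by
  funext r
  rw [dur_apply, arit_apply, arit_apply, ((geq_dur M).derW GEq.rfl) _ (good_genericWord r)]
  simpa using derW_sum_mul 0 M.eval (bracketLetter F.eval) (genericWord r)

end Ring

attribute [local instance] instMulMould instRingMould

/-! ### The depth filtration -/

section Filtration

set_option linter.unusedSectionVars false

variable {L : Type*} [Field L] [Algebra ℚ L]

/-- The moulds that vanish in depths less than `k`. -/
def van (k : ℕ) : Submodule ℚ Mould where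
  carrier := {P | ∀ i < k, P i = 0}
  add_mem' hP hQ i hi := by rw [add_apply, hP i hi, hQ i hi, add_zero]
  zero_mem' _ _ := rfl
  smul_mem' c P hP i hi := by rw [smul_apply, hP i hi, ratFun_smul_def, mul_zero]

theorem mem_van_zero (P : Mould) : P ∈ van 0 := fun _ hi => absurd hi (Nat.not_lt_zero _)

theorem mem_van_one {P : Mould} : P ∈ van 1 ↔ P ∈ ARI :=
  ⟨fun h => h 0 one_pos, fun h i hi => by
    obtain rfl : i = 0 := by omega
    exact h⟩

theorem van_mono {k l : ℕ} (h : k ≤ l) {P : Mould} (hP : P ∈ van l) : P ∈ van k :=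
  fun i hi => hP i (by omega)

theorem eval_wvan {k : ℕ} {P : Mould} (hP : P ∈ van k) : WVan k (P.eval : List L → L) := by
  intro w hw
  by_cases hg : Good w
  · rw [hg.eval_eq, hP _ hw, map_zero]
  · exact eval_of_not_good hg P

theorem mul_mem_van {i j : ℕ} {P Q : Mould} (hP : P ∈ van i) (hQ : Q ∈ van j) :
    P * Q ∈ van (i + j) := fun r hr =>
  tmul_wvan (eval_wvan hP) (fun _ => eval_wvan hQ) _ (by rwa [length_genericWord])

theorem letter_wvan : WVan 1 (letter : List L → L) := fun w hw => by
  obtain rfl : w = [] := List.length_eq_zero_iff.1 (by omega)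
  rfl

/-- The bracket with `letter` raises the order of `F` by one, and merging the block into one letter
lowers it again. -/
theorem arit_mem_van {i j : ℕ} {F M : Mould} (hF : F ∈ van i) (hM : M ∈ van j) :
    arit F M ∈ van (i + j) := by
  intro r hr
  rw [arit_apply]
  refine derW_wvan (fun w hw => ?_) (eval_wvan hM) _ (by rwa [length_genericWord])
  rw [bracketLetter, Pi.sub_apply, wmul, wmul,
    tmul_wvan (eval_wvan hF) (fun _ => letter_wvan) w hw,
    tmul_wvan letter_wvan (fun _ => eval_wvan hF) w (by omega), sub_zero]

theorem van_ext {P Q : Mould} (h : ∀ k, P - Q ∈ van k) : P = Q := by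
  funext r
  exact sub_eq_zero.1 (h (r + 1) r (by omega))

/-- The multiplication by a rational function in each depth. -/
def scale (c : ∀ r, RatFun r) : Mould →ₗ[ℚ] Mould where
  toFun P := fun r => c r * P r
  map_add' P Q := by
    funext r
    exact mul_add _ _ _
  map_smul' q P := by
    funext r
    change c r * (q • P r) = q • (c r * P r)
    rw [ratFun_smul_def, ratFun_smul_def, mul_left_comm]

theorem scale_apply (c : ∀ r, RatFun r) (P : Mould) (r : ℕ) : scale c P r = c r * P r := rfl

theorem scale_mem_van (c : ∀ r, RatFun r) {k : ℕ} {P : Mould} (hP : P ∈ van k) :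
    scale c P ∈ van k := fun i hi => by rw [scale_apply, hP i hi, mul_zero]

theorem dar_eq_scale : dar = scale fun r => ∏ i : Fin r, u i := rfl
theorem dur_eq_scale : dur = scale fun r => ∑ i : Fin r, u i := rfl

theorem u_ne_zero {r : ℕ} (i : Fin r) : u i ≠ 0 := by
  intro h
  exact MvPolynomial.X_ne_zero (R := ℚ) i (IsFractionRing.injective _ (RatFun r)
    (h.trans (map_zero _).symm))

theorem prod_u_ne_zero (r : ℕ) : (∏ i : Fin r, u i) ≠ 0 :=
  Finset.prod_ne_zero_iff.2 fun i _ => u_ne_zero i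

theorem sum_u_ne_zero {r : ℕ} (hr : r ≠ 0) : (∑ i : Fin r, u i) ≠ 0 := by
  intro h
  have h1 : (∑ i : Fin r, MvPolynomial.X i : MvPolynomial (Fin r) ℚ) = 0 := by
    refine IsFractionRing.injective _ (RatFun r) ?_
    rw [map_sum, map_zero]
    exact h
  have h2 := congrArg (MvPolynomial.eval fun _ => (1 : ℚ)) h1
  simp [hr] at h2

theorem deltaFactor_ne_zero (r : ℕ) : deltaFactor r ≠ 0 := by
  rw [deltaFactor]
  split_ifs with h
  · exact one_ne_zero
  · exact mul_ne_zero (prod_u_ne_zero r) (sum_u_ne_zero h)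

theorem dar_darInv (P : Mould) : dar (darInv P) = P := by
  funext r
  exact mul_inv_cancel_left₀ (prod_u_ne_zero r) _

theorem darInv_dar (P : Mould) : darInv (dar P) = P := by
  funext r
  exact inv_mul_cancel_left₀ (prod_u_ne_zero r) _

theorem delta_deltaInv (P : Mould) : delta (deltaInv P) = P := by
  funext r
  exact mul_inv_cancel_left₀ (deltaFactor_ne_zero r) _

theorem deltaInv_delta (P : Mould) : deltaInv (delta P) = P := by
  funext r
  exact inv_mul_cancel_left₀ (deltaFactor_ne_zero r) _

/-- Depth zero is where the two could differ, `delta` being the identity there and `dur` zero. -/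
theorem delta_eq_dar_dur {F : Mould} (hF : F ∈ ARI) : delta F = dar (dur F) := by
  funext r
  have hF : F 0 = 0 := hF
  change deltaFactor r * F r = (∏ i : Fin r, u i) * ((∑ i : Fin r, u i) * F r)
  rw [deltaFactor, ← mul_assoc]
  split_ifs with h
  · subst h
    simp [hF]
  · rfl

theorem delta_mem_ARI {F : Mould} (hF : F ∈ ARI) : delta F ∈ ARI :=
  mem_van_one.1 (scale_mem_van deltaFactor (mem_van_one.2 hF))

theorem deltaInv_mem_ARI {F : Mould} (hF : F ∈ ARI) : deltaInv F ∈ ARI :=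
  mem_van_one.1 (scale_mem_van _ (mem_van_one.2 hF))

theorem bijOn_delta : Set.BijOn delta ARI ARI :=
  ⟨fun _ => delta_mem_ARI, fun P _ Q _ h => by rw [← deltaInv_delta P, h, deltaInv_delta],
    fun P hP => ⟨deltaInv P, deltaInv_mem_ARI hP, delta_deltaInv P⟩⟩

end Filtration

/-! ### Exponential generating functions -/

section Exponential

set_option linter.unusedSectionVars false

variable {L : Type*} [Field L] [Algebra ℚ L]

/-- The exponential generating function of a sequence of moulds. -/
def egf (p : ℕ → Mould) : Mould := fun r =>
  ∑ n ∈ Finset.range (r + 1), ((n ! : ℚ)⁻¹) • p n r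

theorem geq_egf (p : ℕ → Mould) : GEq (L := L) (egf p).eval (egfW fun n => (p n).eval) := by
  intro w hw
  rw [hw.eval_eq, egf, map_sum]
  refine Finset.sum_congr rfl fun n _ => ?_
  rw [ratFun_smul_def, map_mul, AlgHom.commutes, ← hw.eval_eq, Algebra.smul_def]

theorem eval_sum {ι : Type*} (s : Finset ι) (P : ι → Mould) :
    (∑ i ∈ s, P i).eval (L := L) = ∑ i ∈ s, (P i).eval := by
  induction s using Finset.cons_induction with
  | empty => exact eval_zero
  | cons a s ha ih => rw [Finset.sum_cons, Finset.sum_cons, eval_add, ih]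

theorem eval_nsmul (n : ℕ) (P : Mould) : (n • P).eval (L := L) = n • P.eval := by
  induction n with
  | zero => rw [zero_smul, zero_smul, eval_zero]
  | succ n ih => rw [succ_nsmul, succ_nsmul, eval_add, ih]

theorem egf_mul {p s : ℕ → Mould} (hp : ∀ n, p n ∈ van n) (hs : ∀ n, s n ∈ van n) :
    egf p * egf s = egf fun n =>
      ∑ ij ∈ Finset.HasAntidiagonal.antidiagonal n, n.choose ij.1 • (p ij.1 * s ij.2) := by
  refine Mould.ext_geq fun r => (geq_mul _ _).trans <| ((geq_egf p).wmul (geq_egf s)).trans <|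
    GEq.trans ?_ (geq_egf _).symm
  refine (GEq.of_eq (egfW_tmul (G := fun n _ => (s n).eval) (fun n => eval_wvan (hp n))
    fun n _ => eval_wvan (hs n)).symm).trans fun w hw => ?_
  refine Finset.sum_congr rfl fun n _ => congrArg _ ?_
  beta_reduce
  rw [eval_sum, Finset.sum_apply, Finset.sum_apply]
  refine Finset.sum_congr rfl fun ij _ => ?_
  rw [eval_nsmul, Pi.smul_apply, Pi.smul_apply, geq_mul _ _ w hw]
  rfl

theorem egf_eq {p : ℕ → Mould} (hp : ∀ n, p n ∈ van n) {r N : ℕ} (hN : r ≤ N) :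
    egf p r = (∑ n ∈ Finset.range (N + 1), (n ! : ℚ)⁻¹ • p n) r := by
  rw [sum_apply]
  refine Finset.sum_subset (f := fun n => ((n ! : ℚ)⁻¹ • p n) r)
    (Finset.range_mono (by omega)) fun n _ hn => ?_
  rw [smul_apply, hp n r (by simpa using hn), ratFun_smul_def, mul_zero]

/-- Up to any given depth the series agrees with a finite partial sum, and a map preserving the
filtration cannot bring the remainder down. -/
theorem map_egf (T : Mould →ₗ[ℚ] Mould) (hT : ∀ k, ∀ P ∈ van k, T P ∈ van k) {p : ℕ → Mould}
    (hp : ∀ n, p n ∈ van n) : T (egf p) = egf fun n => T (p n) := by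
  funext r
  have h : egf p - ∑ n ∈ Finset.range (r + 1), (n ! : ℚ)⁻¹ • p n ∈ van (r + 1) := by
    intro i hi
    rw [sub_apply, egf_eq hp (Nat.lt_succ_iff.1 hi), sub_self]
  have h2 := hT _ _ h r (Nat.lt_succ_self r)
  rw [map_sub, sub_apply, sub_eq_zero] at h2
  rw [h2, map_sum, sum_apply]
  simp only [map_smul]
  rfl

theorem egf_add (p s : ℕ → Mould) : egf (fun n => p n + s n) = egf p + egf s := by
  funext r
  rw [add_apply, egf, egf, egf, ← Finset.sum_add_distrib]
  refine Finset.sum_congr rfl fun n _ => ?_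
  simp only [ratFun_smul_def, add_apply, mul_add]

theorem egf_smul (c : ℚ) (p : ℕ → Mould) : egf (fun n => c • p n) = c • egf p := by
  funext r
  rw [smul_apply, ratFun_smul_def, egf, egf, Finset.mul_sum]
  refine Finset.sum_congr rfl fun n _ => ?_
  simp only [ratFun_smul_def, smul_apply, mul_left_comm]

theorem scale_egf (c : ∀ r, RatFun r) (p : ℕ → Mould) :
    scale c (egf p) = egf fun n => scale c (p n) := by
  funext r
  rw [scale_apply, egf, egf, Finset.mul_sum]
  refine Finset.sum_congr rfl fun n _ => ?_
  rw [scale_apply, ratFun_smul_def, ratFun_smul_def, mul_left_comm]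

theorem egf_apply_zero (p : ℕ → Mould) : egf p 0 = p 0 0 := by
  simp [egf]

theorem egf_single {p : ℕ → Mould} (M : Mould) (h0 : p 0 = M) (h : ∀ n, p (n + 1) = 0) :
    egf p = M := by
  funext r
  rw [egf, Finset.sum_range_succ', Finset.sum_eq_zero fun n _ => by
    rw [h, zero_apply, ratFun_smul_def, mul_zero], h0, ratFun_smul_def]
  simp

theorem egf_egf {f : ℕ → ℕ → Mould} (hf : ∀ i j, f i j ∈ van (i + j)) :
    egf (fun i => egf (f i)) = egf fun n =>
      ∑ ij ∈ Finset.HasAntidiagonal.antidiagonal n, n.choose ij.1 • f ij.1 ij.2 := by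
  funext r
  -- Passing to the quotient by moulds of order above `r` makes the terms with `i + j > r` literally
  -- zero.
  have h := sum_range_sum_range_eq (fun i j => (van (r + 1)).mkQ (f i j)) r fun i j hij =>
    (Submodule.Quotient.mk_eq_zero _).2 (van_mono hij (hf i j))
  simp only [← map_nsmul, ← map_smul, ← map_sum] at h
  have h2 := (Submodule.Quotient.eq _).1 h r (Nat.lt_succ_self r)
  rw [sub_apply, sub_eq_zero, sum_apply, sum_apply] at h2
  refine Eq.trans ?_ h2
  refine Finset.sum_congr rfl fun i _ => ?_
  beta_reduce
  rw [egf_eq (fun j => van_mono (Nat.le_add_left j i) (hf i j)) le_rfl, ← smul_apply,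
    Finset.smul_sum]
  simp only [smul_smul]

theorem iterate_mem_van {T : Mould → Mould} (hT : ∀ k, ∀ P ∈ van k, T P ∈ van (k + 1))
    (P : Mould) (n : ℕ) : T^[n] P ∈ van n := by
  induction n with
  | zero => exact mem_van_zero P
  | succ n ih =>
    rw [Function.iterate_succ_apply']
    exact hT n _ ih

/-- The derivation `arit(F)` as a linear map. -/
def aritL (F : Mould) : Mould →ₗ[ℚ] Mould where
  toFun := arit F
  map_add' := arit_add F
  map_smul' := arit_smul F

theorem aritL_mem_van {F : Mould} (hF : F ∈ ARI) (k : ℕ) (P : Mould) (hP : P ∈ van k) :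
    aritL F P ∈ van (k + 1) := by
  rw [add_comm]
  exact arit_mem_van (mem_van_one.2 hF) hP

theorem geq_aritL_iterate (F M : Mould) (n : ℕ) : GEq (L := L) ((aritL F)^[n] M).eval
    ((derL (bracketLetter F.eval))^[n] M.eval) := by
  induction n with
  | zero => exact GEq.rfl
  | succ n ih =>
    rw [Function.iterate_succ_apply', Function.iterate_succ_apply']
    exact (geq_arit _ _).trans (ih.derW GEq.rfl)

theorem geq_exp_aritL (F M : Mould) : GEq (L := L) (egf fun n => (aritL F)^[n] M).eval
    (expW (bracketLetter F.eval) M.eval) := by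
  refine (geq_egf _).trans fun w hw => Finset.sum_congr rfl fun n _ => congrArg _ ?_
  exact geq_aritL_iterate F M n w hw

theorem exp_aritL {F : Mould} (hF : F ∈ ARI) (M : Mould) :
    egf (fun n => (aritL F)^[n] M) = comp M (egf fun n => (aritL F)^[n] letterMould) := by
  refine Mould.ext_geq fun r => (geq_exp_aritL F M).trans <|
    GEq.trans (GEq.of_eq (expW_eq_compW (bracketLetter_wvan (eval_nil_of_mem_ARI hF)) _)) <|
    GEq.trans (GEq.rfl.compW ?_) (geq_comp _ _).symm
  refine GEq.trans ?_ (geq_exp_aritL F letterMould).symm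
  have h : ∀ n, GEq (L := RatFun r) ((derL (bracketLetter F.eval))^[n] letter)
      ((derL (bracketLetter F.eval))^[n] letterMould.eval) := by
    intro n
    induction n with
    | zero => exact geq_letterMould.symm
    | succ n ih =>
      rw [Function.iterate_succ_apply', Function.iterate_succ_apply']
      exact ih.derW GEq.rfl
  intro w hw
  unfold expW egfW
  simp only [h _ w hw]

/-- The linear map `preari(·, G)`. -/
def preariL (G : Mould) : Mould →ₗ[ℚ] Mould where
  toFun M := preari M G
  map_add' M N := by
    rw [preari, preari, preari, arit_add, add_mu]
    abel
  map_smul' c M := by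
    rw [preari, preari, arit_smul, smul_mu, ← smul_add, RingHom.id_apply]

theorem preariL_apply (G M : Mould) : preariL G M = M * G + arit G M := rfl

theorem preari_mem_van {i j : ℕ} {M G : Mould} (hM : M ∈ van i) (hG : G ∈ van j) :
    preari M G ∈ van (i + j) :=
  add_mem (mul_mem_van hM hG) (add_comm j i ▸ arit_mem_van hG hM)

theorem preariL_mem_van {G : Mould} (hG : G ∈ ARI) (k : ℕ) (P : Mould) (hP : P ∈ van k) :
    preariL G P ∈ van (k + 1) :=
  preari_mem_van hP (mem_van_one.2 hG)

theorem preariPow_eq (G : Mould) (n : ℕ) : preariPow G n = (preariL G)^[n] 1 := by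
  induction n with
  | zero => rfl
  | succ n ih =>
    rw [Function.iterate_succ_apply', ← ih]
    rfl

theorem expAri_eq (G : Mould) : expAri G = egf fun n => (preariL G)^[n] 1 := by
  funext r
  simp only [expAri, egf, preariPow_eq]

theorem preariL_mul (G M N : Mould) : preariL G (M * N) = arit G M * N + M * preariL G N := by
  rw [preariL_apply, preariL_apply, arit_mul]
  noncomm_ring

theorem expAri_mem_GARI (G : Mould) : expAri G ∈ GARI := by
  change expAri G 0 = 1
  rw [expAri_eq, egf_apply_zero]
  rfl

section Flow

variable {G : Mould} (hG : G ∈ ARI)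
include hG

theorem exp_preariL_mul (M N : Mould) : egf (fun n => (preariL G)^[n] (M * N)) =
    egf (fun n => (aritL G)^[n] M) * egf fun n => (preariL G)^[n] N := by
  rw [egf_mul (iterate_mem_van (aritL_mem_van hG) M) (iterate_mem_van (preariL_mem_van hG) N)]
  congr 1
  ext1 n
  refine iterate_leibniz (preariL G).toAddMonoidHom
    (fun i j => (aritL G)^[i] M * (preariL G)^[j] N) (fun i j => ?_) n
  simp only [Function.iterate_succ_apply']
  exact preariL_mul _ _ _

/-- With b the letter, T(Xb) = XbG + arit(G)(X) b + X(Gb - bG) = T(X) b: the commutator in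
`arit_letter` moves the right factor `G` past b. -/
theorem preariL_iterate_letter (n : ℕ) :
    (preariL G)^[n] letterMould = (preariL G)^[n] 1 * letterMould := by
  induction n with
  | zero => exact (one_mul _).symm
  | succ n ih =>
    rw [Function.iterate_succ_apply', Function.iterate_succ_apply', ih, preariL_apply, arit_mul,
      arit_letter hG, preariL_apply]
    noncomm_ring

/-- Two evaluations of exp(T) at the letter b are compared, one from b = b·1 and the multiplicative
rule, the other from T(Xb) = T(X) b. -/
theorem exp_aritL_letter :
    egf (fun n => (aritL G)^[n] letterMould) = conjLetter (expAri G) := by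
  have h1 := exp_preariL_mul hG letterMould 1
  rw [mul_one] at h1
  simp only [preariL_iterate_letter hG] at h1
  have h2 := map_egf (LinearMap.mulRight ℚ letterMould)
    (fun k P hP => van_mono (Nat.le_add_right k 0) (mul_mem_van hP (mem_van_zero letterMould)))
    (iterate_mem_van (preariL_mem_van hG) 1)
  simp only [LinearMap.mulRight_apply] at h2
  rw [← h2, ← expAri_eq] at h1
  rw [conjLetter, ← mul_assoc, h1, mul_assoc, mul_invmu (expAri_mem_GARI G), mul_one]

theorem exp_preariL (M : Mould) : egf (fun n => (preariL G)^[n] M) =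
    comp M (conjLetter (expAri G)) * expAri G := by
  have h := exp_preariL_mul hG M 1
  rwa [mul_one, exp_aritL hG, exp_aritL_letter hG, ← expAri_eq] at h

theorem preariL_neg_iterate (n : ℕ) :
    (preariL (-G))^[n] 1 = (-1 : ℚ) ^ n • (preariL G)^[n] 1 := by
  have h : ∀ M, preariL (-G) M = (-1 : ℚ) • preariL G M := fun M => by
    have := smul_arit (-1) G M
    rw [neg_one_smul, neg_one_smul] at this
    rw [preariL_apply, preariL_apply, this, neg_one_smul]
    noncomm_ring
  induction n with
  | zero => simp
  | succ n ih =>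
    rw [Function.iterate_succ_apply', Function.iterate_succ_apply', ih, h, map_smul, smul_smul,
      pow_succ']

/-- By `exp_preariL` the left side is exp(T) applied to exp(-T)(1), because replacing `G` by `-G`
negates T = preari(·, G). -/
theorem comp_expAri_neg_mul :
    comp (expAri (-G)) (conjLetter (expAri G)) * expAri G = 1 := by
  have hv := iterate_mem_van (preariL_mem_van hG) 1
  have hT : ∀ n k, ∀ P ∈ van k, ((preariL G) ^ n) P ∈ van k := by
    intro n k P hP
    rw [Module.End.pow_apply]
    induction n with
    | zero => exact hP
    | succ n ih =>
      rw [Function.iterate_succ_apply']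
      exact van_mono (Nat.le_succ k) (preariL_mem_van hG _ _ ih)
  rw [← exp_preariL hG]
  have h1 : ∀ n, (preariL G)^[n] (expAri (-G)) =
      egf fun m => (-1 : ℚ) ^ m • (preariL G)^[n + m] 1 := by
    intro n
    rw [expAri_eq]
    simp only [preariL_neg_iterate hG]
    rw [← Module.End.pow_apply, map_egf _ (hT n) fun m => (van m).smul_mem _ (hv m)]
    congr 1
    ext1 m
    rw [map_smul, Module.End.pow_apply, ← Function.iterate_add_apply]
  simp only [h1]
  rw [egf_egf fun n m => (van _).smul_mem _ (hv (n + m))]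
  have h3 : ∀ n, ∑ ij ∈ Finset.HasAntidiagonal.antidiagonal n,
      n.choose ij.1 • (-1 : ℚ) ^ ij.2 • (preariL G)^[ij.1 + ij.2] 1 =
        (0 : ℚ) ^ n • (preariL G)^[n] 1 := by
    intro n
    -- The signed binomial sum is (1 - 1)ⁿ, so only the term of index zero survives.
    have h4 := Commute.add_pow' (Commute.all (1 : ℚ) (-1)) n
    rw [add_neg_cancel] at h4
    rw [h4, Finset.sum_smul]
    refine Finset.sum_congr rfl fun ij hij => ?_
    rw [Finset.HasAntidiagonal.mem_antidiagonal.1 hij, one_pow, one_mul, smul_assoc]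
  simp only [h3]
  exact egf_single _ (one_smul _ _) fun n => by rw [zero_pow n.succ_ne_zero, zero_smul]

end Flow

end Exponential

/-! ### The derivation `arit - ad` -/

section Inner

/-- The derivation `arit(G) - ad(G)`. -/
def innerL (G : Mould) : Mould →ₗ[ℚ] Mould :=
  preariL G - LinearMap.mulLeft ℚ G

theorem innerL_apply (G M : Mould) : innerL G M = M * G + arit G M - G * M := rfl

variable {G : Mould} (hG : G ∈ ARI)
include hG

theorem innerL_mem_van (k : ℕ) (P : Mould) (hP : P ∈ van k) : innerL G P ∈ van (k + 1) :=
  sub_mem (preariL_mem_van hG k P hP) (add_comm 1 k ▸ mul_mem_van (mem_van_one.2 hG) hP)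

omit hG in
-- A second Leibniz rule: the term `M * G * N` occurs in the first summand and is cancelled by the
-- ad part of the second.
theorem preariL_mul_inner (M N : Mould) :
    preariL G (M * N) = preariL G M * N + M * innerL G N := by
  rw [preariL_apply, preariL_apply, innerL_apply, arit_mul]
  noncomm_ring

theorem exp_innerL (N : Mould) : egf (fun n => (innerL G)^[n] N) =
    invmu (expAri G) * (comp N (conjLetter (expAri G)) * expAri G) := by
  have h : expAri G * egf (fun n => (innerL G)^[n] N) = egf fun n => (preariL G)^[n] N := by
    rw [expAri_eq, egf_mul (iterate_mem_van (preariL_mem_van hG) 1)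
      (iterate_mem_van (innerL_mem_van hG) N)]
    congr 1
    ext1 n
    have := iterate_leibniz (preariL G).toAddMonoidHom
      (fun i j => (preariL G)^[i] 1 * (innerL G)^[j] N) (fun i j => by
        simp only [Function.iterate_succ_apply']
        exact preariL_mul_inner _ _) n
    simp only [Function.iterate_zero, id, one_mul] at this
    exact this.symm
  rw [← exp_preariL hG, ← h, ← mul_assoc, invmu_mul (expAri_mem_GARI G), one_mul]

omit hG in
/-- The sequence `0, dur(G), S(dur(G)), S²(dur(G)), …` with `S = innerL G`. -/
def durSeq (G : Mould) : ℕ → Mould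
  | 0 => 0
  | n + 1 => (innerL G)^[n] (dur G)

theorem durSeq_mem_van (n : ℕ) : durSeq G n ∈ van n := by
  cases n with
  | zero => exact mem_van_zero _
  | succ n =>
    have h : ∀ m, (innerL G)^[m] (dur G) ∈ van (m + 1) := by
      intro m
      induction m with
      | zero => exact scale_mem_van _ (mem_van_one.2 hG)
      | succ m ih =>
        rw [Function.iterate_succ_apply']
        exact innerL_mem_van hG _ _ ih
    exact h n

omit hG in
theorem dur_preariL (M : Mould) : dur (preariL G M) = preariL G (dur M) + M * dur G := by
  have h : dur (M * G + arit G M) = dur (M * G) + dur (arit G M) := map_add (scale _) _ _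
  rw [preariL_apply, preariL_apply, h, dur_mul, ← arit_dur]
  abel

omit hG in
-- By `dur_preariL`, moving `dur` past one preari creates a source term ending in dur(G). Later
-- applications of preari act on that product through `preariL_mul_inner`, which is why `durSeq`
-- iterates `innerL` on dur(G).
theorem dur_preariL_iterate (n : ℕ) : dur ((preariL G)^[n] 1) =
    ∑ ij ∈ Finset.HasAntidiagonal.antidiagonal n,
      n.choose ij.1 • ((preariL G)^[ij.1] 1 * durSeq G ij.2) := by
  induction n with
  | zero =>
    have : dur 1 = 0 := by
      have h := dur_mul 1 1
      simpa using h
    simp [this, durSeq]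
  | succ n ih =>
    -- The sequence starts from zero and receives its only source at the first step; that source
    -- matches the term produced by `dur_preariL`.
    have hs : ∀ j, durSeq G (j + 1) = innerL G (durSeq G j) + if j = 0 then dur G else 0 := by
      intro j
      cases j with
      | zero => simp [durSeq]
      | succ j => simp [durSeq, Function.iterate_succ_apply']
    have hlast : ∑ ij ∈ Finset.HasAntidiagonal.antidiagonal n, n.choose ij.1 •
        ((preariL G)^[ij.1] 1 * if ij.2 = 0 then dur G else 0) = (preariL G)^[n] 1 * dur G := by
      rw [Finset.sum_eq_single (n, 0)]
      · simp
      · rintro ⟨i, j⟩ hij hne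
        have hj : j ≠ 0 := by
          rintro rfl
          exact hne (by simpa using hij)
        simp [hj]
      · intro h
        simp at h
    rw [Function.iterate_succ_apply', dur_preariL, ih, Finset.sum_antidiagonal_choose_succ_nsmul
      (fun i j => (preariL G)^[i] 1 * durSeq G j), map_sum, ← hlast, ← Finset.sum_add_distrib,
      ← Finset.sum_add_distrib]
    refine Finset.sum_congr rfl fun ij hij => ?_
    rw [← Nat.choose_symm_of_eq_add (Finset.HasAntidiagonal.mem_antidiagonal.1 hij).symm,
      map_nsmul, preariL_mul_inner, hs, Function.iterate_succ_apply', mul_add, smul_add, smul_add]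
    abel

theorem egf_durSeq : egf (durSeq G) = du (expAri G) := by
  have h : expAri G * egf (durSeq G) = dur (expAri G) := by
    rw [expAri_eq, egf_mul (iterate_mem_van (preariL_mem_van hG) 1) (durSeq_mem_van hG)]
    simp only [← dur_preariL_iterate, dur_eq_scale, scale_egf]
  change _ = invmu (expAri G) * dur (expAri G)
  rw [← h, ← mul_assoc, invmu_mul (expAri_mem_GARI G), one_mul]

end Inner

/-! ### The operators `darit` and `dgaritA` -/

theorem arit_neg (F M : Mould) : arit (-F) M = -arit F M := by
  simpa using smul_arit (-1) F M

theorem darit_delta (F M : Mould) : darit (delta F) M = dar (innerL (-F) (darInv M)) := by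
  rw [darit, deltaInv_delta, innerL_apply, arit_neg]
  have h : ∀ X, -dar X = dar (-X) := fun X => (map_neg (scale _) X).symm
  rw [h]
  congr 1
  change -(arit F (darInv M) - (F * darInv M - darInv M * F)) = _
  noncomm_ring

/-- The generator `a` goes to ΔF = dar(dur F) = -dar(dur(-F)). From then on Darit acts as the
`dar`-conjugate of `innerL (-F)`, which reproduces `durSeq (-F)` with a minus sign. -/
theorem daritA_iterate {F : Mould} (hF : F ∈ ARI) (n : ℕ) (x : Mould × ℚ) :
    ((daritA (delta F))^[n] x).1 =
      dar ((innerL (-F))^[n] (darInv x.1) - if n = 0 then 0 else x.2 • durSeq (-F) n) := by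
  have hdar : ∀ X Y, dar (X + Y) = dar X + dar Y := fun X Y => map_add (scale _) X Y
  have hInv : ∀ X Y, darInv (X + Y) = darInv X + darInv Y := fun X Y => map_add (scale _) X Y
  have hInvs : ∀ (c : ℚ) X, darInv (c • X) = c • darInv X := fun c X => map_smul (scale _) c X
  have hneg : dur (-F) = -dur F := map_neg (scale _) F
  induction n generalizing x with
  | zero => simp [dar_darInv]
  | succ n ih =>
    rw [Function.iterate_succ_apply, ih]
    congr 1
    simp only [daritA, zero_smul, ite_self, sub_zero, if_neg n.succ_ne_zero, durSeq]
    rw [darit_delta, delta_eq_dar_dur hF, hInv, hInvs, darInv_dar, darInv_dar, hneg,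
      Function.iterate_succ_apply, iterate_map_neg, iterate_map_add, smul_neg, sub_neg_eq_add,
      ← Module.End.pow_apply (innerL (-F)) n (x.2 • dur F), map_smul, Module.End.pow_apply]

theorem egf_daritA {F : Mould} (hF : F ∈ ARI) (x : Mould × ℚ) :
    egf (fun n => ((daritA (delta F))^[n] x).1) =
      dar (invmu (expAri (-F)) * (comp (darInv x.1) (conjLetter (expAri (-F))) * expAri (-F))
        - x.2 • du (expAri (-F))) := by
  have hF' : -F ∈ ARI := mem_van_one.1 (neg_mem (mem_van_one.2 hF))
  have h : ∀ n, (if n = 0 then 0 else x.2 • durSeq (-F) n) = x.2 • durSeq (-F) n := by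
    intro n
    split_ifs with h
    · subst h
      simp [durSeq]
    · rfl
  simp only [daritA_iterate hF, h]
  rw [dar_eq_scale, ← scale_egf, ← exp_innerL hF', ← egf_durSeq hF', ← egf_smul,
    sub_eq_add_neg (egf _), ← neg_one_smul ℚ (egf _), ← egf_smul (-1), ← egf_add]
  simp only [sub_eq_add_neg, neg_one_smul]

theorem daritA_iterate_a (P : Mould) (n : ℕ) :
    ((daritA P)^[n + 1] (0, 1)).1 = (darit P)^[n] P := by
  have hz : darit P 0 = 0 := by
    have h := darit_delta (deltaInv P) 0
    rw [delta_deltaInv] at h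
    have h0 : darInv 0 = 0 := map_zero (scale _)
    have h1 : dar 0 = 0 := map_zero (scale _)
    rw [h, h0, map_zero, h1]
  have h : ∀ n M, (daritA P)^[n] (M, 0) = ((darit P)^[n] M, 0) := by
    intro n
    induction n with
    | zero => intro M; rfl
    | succ n ih =>
      intro M
      rw [Function.iterate_succ_apply, Function.iterate_succ_apply]
      simp only [daritA, zero_smul, add_zero]
      exact ih _
  rw [Function.iterate_succ_apply]
  simp only [daritA, one_smul, hz, zero_add]
  exact congrArg Prod.fst (h n P)

/-- The sequence whose exponential generating function is `exp_Dari(P)`. -/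
def daritSeq (P : Mould) : ℕ → Mould
  | 0 => 1
  | n + 1 => (darit P)^[n] P

theorem expDari_eq_egf (P : Mould) : expDari P = egf (daritSeq P) := by
  funext r
  rw [expDari, egf, Finset.sum_range_succ', add_comm, Finset.range_eq_Ico, Finset.sum_Ico_add'
    (fun n => ((n ! : ℚ)⁻¹) • (daritSeq P n) r) 0 r 1]
  have h : Finset.Icc 1 r = Finset.Ico (0 + 1) (r + 1) := by
    ext
    simp
  rw [h]
  congr 1
  · refine Finset.sum_congr rfl fun n hn => ?_
    obtain ⟨n, rfl⟩ : ∃ k, n = k + 1 := ⟨n - 1, by simp at hn; omega⟩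
    rfl
  · rw [ratFun_smul_def]
    simp [daritSeq]

theorem expDari_eq_add (P : Mould) :
    expDari P = 1 + egf fun n => ((daritA P)^[n] (0, 1)).1 := by
  have h : daritSeq P = fun n => (if n = 0 then 1 else 0) + ((daritA P)^[n] (0, 1)).1 := by
    ext1 n
    cases n with
    | zero => exact (add_zero _).symm
    | succ n => rw [daritA_iterate_a, if_neg n.succ_ne_zero, zero_add, daritSeq]
  rw [expDari_eq_egf, h, egf_add, egf_single (p := fun n => if n = 0 then 1 else 0) 1 rfl]
  intro n
  rfl

theorem expDari_delta {F : Mould} (hF : F ∈ ARI) :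
    expDari (delta F) = 1 - dar (du (expAri (-F))) := by
  have h0 : darInv 0 = 0 := map_zero (scale _)
  have hc : ∀ K, comp 0 K = 0 := fun K => by simpa using comp_smul 0 0 K
  have hn : ∀ X, dar (-X) = -dar X := fun X => map_neg (scale _) X
  rw [expDari_eq_add, egf_daritA hF, h0, hc, zero_mul, mul_zero, one_smul, zero_sub, hn,
    sub_eq_add_neg]

/-! ### Bijectivity of the exponential maps -/

/-- Terms of index at least two differ only from depth `k + 1` on, so the linear term governs the
difference in depth `k`. -/
theorem egf_sub_mem_van {p q : ℕ → Mould} {k : ℕ} (hk : 1 ≤ k) (h0 : p 0 = q 0)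
    (h : ∀ n, p (n + 1) - q (n + 1) ∈ van (k + n)) :
    egf p - egf q - (p 1 - q 1) ∈ van (k + 1) := by
  have hd : ∀ n, p n - q n ∈ van n := by
    intro n
    cases n with
    | zero => exact mem_van_zero _
    | succ n => exact van_mono (by omega) (h n)
  have he : egf p - egf q = egf fun n => p n - q n := by
    have := egf_add (fun n => p n) fun n => (-1 : ℚ) • q n
    rw [egf_smul] at this
    simpa [sub_eq_add_neg] using this.symm
  intro r hr
  rw [he, sub_apply, egf_eq hd (Nat.le_add_right r 1), Finset.sum_range_succ',
    Finset.sum_range_succ', add_apply, add_apply, sum_apply, Finset.sum_eq_zero fun n _ => ?_, h0]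
  · simp
  · rw [smul_apply, h (n + 1) r (by omega), ratFun_smul_def, mul_zero]

/-- A contraction principle for the depth filtration: the iterates of zero stabilize in each depth.
-/
theorem exists_fixed {Ψ : Mould → Mould} (hΨ : ∀ P ∈ ARI, Ψ P ∈ ARI)
    (h : ∀ k, 1 ≤ k → ∀ P ∈ ARI, ∀ Q ∈ ARI, P - Q ∈ van k → Ψ P - Ψ Q ∈ van (k + 1)) :
    ∃ P ∈ ARI, Ψ P = P := by
  have hmem : ∀ n, Ψ^[n] 0 ∈ ARI := by
    intro n
    induction n with
    | zero => rfl
    | succ n ih =>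
      rw [Function.iterate_succ_apply']
      exact hΨ _ ih
  have hstep : ∀ n, Ψ^[n + 1] 0 - Ψ^[n] 0 ∈ van (n + 1) := by
    intro n
    induction n with
    | zero => exact sub_mem (mem_van_one.2 (hmem 1)) (mem_van_one.2 (hmem 0))
    | succ n ih =>
      rw [Function.iterate_succ_apply', Function.iterate_succ_apply' Ψ n]
      rw [Function.iterate_succ_apply'] at ih
      exact h _ (by omega) _ (Function.iterate_succ_apply' Ψ n 0 ▸ hmem (n + 1)) _ (hmem n) ih
  have hstab : ∀ n m, n ≤ m → Ψ^[m] 0 - Ψ^[n] 0 ∈ van (n + 1) := by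
    intro n m hnm
    induction m, hnm using Nat.le_induction with
    | base => simp
    | succ m hm ih =>
      have := add_mem (van_mono (by omega) (hstep m)) ih
      simpa using this
  -- Depth `r` no longer changes after the `r`-th iterate, so the limit is the diagonal.
  let P : Mould := fun r => Ψ^[r] 0 r
  have hP : ∀ n, P - Ψ^[n] 0 ∈ van (n + 1) := by
    intro n r hr
    have := hstab r n (by omega) r (Nat.lt_succ_self r)
    rw [sub_apply, sub_eq_zero] at this ⊢
    exact this.symm
  have hPm : P ∈ ARI := rfl
  refine ⟨P, hPm, van_ext fun k => ?_⟩
  have h1 := h (k + 1) (by omega) P hPm _ (hmem k) (hP k)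
  rw [← Function.iterate_succ_apply' Ψ] at h1
  have h2 := sub_mem h1 (van_mono (Nat.le_refl _) (hP (k + 1)))
  simp only [sub_sub_sub_cancel_right] at h2
  exact van_mono (by omega) h2

/-- The map is the identity plus one up to higher order. Hence equal values improve the agreement of
the arguments by one depth at a time, and P ↦ Q - egf(p P) + P is a contraction whose fixed point is
a preimage of `Q`. -/
theorem bijOn_egf {p : Mould → ℕ → Mould} (h0 : ∀ P, p P 0 = 1) (h1 : ∀ P, p P 1 = P)
    (h : ∀ k, 1 ≤ k → ∀ P ∈ ARI, ∀ Q ∈ ARI, P - Q ∈ van k →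
      ∀ n, p P (n + 1) - p Q (n + 1) ∈ van (k + n)) :
    Set.BijOn (fun P => egf (p P)) ARI GARI := by
  have hd : ∀ k, 1 ≤ k → ∀ P ∈ ARI, ∀ Q ∈ ARI, P - Q ∈ van k →
      egf (p P) - egf (p Q) - (P - Q) ∈ van (k + 1) := by
    intro k hk P hP Q hQ hPQ
    have := egf_sub_mem_van hk ((h0 P).trans (h0 Q).symm) (h k hk P hP Q hQ hPQ)
    rwa [h1, h1] at this
  have hg : ∀ P, egf (p P) 0 = 1 := fun P => by
    rw [egf_apply_zero, h0]
    rfl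
  refine ⟨fun P _ => hg P, ?_, ?_⟩
  · intro P hP Q hQ hPQ
    refine van_ext fun k => ?_
    induction k with
    | zero => exact mem_van_zero _
    | succ k ih =>
      rcases Nat.eq_zero_or_pos k with rfl | hk
      · exact sub_mem (mem_van_one.2 hP) (mem_van_one.2 hQ)
      · have := hd k hk P hP Q hQ ih
        beta_reduce at hPQ
        rw [hPQ, sub_self, zero_sub] at this
        exact neg_mem_iff.1 this
  · intro Q hQ
    have hQ : Q 0 = 1 := hQ
    obtain ⟨P, hP, hPQ⟩ := exists_fixed (Ψ := fun P => Q - egf (p P) + P)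
      (fun P hP => by
        have hP : P 0 = 0 := hP
        change Q 0 - egf (p P) 0 + P 0 = 0
        rw [hg, hQ, hP, sub_self, add_zero])
      (fun k hk P hP R hR hPR => by
        have := neg_mem (hd k hk P hP R hR hPR)
        convert this using 1
        abel)
    refine ⟨P, hP, ?_⟩
    have : Q - egf (p P) = 0 := by simpa using hPQ
    exact (sub_eq_zero.1 this).symm

theorem preariL_sub_left (P Q M : Mould) :
    preariL P M - preariL Q M = M * (P - Q) + arit (P - Q) M := by
  have h := add_arit (P - Q) Q M
  rw [sub_add_cancel] at h
  rw [preariL_apply, preariL_apply, h]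
  noncomm_ring

theorem bijOn_expAri : Set.BijOn expAri ARI GARI := by
  have he : expAri = fun P => egf (preariPow P) := rfl
  rw [he]
  have h1 : ∀ P, preariPow P 1 = P := fun P => by
    change 1 * P + arit P 1 = P
    rw [arit_one, one_mul, add_zero]
  refine bijOn_egf (fun P => rfl) h1 fun k hk P hP Q hQ hPQ n => ?_
  induction n with
  | zero => rwa [h1, h1, add_zero]
  | succ n ih =>
    have e : preariPow P (n + 1 + 1) - preariPow Q (n + 1 + 1) =
        preariL P (preariPow P (n + 1) - preariPow Q (n + 1)) +
          preari (preariPow Q (n + 1)) (P - Q) := by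
      rw [map_sub]
      change _ = _ + (preariPow Q (n + 1) * (P - Q) + arit (P - Q) (preariPow Q (n + 1)))
      rw [← preariL_sub_left, sub_add_sub_cancel]
      rfl
    rw [e]
    refine add_mem (preariL_mem_van hP _ _ ih) ?_
    have hv : preariPow Q (n + 1) ∈ van (n + 1) := by
      rw [preariPow_eq]
      exact iterate_mem_van (preariL_mem_van hQ) 1 _
    exact van_mono (by omega) (preari_mem_van hv hPQ)

theorem darit_sub_mem_van {i j : ℕ} {P Q M : Mould} (hPQ : P - Q ∈ van i) (hM : M ∈ van j) :
    darit P M - darit Q M ∈ van (i + j) := by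
  have e : darit P M - darit Q M = dar (innerL (-(deltaInv (P - Q))) (darInv M)) := by
    have h1 := darit_delta (deltaInv P) M
    have h2 := darit_delta (deltaInv Q) M
    rw [delta_deltaInv] at h1 h2
    have h3 : deltaInv (P - Q) = deltaInv P - deltaInv Q := map_sub (scale _) _ _
    have h4 : ∀ X Y, dar X - dar Y = dar (X - Y) := fun X Y => (map_sub (scale _) _ _).symm
    have h5 := add_arit (-(deltaInv P - deltaInv Q)) (-deltaInv Q) (darInv M)
    have h6 : -(deltaInv P - deltaInv Q) + -deltaInv Q = -deltaInv P := by abel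
    rw [h6] at h5
    rw [h1, h2, h3, h4, innerL_apply, innerL_apply, innerL_apply, h5]
    congr 1
    noncomm_ring
  rw [e]
  refine scale_mem_van _ ?_
  have hF : -(deltaInv (P - Q)) ∈ van i := neg_mem (scale_mem_van _ hPQ)
  have hN : darInv M ∈ van j := scale_mem_van _ hM
  exact sub_mem (add_comm j i ▸ preari_mem_van hN hF) (mul_mem_van hF hN)

theorem darit_sub_right (P M N : Mould) : darit P M - darit P N = darit P (M - N) := by
  have h := fun M => darit_delta (deltaInv P) M
  simp only [delta_deltaInv] at h
  have h4 : ∀ X Y, dar X - dar Y = dar (X - Y) := fun X Y => (map_sub (scale _) _ _).symm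
  have h5 : darInv (M - N) = darInv M - darInv N := map_sub (scale _) _ _
  rw [h, h, h, h4, h5, map_sub]

theorem darit_mem_van {i j : ℕ} {P M : Mould} (hP : P ∈ van i) (hM : M ∈ van j) :
    darit P M ∈ van (i + j) := by
  have h0 : darit 0 M = 0 := by
    have h := darit_delta 0 M
    have h1 : delta 0 = 0 := map_zero (scale _)
    have h2 : dar 0 = 0 := map_zero (scale _)
    have h3 := smul_arit 0 0 (darInv M)
    simp only [zero_smul] at h3
    rw [h1, neg_zero, innerL_apply, h3] at h
    simpa [h2] using h
  have h := darit_sub_mem_van (P := P) (Q := 0) (by simpa using hP) hM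
  rwa [h0, sub_zero] at h

theorem bijOn_expDari : Set.BijOn expDari ARI GARI := by
  have he : expDari = fun P => egf (daritSeq P) := funext expDari_eq_egf
  rw [he]
  refine bijOn_egf (fun P => rfl) (fun P => rfl) fun k hk P hP Q hQ hPQ n => ?_
  induction n with
  | zero => exact hPQ
  | succ n ih =>
    have hs : ∀ R m, daritSeq R (m + 1 + 1) = darit R (daritSeq R (m + 1)) := fun R m =>
      Function.iterate_succ_apply' _ _ _
    have hv : ∀ m, daritSeq Q (m + 1) ∈ van (m + 1) := by
      intro m
      induction m with
      | zero => exact mem_van_one.2 hQ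
      | succ m ih =>
        rw [hs, add_comm (m + 1)]
        exact darit_mem_van (mem_van_one.2 hQ) ih
    have h1 : darit P (daritSeq P (n + 1) - daritSeq Q (n + 1)) ∈ van (k + (n + 1)) :=
      van_mono (by omega) (darit_mem_van (mem_van_one.2 hP) ih)
    have h2 : darit P (daritSeq Q (n + 1)) - darit Q (daritSeq Q (n + 1)) ∈ van (k + (n + 1)) :=
      darit_sub_mem_van hPQ (hv n)
    rw [hs, hs]
    have := add_mem h1 h2
    rwa [← darit_sub_right, sub_add_sub_cancel] at this

/-! ### The group `(GARI, gari)` -/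

theorem gari_eq (P : Mould) {Q : Mould} (hQ : Q ∈ GARI) :
    gari P Q = comp P (conjLetter Q) * Q := by
  rw [gari, garit_eq_comp hQ]
  rfl

theorem gari_mem {P Q : Mould} (hP : P ∈ GARI) (hQ : Q ∈ GARI) : gari P Q ∈ GARI := by
  rw [gari_eq P hQ]
  exact mul_mem_GARI (comp_mem_GARI hP _) hQ

theorem invmu_mul_rev {P Q : Mould} (hP : P ∈ GARI) (hQ : Q ∈ GARI) :
    invmu (P * Q) = invmu Q * invmu P := by
  have h1 := mul_invmu (mul_mem_GARI hP hQ)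
  have h2 : invmu Q * invmu P * (P * Q) = 1 := by
    rw [mul_assoc, ← mul_assoc (invmu P), invmu_mul hP, one_mul, invmu_mul hQ]
  exact (left_inv_eq_right_inv h2 h1).symm

theorem comp_invmu {P : Mould} (hP : P ∈ GARI) (K : Mould) :
    comp (invmu P) K = invmu (comp P K) := by
  refine left_inv_eq_right_inv ?_ (mul_invmu (comp_mem_GARI hP K))
  rw [← comp_mul, invmu_mul hP, comp_one]

/-- Substitution is multiplicative and sends the letter to the conjugate by `Q`; multiplying by `Q`
then only extends the conjugation. Associativity of gari rests on this. -/
theorem conjLetter_gari {P Q : Mould} (hP : P ∈ GARI) (hQ : Q ∈ GARI) :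
    conjLetter (gari P Q) = comp (conjLetter P) (conjLetter Q) := by
  have hc : ∀ X, conjLetter X = X * (letterMould * invmu X) := fun _ => rfl
  rw [gari_eq P hQ, hc (comp P (conjLetter Q) * Q), invmu_mul_rev (comp_mem_GARI hP _) hQ, hc P,
    comp_mul, comp_mul, letter_comp (conjLetter_mem_ARI Q), comp_invmu hP]
  change _ = comp P (conjLetter Q) *
    (Q * (letterMould * invmu Q) * invmu (comp P (conjLetter Q)))
  simp only [mul_assoc]

theorem gari_assoc (P : Mould) {Q R : Mould} (hQ : Q ∈ GARI) (hR : R ∈ GARI) :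
    gari (gari P Q) R = gari P (gari Q R) := by
  rw [gari_eq _ hR, gari_eq P (gari_mem hQ hR), conjLetter_gari hQ hR, gari_eq P hQ, comp_mul,
    comp_assoc, gari_eq Q hR, mul_assoc]

theorem invmu_one : invmu 1 = 1 := by
  have := mul_invmu one_mem_GARI
  rwa [one_mul] at this

theorem one_gari {P : Mould} (hP : P ∈ GARI) : gari 1 P = P := by
  rw [gari_eq 1 hP, comp_one, one_mul]

theorem gari_one (P : Mould) : gari P 1 = P := by
  rw [gari_eq P one_mem_GARI, mul_one, conjLetter, one_mul, invmu_one, mul_one, comp_letter]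

theorem neg_mem_ARI {P : Mould} (hP : P ∈ ARI) : -P ∈ ARI :=
  mem_van_one.1 (neg_mem (mem_van_one.2 hP))

theorem gari_expAri_neg {F : Mould} (hF : F ∈ ARI) : gari (expAri (-F)) (expAri F) = 1 := by
  rw [gari_eq _ (expAri_mem_GARI F)]
  exact comp_expAri_neg_mul hF

theorem isGroupLawOn_gari : IsGroupLawOn GARI gari 1 where
  mem _ hP _ hQ := gari_mem hP hQ
  assoc _ _ _ hQ _ hR := gari_assoc _ hQ hR
  one_mem := one_mem_GARI
  one_op _ hP := one_gari hP
  op_one P _ := gari_one P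
  inv P hP := by
    obtain ⟨F, hF, rfl⟩ := bijOn_expAri.surjOn hP
    have h := gari_expAri_neg (neg_mem_ARI hF)
    rw [neg_neg] at h
    exact ⟨expAri (-F), expAri_mem_GARI _, h, gari_expAri_neg hF⟩

theorem invGari_spec {P : Mould} (hP : P ∈ GARI) :
    invGari P ∈ GARI ∧ gari P (invGari P) = 1 ∧ gari (invGari P) P = 1 :=
  Classical.epsilon_spec (isGroupLawOn_gari.inv P hP)

theorem eq_invGari {P Q : Mould} (hP : P ∈ GARI) (h : gari Q P = 1) :
    Q = invGari P := by
  obtain ⟨h1, h2, -⟩ := invGari_spec hP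
  rw [← gari_one Q, ← h2, ← gari_assoc _ hP h1, h, one_gari h1]

theorem invGari_expAri {F : Mould} (hF : F ∈ ARI) : invGari (expAri F) = expAri (-F) :=
  (eq_invGari (expAri_mem_GARI F) (gari_expAri_neg hF)).symm

theorem invGari_invGari {P : Mould} (hP : P ∈ GARI) : invGari (invGari P) = P :=
  (eq_invGari (invGari_spec hP).1 (invGari_spec hP).2.1).symm

theorem invGari_gari {P Q : Mould} (hP : P ∈ GARI) (hQ : Q ∈ GARI) :
    invGari (gari P Q) = gari (invGari Q) (invGari P) := by
  obtain ⟨p1, -, p3⟩ := invGari_spec hP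
  obtain ⟨q1, -, q3⟩ := invGari_spec hQ
  refine (eq_invGari (gari_mem hP hQ) ?_).symm
  rw [gari_assoc _ p1 (gari_mem hP hQ), ← gari_assoc _ hP hQ, p3, one_gari hQ, q3]

/-! ### The isomorphism `Δ*` -/

theorem logAri_expAri {F : Mould} (hF : F ∈ ARI) : logAri (expAri F) = F :=
  bijOn_expAri.injOn.leftInvOn_invFunOn hF

theorem bijOn_logAri : Set.BijOn logAri GARI ARI :=
  (bijOn_expAri.invOn_invFunOn.symm).bijOn bijOn_expAri.surjOn.mapsTo_invFunOn bijOn_expAri.mapsTo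

theorem logDari_expDari {F : Mould} (hF : F ∈ ARI) : logDari (expDari F) = F :=
  bijOn_expDari.injOn.leftInvOn_invFunOn hF

theorem deltaStar_expAri {F : Mould} (hF : F ∈ ARI) :
    deltaStar (expAri F) = expDari (delta F) := by
  rw [deltaStar, logAri_expAri hF]

theorem bijOn_deltaStar : Set.BijOn deltaStar GARI GARI :=
  bijOn_expDari.comp (bijOn_delta.comp bijOn_logAri)

theorem deltaStar_eq {Q : Mould} (hQ : Q ∈ GARI) : deltaStar Q = 1 - dar (du (invGari Q)) := by
  obtain ⟨F, hF, rfl⟩ := bijOn_expAri.surjOn hQ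
  rw [deltaStar_expAri hF, expDari_delta hF, invGari_expAri hF]

/-- The logarithmic derivative of a product, together with the fact that `dur` commutes with
substitution. -/
theorem du_gari {P Q : Mould} (hP : P ∈ GARI) (hQ : Q ∈ GARI) :
    du (gari P Q) = invmu Q * (comp (du P) (conjLetter Q) * Q) + du Q := by
  have hd : ∀ X, du X = invmu X * dur X := fun X => rfl
  have hc := comp_mem_GARI hP (conjLetter Q)
  rw [gari_eq P hQ, hd, hd, hd, invmu_mul_rev hc hQ, dur_mul, dur_comp, comp_mul, comp_invmu hP,
    mul_add, mul_assoc, mul_assoc, mul_assoc, ← mul_assoc (invmu (comp P _)) (comp P _) (dur Q),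
    invmu_mul hc, one_mul]

theorem dgaritA_fst (P : Mould) (x : Mould × ℚ) :
    (dgaritA P x).1 = egf fun n => ((daritA (logDari P))^[n] x).1 := rfl

theorem dgaritA_deltaStar {Q : Mould} (hQ : Q ∈ GARI) (x : Mould × ℚ) :
    (dgaritA (deltaStar Q) x).1 = dar (invmu (invGari Q) *
      (comp (darInv x.1) (conjLetter (invGari Q)) * invGari Q) - x.2 • du (invGari Q)) := by
  obtain ⟨F, hF, rfl⟩ := bijOn_expAri.surjOn hQ
  rw [dgaritA_fst, deltaStar_expAri hF, logDari_expDari (delta_mem_ARI hF), egf_daritA hF,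
    invGari_expAri hF]

/-- Inversion reverses the factors, so the cocycle rule is applied to (Q⁻¹, P⁻¹). Its first term is
then the action of Dgarit(Δ*P) on the mould part of Dgarit(Δ*Q)·a, and its second term comes from
`a`. -/
theorem deltaStar_gari {P Q : Mould} (hP : P ∈ GARI) (hQ : Q ∈ GARI) :
    deltaStar (gari P Q) = dgari (deltaStar P) (deltaStar Q) := by
  have h0 : darInv 0 = 0 := map_zero (scale _)
  have hc : ∀ K, comp 0 K = 0 := fun K => by simpa using comp_smul 0 0 K
  have hcn : ∀ X K, comp (-X) K = -comp X K := fun X K => by simpa using comp_smul (-1) X K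
  have hn : ∀ X, dar (-X) = -dar X := fun X => map_neg (scale _) X
  have h2 : (dgaritA (deltaStar Q) (0, 1)).2 = 1 := rfl
  have p1 := (invGari_spec hP).1
  have q1 := (invGari_spec hQ).1
  rw [deltaStar_eq (gari_mem hP hQ), invGari_gari hP hQ, du_gari q1 p1, dgari,
    dgaritA_deltaStar hP, dgaritA_deltaStar hQ, h2, darInv_dar, h0, hc, zero_mul, mul_zero,
    one_smul, one_smul, zero_sub, hcn, neg_mul, mul_neg, sub_eq_add_neg (1 : Mould), ← hn]
  congr 2
  abel

theorem isGroupLawOn_of_bijOn {α β : Type*} {S : Set α} {T : Set β} {op : α → α → α}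
    {op' : β → β → β} {e : α} {f : α → β} (h : IsGroupLawOn S op e) (hf : Set.BijOn f S T)
    (hop : ∀ x ∈ S, ∀ y ∈ S, f (op x y) = op' (f x) (f y)) : IsGroupLawOn T op' (f e) where
  mem := by
    intro x hx' y hy'
    obtain ⟨x, hx, rfl⟩ := hf.surjOn hx'
    obtain ⟨y, hy, rfl⟩ := hf.surjOn hy'
    rw [← hop x hx y hy]
    exact hf.mapsTo (h.mem x hx y hy)
  assoc := by
    intro x hx' y hy' z hz'
    obtain ⟨x, hx, rfl⟩ := hf.surjOn hx'
    obtain ⟨y, hy, rfl⟩ := hf.surjOn hy'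
    obtain ⟨z, hz, rfl⟩ := hf.surjOn hz'
    rw [← hop x hx y hy, ← hop _ (h.mem x hx y hy) z hz, ← hop y hy z hz,
      ← hop x hx _ (h.mem y hy z hz), h.assoc x hx y hy z hz]
  one_mem := hf.mapsTo h.one_mem
  one_op := by
    intro x hx'
    obtain ⟨x, hx, rfl⟩ := hf.surjOn hx'
    rw [← hop _ h.one_mem x hx, h.one_op x hx]
  op_one := by
    intro x hx'
    obtain ⟨x, hx, rfl⟩ := hf.surjOn hx'
    rw [← hop x hx _ h.one_mem, h.op_one x hx]
  inv := by
    intro x hx'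
    obtain ⟨x, hx, rfl⟩ := hf.surjOn hx'
    obtain ⟨y, hy, h1, h2⟩ := h.inv x hx
    exact ⟨f y, hf.mapsTo hy, by rw [← hop x hx y hy, h1], by rw [← hop y hy x hx, h2]⟩

theorem deltaStar_one : deltaStar 1 = 1 := by
  have h1 : invGari 1 = 1 := (eq_invGari one_mem_GARI (gari_one 1)).symm
  have h2 : du 1 = 0 := by
    have h : dur 1 = 0 := by simpa using dur_mul 1 1
    change invmu 1 * dur 1 = 0
    rw [h, mul_zero]
  have h3 : dar 0 = 0 := map_zero (scale _)
  rw [deltaStar_eq one_mem_GARI, h1, h2, h3, sub_zero]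

theorem isGroupLawOn_dgari : IsGroupLawOn GARI dgari 1 := by
  have h := isGroupLawOn_of_bijOn isGroupLawOn_gari bijOn_deltaStar
    fun _ hP _ hQ => deltaStar_gari hP hQ
  rwa [deltaStar_one] at h

/-! ### The mould `pal` -/

theorem pal_succ (r : ℕ) : pal (r + 1) = (∑ i : Fin (r + 1), u i)⁻¹ *
    ∑ i : Fin (r + 1), subst (pal i) (fun k : Fin (i : ℕ) => u (r := r + 1) (k.castLE i.2.le))
      * dupal.eval ((genericWord (r + 1)).drop i) := by
  rw [pal]

theorem pal_mem_GARI : pal ∈ GARI := by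
  change pal 0 = 1
  rw [pal]

theorem dupal_mem_ARI : dupal ∈ ARI := by
  change dupal 0 = 0
  rw [dupal, ratFun_smul_def]
  simp

theorem dur_pal : dur pal = pal * dupal := by
  funext r
  cases r with
  | zero =>
    have h : dupal 0 = 0 := dupal_mem_ARI
    rw [mul_apply_zero, h, mul_zero, dur_apply, genericWord_zero, List.sum_nil, zero_mul]
  | succ r =>
    -- The product also contains the cutting with empty right chunk, absent from the recursion for
    -- `pal`; this makes it vanish.
    have h0 : dupal.eval ([] : List (RatFun (r + 1))) = 0 := eval_nil_of_mem_ARI dupal_mem_ARI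
    rw [dur_apply, sum_genericWord, pal_succ, mul_inv_cancel_left₀ (sum_u_ne_zero r.succ_ne_zero),
      mul_apply, wmul, tmul, splits_eq_map_range, length_genericWord, List.map_map,
      List.range_succ, List.map_append, List.sum_append, List.map_singleton, List.sum_singleton,
      Function.comp_apply, List.drop_of_length_le (length_genericWord (r + 1)).le, h0, mul_zero,
      add_zero, ← List.map_coe_finRange_eq_range, List.map_map, ← List.ofFn_eq_map, List.sum_ofFn]
    refine Finset.sum_congr rfl fun i _ => ?_
    simp only [Function.comp_apply]
    congr 1
    have h : (genericWord (r + 1)).take i =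
        List.ofFn fun k : Fin (i : ℕ) => u (r := r + 1) (k.castLE i.2.le) := by
      refine List.ext_getElem ?_ fun n h1 h2 => ?_
      · simp [length_genericWord]
      · simp only [genericWord, List.getElem_take, List.getElem_ofFn]
        rfl
    rw [h, eval_ofFn]

theorem du_pal : du pal = dupal := by
  change invmu pal * dur pal = dupal
  rw [dur_pal, ← mul_assoc, invmu_mul pal_mem_GARI, one_mul]

theorem deltaStar_invpal : deltaStar invpal = 1 - dar dupal := by
  have h := invGari_spec pal_mem_GARI
  rw [invpal, deltaStar_eq h.1, invGari_invGari pal_mem_GARI, du_pal]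

/-! ### The ring of power series in two non-commuting variables -/

instance : Module ℚ NCSeries := inferInstanceAs (Module ℚ (List (Fin 2) → ℚ))

theorem ncMul_eq_wmul (f g : NCSeries) : ncMul f g = wmul (α := Fin 2) f g := rfl

theorem ncOne_eq_wone : (1 : NCSeries) = wone (α := Fin 2) := by
  funext w
  cases w <;> rfl

local instance : Mul NCSeries := ⟨ncMul⟩

theorem ncAdd_mul (f g h : NCSeries) : ncMul (f + g) h = ncMul f h + ncMul g h :=
  tmul_add_left (α := Fin 2) (R := ℚ) f g (fun _ => h)

theorem ncMul_add (f g h : NCSeries) : ncMul f (g + h) = ncMul f g + ncMul f h :=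
  tmul_add_right (α := Fin 2) (R := ℚ) f (fun _ => g) (fun _ => h)

local instance : Ring NCSeries :=
  { (inferInstance : AddCommGroup NCSeries) with
    mul := ncMul
    one := 1
    mul_assoc := wmul_assoc (α := Fin 2)
    one_mul := fun f => by
      change ncMul 1 f = f
      rw [ncMul_eq_wmul, ncOne_eq_wone]
      exact one_wmul (α := Fin 2) f
    mul_one := fun f => by
      change ncMul f 1 = f
      rw [ncMul_eq_wmul, ncOne_eq_wone]
      exact wmul_one (α := Fin 2) f
    left_distrib := ncMul_add
    right_distrib := ncAdd_mul
    zero_mul := fun f => by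
      have h := ncAdd_mul 0 0 f
      rw [add_zero] at h
      exact left_eq_add.1 h
    mul_zero := fun f => by
      have h := ncMul_add f 0 0
      rw [add_zero] at h
      exact left_eq_add.1 h }

theorem ncAd_eq (f g : NCSeries) : ncAd f g = f * g - g * f := rfl

theorem nc_add_apply (f g : NCSeries) (w : List (Fin 2)) : (f + g) w = f w + g w := rfl
theorem nc_sub_apply (f g : NCSeries) (w : List (Fin 2)) : (f - g) w = f w - g w := rfl
theorem nc_neg_apply (f : NCSeries) (w : List (Fin 2)) : (-f) w = -f w := rfl

theorem nc_sum_apply {ι : Type*} (s : Finset ι) (f : ι → NCSeries) (w : List (Fin 2)) :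
    (∑ i ∈ s, f i) w = ∑ i ∈ s, f i w := by
  induction s using Finset.cons_induction with
  | empty => rfl
  | cons a s ha ih => rw [Finset.sum_cons, Finset.sum_cons, nc_add_apply, ih]

theorem nc_mul_apply_cons (f g : NCSeries) (x : Fin 2) (w : List (Fin 2)) :
    (f * g) (x :: w) = f [] * g (x :: w) + ncMul (fun v => f (x :: v)) g w :=
  tmul_cons (α := Fin 2) (R := ℚ) f (fun _ => g) x w

theorem ncWord_singleton_mul (x y : Fin 2) (f : NCSeries) (w : List (Fin 2)) :
    (ncWord [x] * f) (y :: w) = if y = x then f w else 0 := by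
  rw [nc_mul_apply_cons]
  have h0 : ncWord [x] [] = 0 := by simp [ncWord]
  have h1 : (fun v => ncWord [x] (y :: v)) = if y = x then (1 : NCSeries) else 0 := by
    funext v
    split_ifs with h
    · subst h
      cases v <;> simp [ncWord, ncOne_eq_wone, wone]
    · simp [ncWord, h]
      rfl
  rw [h0, zero_mul, zero_add, h1]
  split_ifs
  · exact congrFun (one_mul f) w
  · exact congrFun (zero_mul f) w

/-- The series only involves words with `m` letters `b`. -/
def IsHomog (m : ℕ) (f : NCSeries) : Prop := ∀ w, w.count 1 ≠ m → f w = 0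

theorem IsHomog.mul {m k : ℕ} {f g : NCSeries} (hf : IsHomog m f) (hg : IsHomog k g) :
    IsHomog (m + k) (f * g) := by
  intro w hw
  refine List.sum_eq_zero fun y hy => ?_
  obtain ⟨p, hp, rfl⟩ := List.mem_map.1 hy
  rw [← mem_splits.1 hp, List.count_append] at hw
  by_cases h : p.1.count 1 = m
  · rw [hg p.2 (by omega), mul_zero]
  · rw [hf p.1 h, zero_mul]

theorem IsHomog.sub {m : ℕ} {f g : NCSeries} (hf : IsHomog m f) (hg : IsHomog m g) :
    IsHomog m (f - g) := fun w hw => by rw [nc_sub_apply, hf w hw, hg w hw, sub_zero]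

theorem IsHomog.neg {m : ℕ} {f : NCSeries} (hf : IsHomog m f) : IsHomog m (-f) :=
  fun w hw => by rw [nc_neg_apply, hf w hw, neg_zero]

theorem isHomog_sa : IsHomog 0 sa := by
  intro w hw
  refine if_neg ?_
  rintro rfl
  simp at hw

theorem isHomog_sb : IsHomog 1 sb := by
  intro w hw
  refine if_neg ?_
  rintro rfl
  simp at hw

theorem isHomog_ncAd_iterate (n : ℕ) : IsHomog n ((ncAd (-sb))^[n] sa) := by
  induction n with
  | zero => exact isHomog_sa
  | succ n ih =>
    rw [Function.iterate_succ_apply', ncAd_eq]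
    exact (add_comm 1 n ▸ isHomog_sb.neg.mul ih).sub (ih.mul isHomog_sb.neg)

/-- One bracket turns `a` into C₂ = [a, b]; the remaining ones are differences of commuting left and
right multiplications, expanded binomially. -/
theorem ncAd_iterate_succ (n : ℕ) : (ncAd (-sb))^[n + 1] sa =
    ∑ i : Fin (n + 1), ((-1) ^ (i : ℕ) * (n.choose i : ℚ)) •
      (sb ^ (i : ℕ) * (genC 1 * sb ^ (n - i))) := by
  have h1 : ncAd (-sb) sa = genC 1 := by
    change ncAd (-sb) sa = ncAd sa sb
    rw [ncAd_eq, ncAd_eq]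
    noncomm_ring
  let T : NCSeries →+ NCSeries :=
    AddMonoidHom.mulLeft (-sb) - AddMonoidHom.mulRight (-sb)
  have h2 := iterate_leibniz T (fun i j => (-sb) ^ i * (genC 1 * sb ^ j)) (fun i j => by
    change -sb * ((-sb) ^ i * (genC 1 * sb ^ j)) - ((-sb) ^ i * (genC 1 * sb ^ j)) * -sb = _
    rw [pow_succ', pow_succ]
    noncomm_ring) n
  rw [pow_zero, pow_zero, one_mul, mul_one] at h2
  rw [Function.iterate_succ_apply, h1]
  refine Eq.trans h2 ?_
  rw [Finset.Nat.sum_antidiagonal_eq_sum_range_succ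
    (fun i j => n.choose i • ((-sb) ^ i * (genC 1 * sb ^ j))), Finset.sum_range]
  refine Finset.sum_congr rfl fun i _ => ?_
  have hs : ∀ (c : ℚ) (f g : NCSeries), c • f * g = c • (f * g) := fun c f g =>
    tmul_smul_left (α := Fin 2) (R := ℚ) c f (fun _ => g)
  have h3 : (-sb) ^ (i : ℕ) = (-1 : ℚ) ^ (i : ℕ) • sb ^ (i : ℕ) := by
    rcases Nat.even_or_odd (i : ℕ) with h | h
    · rw [h.neg_pow, h.neg_one_pow, one_smul]
    · rw [h.neg_pow, h.neg_one_pow, neg_one_smul]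
  rw [h3, hs, mul_comm, mul_smul, Nat.cast_smul_eq_nsmul]

/-! ### The monomials in the `C_i` -/

/-- The monomial `C_{k₁+1}⋯C_{k_r+1}` indexed by a list. -/
def monList (l : List ℕ) : NCSeries := (l.map genC).prod

theorem monC_eq {r : ℕ} (k : Fin r → ℕ) : monC k = monList (List.ofFn k) := by
  rw [monList, List.map_ofFn]
  rfl

/-- The word `a^{m₁}b⋯a^{m_r}b`. -/
def leadWord (l : List ℕ) : List (Fin 2) := l.flatMap fun m => List.replicate m 0 ++ [1]

theorem count_leadWord (l : List ℕ) : (leadWord l).count 1 = l.length := by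
  induction l with
  | nil => rfl
  | cons m l ih =>
    rw [leadWord, List.flatMap_cons, List.count_append, ← leadWord, ih, List.count_append,
      List.count_replicate]
    simp [add_comm]

/-- Words of ad(a)ᵏ(b) contain `k` letters `a` and one `b`. Only aᵏb, with coefficient one, has all
the `a` in front, and none has more than `k` in front. -/
theorem genC_mul_apply (k m : ℕ) (hkm : k ≤ m) (f : NCSeries) (w : List (Fin 2)) :
    (genC k * f) (List.replicate m 0 ++ 1 :: w) = if k = m then f w else 0 := by
  induction k generalizing m f with
  | zero =>
    change (ncWord [1] * f) _ = _
    cases m with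
    | zero => simp [ncWord_singleton_mul]
    | succ m => simp [List.replicate_succ, ncWord_singleton_mul]
  | succ k ih =>
    obtain ⟨m, rfl⟩ : ∃ j, m = j + 1 := ⟨m - 1, by omega⟩
    have h : genC (k + 1) = sa * genC k - genC k * sa := Function.iterate_succ_apply' _ _ _
    rw [h, sub_mul, nc_sub_apply, mul_assoc, mul_assoc, ih (m + 1) (by omega),
      if_neg (by omega), sub_zero, List.replicate_succ, List.cons_append, sa,
      ncWord_singleton_mul, if_pos rfl, ih m (by omega)]
    simp

theorem monList_leadWord (l m : List ℕ) (hl : l.length = m.length) (h : l ≤ m) :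
    monList l (leadWord m) = if l = m then 1 else 0 := by
  induction l generalizing m with
  | nil =>
    obtain rfl : m = [] := List.length_eq_zero_iff.1 hl.symm
    rfl
  | cons k l ih =>
    cases m with
    | nil => simp at hl
    | cons n m =>
      have h' : k < n ∨ k = n ∧ l ≤ m := by
        rcases h.lt_or_eq with h | h
        · rcases List.cons_lt_cons_iff.1 h with h | h
          · exact Or.inl h
          · exact Or.inr ⟨h.1, h.2.le⟩
        · simp at h
          exact Or.inr ⟨h.1, h.2.le⟩
      have e1 : monList (k :: l) = genC k * monList l := by simp [monList]
      have e2 : leadWord (n :: m) = List.replicate n 0 ++ 1 :: leadWord m := by simp [leadWord]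
      rw [e1, e2, genC_mul_apply k n (by omega)]
      rcases h' with h' | ⟨rfl, h'⟩
      · rw [if_neg (by omega), if_neg (by simp; omega)]
      · rw [if_pos rfl, ih m (by simpa using hl) h']
        simp

theorem toNC_apply (g : SeriesC) (w : List (Fin 2)) : g.toNC w =
    Finsupp.linearCombination ℚ (fun k => monC k w) (g (w.count 1)) := rfl

/-- The monomials are triangular for the lexicographic order. At the leading word of the largest
exponent in the support of a difference, every other monomial of the support vanishes. -/
theorem toNC_injective : Function.Injective SeriesC.toNC := by
  intro g g' hg
  funext r
  by_contra hne
  have hne' : (g r - g' r).support.Nonempty :=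
    Finsupp.support_nonempty_iff.2 (sub_ne_zero.2 hne)
  obtain ⟨k, hk, hmax⟩ := Finset.exists_max_image _ (fun k => List.ofFn k) hne'
  have hcount : (leadWord (List.ofFn k)).count 1 = r := by
    rw [count_leadWord, List.length_ofFn]
  -- The depth is read off as a letter count, equal to `r` only propositionally, hence the
  -- generalization.
  have h : ∀ (s : ℕ) (hs : s = r) (w : List (Fin 2)),
      Finsupp.linearCombination ℚ (fun k => monC k w) (g s) =
        Finsupp.linearCombination ℚ (fun k => monC k w) (g' s) →
      Finsupp.linearCombination ℚ (fun k : Fin r → ℕ => monC k w) (g r - g' r) = 0 := by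
    rintro s rfl w hw
    rw [map_sub, hw, sub_self]
  have h2 := h _ hcount (leadWord (List.ofFn k)) (congrFun hg _)
  rw [Finsupp.linearCombination_apply, Finsupp.sum, Finset.sum_eq_single k] at h2
  · rw [monC_eq, monList_leadWord _ _ rfl le_rfl, if_pos rfl, smul_eq_mul, mul_one] at h2
    exact Finsupp.mem_support_iff.1 hk h2
  · intro k' hk' hne
    rw [monC_eq, monList_leadWord _ _ (by simp) (hmax k' hk'), if_neg, smul_zero]
    exact fun h => hne (List.ofFn_injective h)
  · exact fun h => absurd hk h

/-! ### The series `1 - a + Ber_{-b}(a)` -/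

/-- The element of `ℚ⟨C⟩` representing `1 - a + Ber_{-b}(a)`. -/
def berSeries : SeriesC
  | 0 => Finsupp.single 0 1
  | n + 1 => (bernoulli (n + 1) / ((n + 1)! : ℚ)) • ∑ i : Fin (n + 1),
      ((-1) ^ (i : ℕ) * (n.choose i : ℚ)) • Finsupp.single (Pi.single i 1) 1

theorem ofFn_single (n : ℕ) (i : Fin (n + 1)) : List.ofFn (Pi.single i 1 : Fin (n + 1) → ℕ) =
    List.replicate i 0 ++ 1 :: List.replicate (n - i) 0 := by
  refine List.ext_getElem ?_ fun m h1 h2 => ?_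
  · simp
    omega
  · rw [List.getElem_ofFn, List.getElem_append, Pi.single_apply]
    simp only [Fin.ext_iff, List.length_replicate, List.getElem_replicate, List.getElem_cons]
    split_ifs <;> first | rfl | omega

theorem monC_single (n : ℕ) (i : Fin (n + 1)) :
    monC (Pi.single i 1 : Fin (n + 1) → ℕ) = sb ^ (i : ℕ) * (genC 1 * sb ^ (n - i)) := by
  have h0 : genC 0 = sb := rfl
  rw [monC_eq, ofFn_single, monList]
  simp [h0]

theorem berSeries_toNC : berSeries.toNC = 1 - sa + ber (-sb) sa := by
  funext w
  rw [toNC_apply, nc_add_apply, nc_sub_apply]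
  -- Each ad(-b) adds one letter `b`, so a word selects the single index equal to its number of `b`.
  -- In depth zero this contributes `a`, cancelling the `-a`.
  have hber : ber (-sb) sa w =
      bernoulli (w.count 1) / ((w.count 1)! : ℚ) * ((ncAd (-sb))^[w.count 1] sa) w := by
    refine Finset.sum_eq_single _ (fun m _ hm => ?_) fun h => ?_
    · rw [isHomog_ncAd_iterate m w (Ne.symm hm), mul_zero]
    · exact absurd (Finset.mem_range.2 (Nat.lt_succ_of_le (List.count_le_length))) h
  rw [hber]
  generalize hr : w.count 1 = r
  cases r with
  | zero =>
    simp [berSeries, Finsupp.linearCombination_single]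
    rfl
  | succ n =>
    have h1 : (1 : NCSeries) w = 0 := by
      cases w with
      | nil => simp at hr
      | cons x w => rw [ncOne_eq_wone]; rfl
    rw [h1, isHomog_sa w (by omega), ncAd_iterate_succ, nc_sum_apply]
    simp only [berSeries, map_smul, map_sum, Finsupp.linearCombination_single, monC_single]
    simp only [smul_eq_mul, one_mul, sub_zero, zero_add]
    rfl

theorem ma_apply (g : SeriesC) (r : ℕ) : g.ma r = Finsupp.linearCombination ℚ
    (fun k : Fin r → ℕ => (-1 : RatFun r) ^ (∑ i, k i) * ∏ i, u i ^ k i) (g r) := rfl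

theorem berSeries_ma : berSeries.ma = 1 - dar dupal := by
  funext r
  rw [ma_apply, sub_apply, one_apply]
  cases r with
  | zero =>
    have h : dar dupal 0 = 0 := by
      have h : dupal 0 = 0 := dupal_mem_ARI
      rw [dar_apply, h, mul_zero]
    rw [h, berSeries, Finsupp.linearCombination_single]
    simp
  | succ n =>
    -- The exponents sum to one because each monomial has exactly one C₂; this gives the minus sign
    -- in front of `dar dupal`.
    have h : ∀ i : Fin (n + 1), (-1 : RatFun (n + 1)) ^ (∑ j, (Pi.single i 1 : Fin (n + 1) → ℕ) j) *
        ∏ j, u j ^ (Pi.single i 1 : Fin (n + 1) → ℕ) j = -u i := by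
      intro i
      simp [Pi.single_apply, pow_ite]
    rw [if_neg n.succ_ne_zero, zero_sub, berSeries, map_smul, map_sum]
    simp only [map_smul, Finsupp.linearCombination_single, h]
    simp only [ratFun_smul_def]
    rw [dar_apply, prod_genericWord, dupal, ratFun_smul_def, mul_left_comm,
      mul_inv_cancel_left₀ (prod_u_ne_zero _), ← mul_neg, ← Finset.sum_neg_distrib]
    simp

end MouldTheory

end

theorem proposition3p2p3 :
    -- `gari` and `Dgari` are group laws on `GARI`
    IsGroupLawOn GARI gari 1 ∧ IsGroupLawOn GARI dgari 1 ∧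
    -- `exp_ari` and `exp_Dari` are bijections from `ARI` to `GARI`
    Set.BijOn expAri ARI GARI ∧ Set.BijOn expDari ARI GARI ∧
    -- `Δ*` is an isomorphism from `(GARI, gari)` to `(GARI, Dgari)`
    Set.BijOn deltaStar GARI GARI ∧
    (∀ P ∈ GARI, ∀ Q ∈ GARI, deltaStar (gari P Q) = dgari (deltaStar P) (deltaStar Q)) ∧
    -- the formula for `Δ*`
    (∀ Q ∈ GARI, deltaStar Q = 1 - dar (du (invGari Q))) ∧
    -- `1 - a + Ber_{-b}(a)` lies in `ℚ⟨C⟩`, and `Δ*(invpal)` is its image under `ma`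
    (∃ g : SeriesC, g.toNC = 1 - sa + ber (-sb) sa) ∧
    (∀ g : SeriesC, g.toNC = 1 - sa + ber (-sb) sa → deltaStar invpal = g.ma) := by
  refine ⟨isGroupLawOn_gari, isGroupLawOn_dgari, bijOn_expAri, bijOn_expDari, bijOn_deltaStar,
    fun P hP Q hQ => deltaStar_gari hP hQ, fun Q hQ => deltaStar_eq hQ,
    ⟨berSeries, berSeries_toNC⟩, fun g hg => ?_⟩
  -- Injectivity identifies any representative with the explicit one.
  rw [toNC_injective (hg.trans berSeries_toNC.symm), berSeries_ma, deltaStar_invpal]
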